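/- Let $d\ge 3$. Let $X=(X_t)_{t\ge 0}$ be the continuous-time simple random walk on $\mathbb Z^d$ with unit jump rate, $P_x$ its law started at $x$ and $\zeta_0$ its first jump time. For finite $K\subset\mathbb Z^d$ let $\widetilde H_K=\inf\{t\ge\zeta_0: X_t\in K\}$, $e_K(x)=P_x[\widetilde H_K=\infty]\,1\{x\in K\}$, $e_K(A)=\sum_{y\in A}e_K(y)$, $\mathrm{cap}(K)=\sum_x e_K(x)$ and $\bar e_K=e_K/\mathrm{cap}(K)$. Let $\omega$, defined on a probability space with measure $\mathbb P$, be the continuous-time interlacement point process: a Poisson point process on $\widehat W^*\times\mathbb R_+$ with intensity $\nu(d\widehat w^*)\,du$, where $\widehat W^*$ is the space, modulo discrete time shift, of doubly-infinite transient nearest-neighbour trajectories $(w_n,\zeta_n)_{n\in\mathbb Z}$ on $\mathbb Z^d$ with positive holding times $\zeta_n$ having infinite forward and backward sums. The measure $\nu$ is characterized as follows: for every finite $K$, its restriction to the set of trajectories visiting $K$ is the image, under the projection modulo time shift, of the finite measure $\widehat Q_K$ on doubly-infinite trajectories for which $\widehat Q_K[w_0=x]=e_K(x)$ and, given $w_0=x$,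 the sequences $(w_n,\zeta_n)_{n\ge 0}$ and $(w_{-n},\zeta_{-n})_{n\ge 1}$ are independent, distributed respectively as the positions and holding times of the walk under $P_x$, and of the walk after its first jump under $P_x[\,\cdot\mid\widetilde H_K=\infty]$. For finite $\Sigma\subset\mathbb Z^d$ and $u\ge0$ let $\mu_{\Sigma,u}$ be the point measure on one-sided trajectories obtained from $\omega$ by retaining the points $(\widehat w^*,v)$ with $v\le u$ and $\widehat w^*$ visiting $\Sigma$, and mapping them to the onward trajectory from the first entrance in $\Sigma$. For integers $K\ge 100$, $L\ge 1$ let $D_z=z+([-3L,4L)\cap\mathbb Z)^d$, let $\mathcal C\subset L\mathbb Z^d$ be finite and non-empty, with distinct points at mutual $\ell^\infty$-distance at least $10KL$, and set $$\Sigma=\bigcup_{z\in\mathcal C}D_z,\qquad V(x)=\sum_{z\in\mathcal C}e_\Sigma(D_z)\,\bar e_{D_z}(x),\qquad h^u=\int\Big(\int_0^\infty V(X_s(w))\,ds\Big)\,\mu_{\Sigma,u}(dw).$$ Then there is a constant $c\in(0,\infty)$ depending only on $d$ such that for all $\varepsilon\in(0,1)$, all $u_-,u,u_+$ with $0<\frac{u_-}{1-\varepsilon}<u<\frac{u_+}{1+\varepsilon}$,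 all integers $L\ge1$ and $K\ge 100$ with $K\ge c/\varepsilon$, and all $\mathcal C$ as above, $$\mathbb P\big[h^u\ge u_+\,\mathrm{cap}(\Sigma)\big]\le\exp\Big(-\Big(\sqrt{\tfrac{u_+}{1+\varepsilon}}-\sqrt u\Big)^2\mathrm{cap}(\Sigma)\Big)$$ and $$\mathbb P\big[h^u\le u_-\,\mathrm{cap}(\Sigma)\big]\le\exp\Big(-\Big(\sqrt u-\sqrt{\tfrac{u_-}{1-\varepsilon}}\Big)^2\mathrm{cap}(\Sigma)\Big).$$ -/

import Mathlib

open MeasureTheory ProbabilityTheory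
open scoped ENNReal

noncomputable section

namespace Interlacement

/-! ### Trajectories -/

/-- The lattice `ℤ^d`; its norm in Mathlib is the `ℓ^∞`-norm. -/
abbrev Site (d : ℕ) : Type := Fin d → ℤ

/-- Nearest neighbours: the Euclidean distance is `1`. -/
def IsNeighbor {d : ℕ} (x y : Site d) : Prop := ∑ i, (x i - y i) ^ 2 = 1

/-- One-sided nearest-neighbour transient sequences `(w_n, ζ_n)`, `n ≥ 0`, with positive holding
times whose sum is infinite. -/
def forwardSet (d : ℕ) : Set (ℕ → Site d × ℝ) :=
  {w | (∀ n, IsNeighbor (w n).1 (w (n + 1)).1) ∧ (∀ n, 0 < (w n).2) ∧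
    (∀ x, {n | (w n).1 = x}.Finite) ∧ ∑' n, ENNReal.ofReal (w n).2 = ∞}

/-- Doubly-infinite nearest-neighbour transient sequences `(w_n, ζ_n)`, `n ∈ ℤ`, with positive
holding times whose backward and forward sums are infinite. -/
def twoSidedSet (d : ℕ) : Set (ℤ → Site d × ℝ) :=
  {w | (∀ n, IsNeighbor (w n).1 (w (n + 1)).1) ∧ (∀ n, 0 < (w n).2) ∧
    (∀ x, {n | (w n).1 = x}.Finite) ∧
    ∑' n : ℕ, ENNReal.ofReal (w (-(n : ℤ))).2 = ∞ ∧ ∑' n : ℕ, ENNReal.ofReal (w (n : ℤ)).2 = ∞}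

/-- The space of one-sided trajectories, with the σ-algebra of the coordinates. -/
abbrev ForwardPath (d : ℕ) : Type := forwardSet d

/-- The space of doubly-infinite trajectories, with the σ-algebra of the coordinates. -/
abbrev TwoSidedPath (d : ℕ) : Type := twoSidedSet d

lemma measurableSet_finite_fiber {ι : Type*} {d : ℕ} [Countable ι] (x : Site d) :
    MeasurableSet {w : ι → Site d × ℝ | {n | (w n).1 = x}.Finite} := by
  have h : {w : ι → Site d × ℝ | {n | (w n).1 = x}.Finite}
      = ⋃ s : Finset ι, ⋂ n : ι, {w | (w n).1 = x → n ∈ s} := by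
    ext w
    simp only [Set.mem_ofPred_eq, Set.mem_iUnion, Set.mem_iInter]
    constructor
    · intro hf
      exact ⟨hf.toFinset, fun n hn => by simpa using hn⟩
    · rintro ⟨s, hs⟩
      exact s.finite_toSet.subset fun n hn => hs n hn
  rw [h]
  refine MeasurableSet.iUnion fun s => MeasurableSet.iInter fun n => ?_
  have hm : Measurable fun w : ι → Site d × ℝ => (w n).1 := by fun_prop
  exact hm (MeasurableSet.of_discrete (s := {y | y = x → n ∈ s}))

lemma measurableSet_isNeighbor {ι : Type*} {d : ℕ} (m n : ι) :
    MeasurableSet {w : ι → Site d × ℝ | IsNeighbor (w m).1 (w n).1} := by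
  have hm : Measurable fun w : ι → Site d × ℝ => ((w m).1, (w n).1) := by fun_prop
  exact hm (MeasurableSet.of_discrete (s := {p : Site d × Site d | IsNeighbor p.1 p.2}))

lemma measurableSet_forwardSet (d : ℕ) : MeasurableSet (forwardSet d) := by
  have h1 : MeasurableSet {w : ℕ → Site d × ℝ | ∀ n, IsNeighbor (w n).1 (w (n + 1)).1} := by
    simp only [Set.ofPred_forall]
    exact MeasurableSet.iInter fun n => measurableSet_isNeighbor n (n + 1)
  have h2 : MeasurableSet {w : ℕ → Site d × ℝ | ∀ n, 0 < (w n).2} := by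
    simp only [Set.ofPred_forall]
    exact MeasurableSet.iInter fun n => measurableSet_lt measurable_const (by fun_prop)
  have h3 : MeasurableSet {w : ℕ → Site d × ℝ | ∀ x, {n | (w n).1 = x}.Finite} := by
    rw [Set.ofPred_forall]
    exact MeasurableSet.iInter fun x => measurableSet_finite_fiber x
  have h4 : MeasurableSet {w : ℕ → Site d × ℝ | ∑' n, ENNReal.ofReal (w n).2 = ∞} :=
    measurableSet_eq_fun (by fun_prop) measurable_const
  exact h1.inter (h2.inter (h3.inter h4))

lemma measurableSet_twoSidedSet (d : ℕ) : MeasurableSet (twoSidedSet d) := by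
  have h1 : MeasurableSet {w : ℤ → Site d × ℝ | ∀ n, IsNeighbor (w n).1 (w (n + 1)).1} := by
    simp only [Set.ofPred_forall]
    exact MeasurableSet.iInter fun n => measurableSet_isNeighbor n (n + 1)
  have h2 : MeasurableSet {w : ℤ → Site d × ℝ | ∀ n, 0 < (w n).2} := by
    simp only [Set.ofPred_forall]
    exact MeasurableSet.iInter fun n => measurableSet_lt measurable_const (by fun_prop)
  have h3 : MeasurableSet {w : ℤ → Site d × ℝ | ∀ x, {n | (w n).1 = x}.Finite} := by
    rw [Set.ofPred_forall]
    exact MeasurableSet.iInter fun x => measurableSet_finite_fiber x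
  have h4 : MeasurableSet
      {w : ℤ → Site d × ℝ | ∑' n : ℕ, ENNReal.ofReal (w (-(n : ℤ))).2 = ∞} :=
    measurableSet_eq_fun (by fun_prop) measurable_const
  have h5 : MeasurableSet {w : ℤ → Site d × ℝ | ∑' n : ℕ, ENNReal.ofReal (w (n : ℤ)).2 = ∞} :=
    measurableSet_eq_fun (by fun_prop) measurable_const
  exact h1.inter (h2.inter (h3.inter (h4.inter h5)))

/-! ### The simple random walk -/

/-- The uniform distribution on the `2d` unit vectors of `ℤ^d`. -/
def stepLaw (d : ℕ) : Measure (Site d) :=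
  (2 * d : ℝ≥0∞)⁻¹ • ∑ i : Fin d,
    (Measure.dirac (Pi.single i 1) + Measure.dirac (-Pi.single i 1))

/-- The sequence `(Y_n, ζ_n)` started at `x`, with the given increments and holding times. -/
def walkOfSteps {d : ℕ} (x : Site d) (s : ℕ → Site d × ℝ) : ℕ → Site d × ℝ :=
  fun n => (x + ∑ i ∈ Finset.range n, (s i).1, (s n).2)

/-- The law `P_x` on the space of one-sided trajectories: `Y` is the simple random walk started at
`x` and `ζ` is an independent sequence of i.i.d. exponential variables with parameter `1`.
(For `d ≥ 3` the sequences that are not in `forwardSet d` form a null set.) -/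
def walkLaw {d : ℕ} (x : Site d) : Measure (ForwardPath d) :=
  ((Measure.infinitePi fun _ : ℕ => (stepLaw d).prod (expMeasure 1)).map
    (walkOfSteps x)).comap Subtype.val

/-- The position `X_t`, for `t ≥ 0`: it is `w_k` when `∑_{i < k} ζ_i ≤ t < ∑_{i ≤ k} ζ_i`. -/
def position {d : ℕ} (w : ForwardPath d) (t : ℝ) : Site d :=
  (w.1 (sInf {k : ℕ | t < ∑ i ∈ Finset.range (k + 1), (w.1 i).2})).1

/-- The return time `inf {t ≥ ζ_0 : X_t ∈ K}`, which is `∞` when there is no such `t`. -/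
def returnTime {d : ℕ} (K : Finset (Site d)) (w : ForwardPath d) : ℝ≥0∞ :=
  ⨅ (t : ℝ) (_ : (w.1 0).2 ≤ t ∧ position w t ∈ K), ENNReal.ofReal t

/-! ### Potential theory -/

open Classical in
/-- The equilibrium measure `e_K(x) = P_x[no return to K] 1{x ∈ K}` of a finite set. -/
def equilibrium {d : ℕ} (K : Finset (Site d)) (x : Site d) : ℝ :=
  if x ∈ K then (walkLaw x).real {w | returnTime K w = ∞} else 0

/-- The capacity of a finite set: the total mass of its equilibrium measure. -/
def capacity {d : ℕ} (K : Finset (Site d)) : ℝ := ∑ x ∈ K, equilibrium K x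

/-- The normalized equilibrium measure. -/
def normalizedEquilibrium {d : ℕ} (K : Finset (Site d)) (x : Site d) : ℝ :=
  equilibrium K x / capacity K

/-! ### Doubly-infinite trajectories modulo time shift -/

/-- Two doubly-infinite trajectories are equivalent if they differ by a discrete time shift. -/
instance shiftSetoid (d : ℕ) : Setoid (TwoSidedPath d) where
  r v w := ∃ k : ℤ, ∀ n, v.1 n = w.1 (n + k)
  iseqv :=
    { refl := fun v => ⟨0, fun n => by simp⟩
      symm := by
        rintro v w ⟨k, h⟩
        exact ⟨-k, fun n => by rw [h (n + -k)]; simp⟩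
      trans := by
        rintro u v w ⟨k, h⟩ ⟨l, h'⟩
        exact ⟨k + l, fun n => by rw [h n, h' (n + k), add_assoc]⟩ }

/-- Trajectories modulo time shift. Its σ-algebra is the quotient one: a set is measurable if its
preimage in `TwoSidedPath d` is. -/
abbrev PathClass (d : ℕ) : Type := Quotient (shiftSetoid d)

/-- The trajectory visits `K`. -/
def Visits {d : ℕ} (K : Finset (Site d)) (w : TwoSidedPath d) : Prop := ∃ n, (w.1 n).1 ∈ K

/-- The set of trajectories modulo time shift that visit `K`. -/
def visiting {d : ℕ} (K : Finset (Site d)) : Set (PathClass d) :=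
  (Quotient.mk (shiftSetoid d)) '' {w | Visits K w}

/-- The (discrete) time of the first visit to `K`, for a trajectory that visits `K`. -/
def firstEntrance {d : ℕ} (K : Finset (Site d)) (w : TwoSidedPath d) : ℤ :=
  sInf {n | (w.1 n).1 ∈ K}

/-- The one-sided trajectory `(w_{k + n}, ζ_{k + n})`, `n ≥ 0`. -/
def forwardFrom {d : ℕ} (w : TwoSidedPath d) (k : ℤ) : ForwardPath d :=
  ⟨fun n => w.1 (k + n), by
    obtain ⟨h1, h2, h3, -, h5⟩ := w.2
    refine ⟨fun n => ?_, fun n => h2 _, fun x => ?_, ?_⟩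
    · have := h1 (k + n)
      rw [add_assoc] at this
      exact_mod_cast this
    · exact (h3 x).preimage (fun a _ b _ hab => by simpa using hab)
    · by_contra hne
      have hs : ∀ j : ℤ, (∑' n : ℕ, ENNReal.ofReal (w.1 (j + n)).2 ≠ ∞ ↔
          ∑' n : ℕ, ENNReal.ofReal (w.1 (j + 1 + n)).2 ≠ ∞) := by
        intro j
        rw [tsum_eq_zero_add' ENNReal.summable]
        have : ∀ n : ℕ, j + ((n + 1 : ℕ) : ℤ) = j + 1 + n := fun n => by push_cast; ring
        simp only [this, ne_eq, ENNReal.add_eq_top, ENNReal.ofReal_ne_top, false_or]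
      have key : ∑' n : ℕ, ENNReal.ofReal (w.1 (0 + n)).2 ≠ ∞ := by
        induction k using Int.induction_on with
        | zero => exact hne
        | succ i ih => exact ih ((hs _).2 hne)
        | pred i ih => exact ih (by have := (hs _).1 hne; simpa using this)
      simp only [zero_add] at key
      exact key h5⟩

lemma onward_aux {d : ℕ} (K : Finset (Site d)) {v w : TwoSidedPath d}
    (h : ∃ k : ℤ, ∀ n, v.1 n = w.1 (n + k)) (hv : Visits K v) :
    Visits K w ∧ forwardFrom v (firstEntrance K v) = forwardFrom w (firstEntrance K w) := by
  obtain ⟨k, hk⟩ := h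
  obtain ⟨m, hm⟩ := hv
  have hfin : {n | (w.1 n).1 ∈ K}.Finite := by
    have : {n | (w.1 n).1 ∈ K} = ⋃ x ∈ K, {n | (w.1 n).1 = x} := by ext; simp
    rw [this]
    exact K.finite_toSet.biUnion fun x _ => w.2.2.2.1 x
  have hne : {n | (w.1 n).1 ∈ K}.Nonempty := ⟨m + k, by simpa [hk] using hm⟩
  refine ⟨hne, ?_⟩
  have hmem := hne.csInf_mem hfin
  have hle : ∀ n, (w.1 n).1 ∈ K → sInf {n | (w.1 n).1 ∈ K} ≤ n :=
    fun n hn => csInf_le hfin.bddBelow hn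
  have hv' : IsLeast {n | (v.1 n).1 ∈ K} (sInf {n | (w.1 n).1 ∈ K} - k) := by
    constructor
    · simpa [hk] using hmem
    · intro n hn
      have := hle (n + k) (by simpa [hk] using hn)
      linarith
  have hE : firstEntrance K v = firstEntrance K w - k := hv'.csInf_eq
  apply Subtype.ext
  funext n
  simp only [forwardFrom, hE, hk]
  rw [show firstEntrance K w - k + (n : ℤ) + k = firstEntrance K w + n by ring]

open Classical in
/-- The onward trajectory upon the first entrance in `K`, for trajectories that visit `K`
(on the other ones the map takes an arbitrary constant value, which plays no role). -/
def onward {d : ℕ} (K : Finset (Site d)) : PathClass d → ForwardPath d :=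
  Quotient.lift
    (fun w => if Visits K w then forwardFrom w (firstEntrance K w)
      else Classical.choice ⟨forwardFrom w 0⟩)
    (by
      intro v w h
      have h' : ∃ k : ℤ, ∀ n, w.1 n = v.1 (n + k) := (shiftSetoid d).symm h
      by_cases hv : Visits K v
      · obtain ⟨hw, he⟩ := onward_aux K h hv
        simp only [if_pos hv, if_pos hw, he]
      · have hw : ¬ Visits K w := fun hw => hv (onward_aux K h' hw).1
        simp only [if_neg hv, if_neg hw])

/-! ### Random interlacements -/

/-- The doubly-infinite sequence with `(w_n, ζ_n)` given by the first path for `n ≥ 0`, and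
`(w_{-n}, ζ_{-n})` given by the second path for `n ≥ 1`, i.e. after its first jump. -/
def glue {d : ℕ} (p : ForwardPath d × ForwardPath d) : ℤ → Site d × ℝ :=
  fun n => if 0 ≤ n then p.1.1 n.toNat else p.2.1 (-n).toNat

/-- The finite measure `Q_K` on doubly-infinite trajectories: `Q_K[X_0 = x] = e_K(x)` and, given
`X_0 = x`, the forward and the backward parts are independent, distributed as the walk under `P_x`
and as the walk after its first jump under `P_x[ · | no return to K]`, respectively. -/
def hitMeasure {d : ℕ} (K : Finset (Site d)) : Measure (TwoSidedPath d) :=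
  (∑ x ∈ K, ENNReal.ofReal (equilibrium K x) •
    ((walkLaw x).prod (cond (walkLaw x) {w | returnTime K w = ∞})).map glue).comap Subtype.val

/-- `N` is (under `P`) a Poisson point process on `S` with intensity measure `lam`: every
realization is a countable sum of Dirac masses, `N(A)` is Poisson with mean `lam(A)` whenever the
latter is finite, and the values on disjoint sets are independent. -/
structure IsPoissonPointProcess {Ω S : Type*} [MeasurableSpace Ω] [MeasurableSpace S]
    (P : Measure Ω) (N : Ω → Measure S) (lam : Measure S) : Prop where
  measurable : Measurable N
  isPointMeasure : ∀ ω, ∃ (I : Set ℕ) (x : I → S), N ω = Measure.sum fun i => Measure.dirac (x i)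
  poisson : ∀ A, MeasurableSet A → lam A ≠ ∞ →
    P.map (fun ω => N ω A) = (poissonMeasure (lam A).toNNReal).map (fun n : ℕ => (n : ℝ≥0∞))
  indep : ∀ (n : ℕ) (A : Fin n → Set S), (∀ i, MeasurableSet (A i)) →
    Pairwise (fun i j => Disjoint (A i) (A j)) → iIndepFun (fun i ω => N ω (A i)) P

/-- `ν` is the intensity measure of random interlacements: for every finite `K`, the restriction
of `ν` to the trajectories visiting `K` is the image of `Q_K` under the canonical projection. -/
def IsInterlacementIntensity {d : ℕ} (ν : Measure (PathClass d)) : Prop :=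
  ∀ K : Finset (Site d),
    ν.restrict (visiting K) = (hitMeasure K).map (Quotient.mk (shiftSetoid d))

/-- `N` is (under `P`) the interlacement point process: a Poisson point process on (trajectories
modulo time shift) `× ℝ_+` with intensity `ν(dw) du`. -/
def IsInterlacementProcess {d : ℕ} {Ω : Type*} [MeasurableSpace Ω] (P : Measure Ω)
    (N : Ω → Measure (PathClass d × ℝ)) : Prop :=
  ∃ ν : Measure (PathClass d), IsInterlacementIntensity ν ∧
    IsPoissonPointProcess P N (ν.prod (volume.restrict (Set.Ici 0)))

/-- The point measure `μ_{K,u}` on one-sided trajectories: keep the points `(w, v)` of `η` with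
`v ≤ u` and `w` visiting `K`, and map them to the onward trajectory upon first entrance in `K`. -/
def onwardMeasure {d : ℕ} (K : Finset (Site d)) (u : ℝ) (η : Measure (PathClass d × ℝ)) :
    Measure (ForwardPath d) :=
  (η.restrict (visiting K ×ˢ Set.Iic u)).map fun p => onward K p.1

/-! ### The observable -/

/-- The box `D_z = z + [-3L, 4L)^d`. -/
def box {d : ℕ} (L : ℕ) (z : Site d) : Finset (Site d) :=
  Fintype.piFinset fun i => Finset.Ico (z i - 3 * L) (z i + 4 * L)

/-- A finite non-empty collection of sites of `L ℤ^d` with mutual `ℓ^∞`-distance at least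
`10 K L`. -/
def IsSeparated {d : ℕ} (K L : ℕ) (C : Finset (Site d)) : Prop :=
  C.Nonempty ∧ (∀ z ∈ C, ∀ i, (L : ℤ) ∣ z i) ∧
    ∀ z ∈ C, ∀ z' ∈ C, z ≠ z' → (10 * K * L : ℝ) ≤ ‖z - z'‖

open Classical in
/-- `Σ(C)`, the union of the boxes `D_z` with `z ∈ C`. -/
def boxUnion {d : ℕ} (L : ℕ) (C : Finset (Site d)) : Finset (Site d) := C.biUnion (box L)

/-- The potential `V(x) = ∑_{z ∈ C} e_Σ(D_z) ē_{D_z}(x)`. -/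
def potential {d : ℕ} (L : ℕ) (C : Finset (Site d)) (x : Site d) : ℝ :=
  ∑ z ∈ C, (∑ y ∈ box L z, equilibrium (boxUnion L C) y) * normalizedEquilibrium (box L z) x

/-- The observable `h^u(C)`: the integral with respect to `μ_{Σ,u}` of the functional
`w ↦ ∫_0^∞ V(X_s(w)) ds`. -/
def observable {d : ℕ} (L : ℕ) (C : Finset (Site d)) (u : ℝ) (η : Measure (PathClass d × ℝ)) :
    ℝ≥0∞ :=
  ∫⁻ w, (∫⁻ s in Set.Ici (0 : ℝ), ENNReal.ofReal (potential L C (position w s)))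
    ∂(onwardMeasure (boxUnion L C) u η)

end Interlacement

end

/-! The proof joins an exact computation with a comparison from potential theory.

Exact computation. Let `V` be replaced by the equilibrium measure `e_Σ`. Its Green potential is the
hitting probability of `Σ`, which is constant on `Σ`, so a Feynman–Kac equation is solved explicitly
(`lintegral_prod_exp_equilibrium`). For a walk started in `Σ`, the exponential moment of `∫ e_Σ(X_s)
ds` is at most `1/(1-a)` for `0 ≤ a < 1`, and the Laplace transform at `b ≥ 0` is at most `1/(1+b)`:
these are the values for an exponential variable of mean one. The onward trajectories form a Poisson
cloud of walks with starting intensity `u e_Σ`, so the Laplace functional of the Poisson process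
gives the exponent `u cap(Σ) a/(1-a)`, or `-u cap(Σ) b/(1+b)`. Markov's inequality with the optimal
parameter yields exactly `(√v - √u)^2 cap(Σ)`: `measure_le_totalOccupation` and
`measure_totalOccupation_le`.

Comparison. It remains to show `(1-ε) e_Σ ≤ V ≤ (1+ε) e_Σ` pointwise (`potential_comparison`). On a
set, its equilibrium measure is the Laplacian, that is the discrete normal derivative, of the escape
probability. The escape probabilities from `Σ` and from a single box `D_z` both vanish on `D_z` and
are harmonic off `D_z` up to distance of order `KL`, much larger than the box. The boundary Harnack
comparison `exists_lap_comparison` makes their normal derivatives on `D_z` proportional up to a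
relative error of order `1/K`. The unknown factor cancels in `V`, where `e_{D_z}` is normalized and
multiplied by `e_Σ(D_z)`.

The quantitative Harnack inequality with error of order (radius of the inner ball)/(radius of the
outer one) rests on the gradient bound `|∇g(x)| ≤ c g(x)/|x|` for the Green function. This is
obtained from the formula for the heat kernel as a product of Bessel functions. Turán's inequality
and the three-term recurrence bound the logarithmic time derivative of each factor from below; an
integration by parts in time then shows that in `g(x) = ∫ p_a(x) da` the mean of `1/a` is at most of
order `1/|x|^2`, up to a cutoff at small times. -/

noncomputable section
namespace Interlacement

/-! ### The one-dimensional heat kernel -/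

open Nat in
/-- The terms of the power series of `a ↦ I_k(2a)`, with `I_k` the modified Bessel function. -/
def besselTerm (k : ℕ) (a : ℝ) (j : ℕ) : ℝ := a ^ (2 * j + k) / (j ! * (j + k)! : ℝ)

/-- The modified Bessel function `I_k(2a)`. -/
def besselSum (k : ℕ) (a : ℝ) : ℝ := ∑' j, besselTerm k a j

lemma besselTerm_nonneg {a : ℝ} (ha : 0 ≤ a) (k j : ℕ) : 0 ≤ besselTerm k a j := by
  unfold besselTerm; positivity

lemma summable_norm_besselTerm (k : ℕ) (a : ℝ) : Summable fun j => ‖besselTerm k a j‖ := by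
  refine Summable.of_nonneg_of_le (fun j => norm_nonneg _) (fun j => ?_)
    ((Real.summable_pow_div_factorial (a ^ 2)).mul_left (|a| ^ k))
  unfold besselTerm
  rw [norm_div, norm_pow, Real.norm_eq_abs, Real.norm_of_nonneg (by positivity), pow_add,
    pow_mul, sq_abs, mul_comm ((a ^ 2) ^ j), mul_div_assoc]
  have h1 : (1 : ℝ) ≤ (j + k).factorial := by exact_mod_cast Nat.succ_le_of_lt (Nat.factorial_pos _)
  have h2 : (0 : ℝ) < j.factorial := by exact_mod_cast Nat.factorial_pos _
  gcongr
  nlinarith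

lemma summable_besselTerm (k : ℕ) (a : ℝ) : Summable (besselTerm k a) :=
  (summable_norm_besselTerm k a).of_norm

lemma besselSum_pos {a : ℝ} (ha : 0 < a) (k : ℕ) : 0 < besselSum k a :=
  (summable_besselTerm k a).tsum_pos (besselTerm_nonneg ha.le k) 0 (by
    unfold besselTerm; positivity)

lemma besselSum_nonneg {a : ℝ} (ha : 0 ≤ a) (k : ℕ) : 0 ≤ besselSum k a :=
  tsum_nonneg (besselTerm_nonneg ha k)

lemma besselSum_zero_right (k : ℕ) : besselSum k 0 = if k = 0 then 1 else 0 := by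
  unfold besselSum
  rw [tsum_eq_single 0]
  · rcases k with _ | k <;> simp [besselTerm]
  · intro j hj
    have : 2 * j + k ≠ 0 := by omega
    simp [besselTerm, hj]

/-- The terms of the Bessel series with index shifted by one. -/
def besselTermShift (k : ℕ) (a : ℝ) (j : ℕ) : ℝ :=
  if j = 0 then 0 else besselTerm k a (j - 1)

lemma summable_besselTermShift (k : ℕ) (a : ℝ) : Summable (besselTermShift k a) := by
  rw [← summable_nat_add_iff 1]
  simpa [besselTermShift] using summable_besselTerm k a

lemma tsum_besselTermShift (k : ℕ) (a : ℝ) : ∑' j, besselTermShift k a j = besselSum k a := by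
  rw [(summable_besselTermShift k a).tsum_eq_zero_add]
  simp [besselTermShift, besselSum]

lemma besselTerm_recurrence (k j : ℕ) (a : ℝ) :
    a * besselTerm k a j = (j + (k + 1)) * besselTerm (k + 1) a j := by
  unfold besselTerm
  rw [← add_assoc j k 1, Nat.factorial_succ]
  have h1 : ((j + k).factorial : ℝ) ≠ 0 := by exact_mod_cast Nat.factorial_ne_zero _
  have h2 : (j.factorial : ℝ) ≠ 0 := by exact_mod_cast Nat.factorial_ne_zero _
  have h3 : (j : ℝ) + k + 1 ≠ 0 := by positivity
  push_cast
  field_simp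
  ring

/-- The factor `j` vanishes at `j = 0`, where the shifted series has no term. Subtracted from
`besselTerm_recurrence` it cancels the `j` there and leaves the constant `k + 1` of the three-term
recurrence. -/
lemma besselTermShift_recurrence (k j : ℕ) (a : ℝ) :
    a * besselTermShift (k + 1) a j = j * besselTerm k a j := by
  rcases j with _ | j
  · simp [besselTermShift]
  simp only [besselTermShift, besselTerm, Nat.add_one_sub_one, Nat.succ_ne_zero, if_false]
  rw [show j + 1 + k = j + (k + 1) by ring, Nat.factorial_succ j]
  have h1 : ((j + (k + 1)).factorial : ℝ) ≠ 0 := by exact_mod_cast Nat.factorial_ne_zero _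
  have h2 : (j.factorial : ℝ) ≠ 0 := by exact_mod_cast Nat.factorial_ne_zero _
  push_cast
  field_simp
  ring

/-- The three-term recurrence of the Bessel functions. -/
lemma besselSum_recurrence (k : ℕ) (a : ℝ) :
    a * (besselSum k a - besselSum (k + 2) a) = (k + 1) * besselSum (k + 1) a := by
  rw [← tsum_besselTermShift (k + 2), besselSum, besselSum,
    ← (summable_besselTerm k a).tsum_sub (summable_besselTermShift (k + 2) a), ← tsum_mul_left,
    ← tsum_mul_left]
  congr 1 with j
  rw [mul_sub, besselTerm_recurrence, besselTermShift_recurrence]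
  ring

lemma hasDerivAt_besselTerm_succ (k j : ℕ) (a : ℝ) :
    HasDerivAt (fun y => besselTerm (k + 1) y j)
      (besselTerm k a j + besselTermShift (k + 2) a j) a := by
  have h := (hasDerivAt_pow (2 * j + (k + 1)) a).div_const
    (j.factorial * (j + (k + 1)).factorial : ℝ)
  unfold besselTerm
  convert! h using 1
  have h1 : ((j + k).factorial : ℝ) ≠ 0 := by exact_mod_cast Nat.factorial_ne_zero _
  have h3 : (j : ℝ) + k + 1 ≠ 0 := by positivity
  rcases j with _ | j
  · simp only [besselTermShift, if_true]
    simp only [Nat.mul_zero, zero_add, Nat.add_sub_cancel, Nat.factorial_succ] at *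
    push_cast at *
    simp at h3
    field_simp
    ring
  · simp only [besselTermShift, besselTerm, Nat.add_one_sub_one, Nat.succ_ne_zero, if_false]
    rw [show 2 * (j + 1) + (k + 1) - 1 = 2 * j + (k + 2) by omega,
      show 2 * (j + 1) + k = 2 * j + (k + 2) by omega,
      show j + 1 + (k + 1) = (j + 1 + k) + 1 by omega,
      show j + (k + 2) = (j + 1 + k) + 1 by omega, Nat.factorial_succ (j + 1 + k),
      Nat.factorial_succ j]
    have h2 : (j.factorial : ℝ) ≠ 0 := by exact_mod_cast Nat.factorial_ne_zero _
    push_cast at *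
    field_simp
    ring

lemma hasDerivAt_besselTerm_zero (j : ℕ) (a : ℝ) :
    HasDerivAt (fun y => besselTerm 0 y j) (2 * besselTermShift 1 a j) a := by
  have h := (hasDerivAt_pow (2 * j + 0) a).div_const (j.factorial * (j + 0).factorial : ℝ)
  unfold besselTerm
  convert! h using 1
  rcases j with _ | j
  · simp [besselTermShift]
  · simp only [besselTermShift, besselTerm, Nat.add_one_sub_one, Nat.succ_ne_zero, if_false]
    rw [show 2 * (j + 1) + 0 - 1 = 2 * j + 1 by omega, Nat.add_zero, Nat.factorial_succ j]
    have h2 : (j.factorial : ℝ) ≠ 0 := by exact_mod_cast Nat.factorial_ne_zero _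
    push_cast
    field_simp
    ring

lemma norm_besselTerm_le (k j : ℕ) {a M : ℝ} (h : |a| ≤ M) :
    ‖besselTerm k a j‖ ≤ besselTerm k M j := by
  unfold besselTerm
  rw [norm_div, norm_pow, Real.norm_eq_abs, Real.norm_of_nonneg (by positivity)]
  gcongr

lemma norm_besselTermShift_le (k j : ℕ) {a M : ℝ} (h : |a| ≤ M) :
    ‖besselTermShift k a j‖ ≤ besselTermShift k M j := by
  unfold besselTermShift
  split_ifs
  · simp
  · exact norm_besselTerm_le _ _ h

/-- Termwise differentiation: all coefficients are nonnegative, so for `|y| < |a| + 1` the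
derivatives are dominated by their values at `|a| + 1`. -/
lemma hasDerivAt_besselSum_succ (k : ℕ) (a : ℝ) :
    HasDerivAt (besselSum (k + 1)) (besselSum k a + besselSum (k + 2) a) a := by
  have h := hasDerivAt_tsum_of_isPreconnected (g := fun j y => besselTerm (k + 1) y j)
    (g' := fun j y => besselTerm k y j + besselTermShift (k + 2) y j)
    (u := fun j => besselTerm k (|a| + 1) j + besselTermShift (k + 2) (|a| + 1) j)
    (t := Metric.ball 0 (|a| + 1)) (y₀ := a) (y := a)
    ((summable_besselTerm _ _).add (summable_besselTermShift _ _)) Metric.isOpen_ball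
    (convex_ball _ _).isPreconnected (fun j y _ => hasDerivAt_besselTerm_succ k j y)
    (fun j y hy => (norm_add_le _ _).trans (add_le_add
      (norm_besselTerm_le _ _ (by simpa using (mem_ball_zero_iff.1 hy).le))
      (norm_besselTermShift_le _ _ (by simpa using (mem_ball_zero_iff.1 hy).le))))
    (by simp) (summable_besselTerm _ _) (by simp)
  rwa [(summable_besselTerm _ _).tsum_add (summable_besselTermShift _ _),
    tsum_besselTermShift] at h

lemma hasDerivAt_besselSum_zero (a : ℝ) :
    HasDerivAt (besselSum 0) (2 * besselSum 1 a) a := by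
  have h := hasDerivAt_tsum_of_isPreconnected (g := fun j y => besselTerm 0 y j)
    (g' := fun j y => 2 * besselTermShift 1 y j)
    (u := fun j => 2 * besselTermShift 1 (|a| + 1) j)
    (t := Metric.ball 0 (|a| + 1)) (y₀ := a) (y := a)
    ((summable_besselTermShift _ _).mul_left 2) Metric.isOpen_ball
    (convex_ball _ _).isPreconnected (fun j y _ => hasDerivAt_besselTerm_zero j y)
    (fun j y hy => by
      rw [norm_mul, Real.norm_ofNat]
      gcongr
      exact norm_besselTermShift_le _ _ (by simpa using (mem_ball_zero_iff.1 hy).le))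
    (by simp) (summable_besselTerm _ _) (by simp)
  rwa [tsum_mul_left, tsum_besselTermShift] at h

/-- Vandermonde's identity. The resulting binomial and power of `a` depend on `p` and `r` only
through `p + r`, so two products with the same `p + r` differ only by the factorials in the
denominator. -/
lemma sum_antidiagonal_besselTerm (p r n : ℕ) (a : ℝ) :
    ∑ ij ∈ Finset.HasAntidiagonal.antidiagonal n, besselTerm p a ij.1 * besselTerm r a ij.2
      = a ^ (2 * n + p + r) * ((n + r + (n + p)).choose n : ℝ)
        / ((n + p).factorial * (n + r).factorial : ℝ) := by
  rw [Nat.add_choose_eq, Nat.cast_sum, Finset.mul_sum, Finset.sum_div]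
  refine Finset.sum_congr rfl fun ij hij => ?_
  obtain ⟨i, j⟩ := ij
  obtain rfl : i + j = n := Finset.HasAntidiagonal.mem_antidiagonal.1 hij
  have h1 := Nat.add_choose_mul_factorial_mul_factorial i (j + r)
  have h2 := Nat.add_choose_mul_factorial_mul_factorial j (i + p)
  rw [show i + (j + r) = i + j + r by ring] at h1
  rw [show j + (i + p) = i + j + p by ring] at h2
  simp only [besselTerm]
  rw [← h1, ← h2, Nat.choose_symm_of_eq_add (show i + j + r = i + (j + r) by ring),
    Nat.choose_symm_of_eq_add (show i + j + p = j + (i + p) by ring)]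
  have f := fun m : ℕ => (show (m.factorial : ℝ) ≠ 0 by exact_mod_cast Nat.factorial_ne_zero m)
  have c1 : ((i + j + r).choose (j + r) : ℝ) ≠ 0 := by
    exact_mod_cast (Nat.choose_pos (by omega)).ne'
  have c2 : ((i + j + p).choose (i + p) : ℝ) ≠ 0 := by
    exact_mod_cast (Nat.choose_pos (by omega)).ne'
  have := f i; have := f j; have := f (i + p); have := f (j + r)
  push_cast
  field_simp
  ring

lemma besselSum_mul (p r : ℕ) (a : ℝ) :
    besselSum p a * besselSum r a = ∑' n, a ^ (2 * n + p + r) *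
      ((n + r + (n + p)).choose n : ℝ) / ((n + p).factorial * (n + r).factorial : ℝ) := by
  rw [besselSum, besselSum, tsum_mul_tsum_eq_tsum_sum_antidiagonal_of_summable_norm
    (summable_norm_besselTerm p a) (summable_norm_besselTerm r a)]
  simp only [sum_antidiagonal_besselTerm]

lemma summable_besselSum_mul (p r : ℕ) (a : ℝ) : Summable fun n : ℕ => a ^ (2 * n + p + r) *
      ((n + r + (n + p)).choose n : ℝ) / ((n + p).factorial * (n + r).factorial : ℝ) := by
  have := summable_norm_sum_mul_antidiagonal_of_summable_norm
    (summable_norm_besselTerm p a) (summable_norm_besselTerm r a)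
  simpa only [sum_antidiagonal_besselTerm] using this.of_norm

/-- Turán's inequality for the Bessel functions. -/
lemma besselSum_turan {a : ℝ} (ha : 0 ≤ a) (k : ℕ) :
    besselSum k a * besselSum (k + 2) a ≤ besselSum (k + 1) a ^ 2 := by
  rw [sq, besselSum_mul, besselSum_mul]
  refine (summable_besselSum_mul _ _ a).tsum_le_tsum (fun n => ?_) (summable_besselSum_mul _ _ a)
  -- Powers and binomials now agree, and the inequality reduces to `(n+k+1)! ^ 2 ≤ (n+k)! (n+k+2)!`.
  rw [show 2 * n + (k + 1) + (k + 1) = 2 * n + k + (k + 2) by ring,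
    show n + (k + 1) + (n + (k + 1)) = n + (k + 2) + (n + k) by ring]
  have h : (((n + (k + 1)).factorial * (n + (k + 1)).factorial : ℕ) : ℝ)
      ≤ ((n + k).factorial * (n + (k + 2)).factorial : ℕ) := by
    rw [Nat.cast_le, show n + (k + 2) = (n + k + 1) + 1 by ring,
      show n + (k + 1) = n + k + 1 by ring, Nat.factorial_succ (n + k + 1),
      Nat.factorial_succ (n + k)]
    have := Nat.factorial_pos (n + k)
    nlinarith [Nat.zero_le ((n + k).factorial * ((n + k + 1) * (n + k).factorial))]
  push_cast at h
  have h0 : (0 : ℝ) < (n + (k + 1)).factorial := by exact_mod_cast Nat.factorial_pos _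
  gcongr

/-- Arithmetic–geometric mean: the `j`-th term of `I_1` is `xy`, where `x ^ 2` and `y ^ 2` are the
terms `j` and `j + 1` of `I_0`. -/
lemma besselSum_one_le (a : ℝ) : besselSum 1 a ≤ besselSum 0 a := by
  have h0 := (summable_besselTerm 0 a)
  have h1 : Summable fun j => besselTerm 0 a (j + 1) := (summable_nat_add_iff 1).2 h0
  have h2 : besselSum 0 a = 1 + ∑' j, besselTerm 0 a (j + 1) := by
    rw [besselSum, h0.tsum_eq_zero_add]; simp [besselTerm]
  have h3 : besselSum 1 a ≤ ∑' j, (besselTerm 0 a j + besselTerm 0 a (j + 1)) / 2 := by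
    refine (summable_besselTerm 1 a).tsum_le_tsum (fun j => ?_) ((h0.add h1).div_const 2)
    have e1 : besselTerm 1 a j = (a ^ j / j.factorial) * (a ^ (j + 1) / (j + 1).factorial) := by
      unfold besselTerm
      rw [div_mul_div_comm, ← pow_add]; congr 2; ring
    have e2 : besselTerm 0 a j = (a ^ j / j.factorial) ^ 2 := by
      unfold besselTerm
      rw [div_pow, ← pow_mul, add_zero, add_zero, ← sq, mul_comm]
    have e3 : besselTerm 0 a (j + 1) = (a ^ (j + 1) / (j + 1).factorial) ^ 2 := by
      unfold besselTerm
      rw [div_pow, ← pow_mul, add_zero, add_zero, ← sq, mul_comm]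
    rw [e1, e2, e3]
    nlinarith [sq_nonneg (a ^ j / j.factorial - a ^ (j + 1) / (j + 1).factorial)]
  rw [tsum_div_const, h0.tsum_add h1] at h3
  change _ ≤ (besselSum 0 a + _) / 2 at h3
  linarith

/-- By Turán the ratios `I_{k+1} / I_k` are nonincreasing in `k`, and the one at `k = 0` is at most
`1`. The argument divides by `I_k`, hence the separate case `a = 0`. -/
lemma besselSum_succ_le {a : ℝ} (ha : 0 ≤ a) (k : ℕ) : besselSum (k + 1) a ≤ besselSum k a := by
  rcases ha.eq_or_lt with rfl | ha'
  · simp only [besselSum_zero_right]; split_ifs <;> simp_all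
  induction k with
  | zero => exact besselSum_one_le a
  | succ k ih =>
    have h1 := besselSum_turan ha k
    have h2 := besselSum_pos ha' k
    have h3 := besselSum_pos ha' (k + 1)
    have h4 : besselSum (k + 1) a ^ 2 ≤ besselSum k a * besselSum (k + 1) a := by nlinarith
    exact le_of_mul_le_mul_left (h1.trans h4) h2


/-- The heat kernel of the continuous-time simple random walk on `ℤ` with jump rate `2`. -/
def heatKernelOne (k : ℕ) (a : ℝ) : ℝ := Real.exp (-2 * a) * besselSum k a

lemma heatKernelOne_pos {a : ℝ} (ha : 0 < a) (k : ℕ) : 0 < heatKernelOne k a :=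
  mul_pos (Real.exp_pos _) (besselSum_pos ha k)

lemma heatKernelOne_nonneg {a : ℝ} (ha : 0 ≤ a) (k : ℕ) : 0 ≤ heatKernelOne k a :=
  mul_nonneg (Real.exp_pos _).le (besselSum_nonneg ha k)

lemma heatKernelOne_zero_right (k : ℕ) : heatKernelOne k 0 = if k = 0 then 1 else 0 := by
  simp [heatKernelOne, besselSum_zero_right]

lemma heatKernelOne_succ_le {a : ℝ} (ha : 0 ≤ a) (k : ℕ) :
    heatKernelOne (k + 1) a ≤ heatKernelOne k a :=
  mul_le_mul_of_nonneg_left (besselSum_succ_le ha k) (Real.exp_pos _).le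

lemma heatKernelOne_anti {a : ℝ} (ha : 0 ≤ a) : Antitone fun k => heatKernelOne k a :=
  antitone_nat_of_succ_le (heatKernelOne_succ_le ha)

lemma heatKernelOne_recurrence (k : ℕ) (a : ℝ) :
    a * (heatKernelOne k a - heatKernelOne (k + 2) a) = (k + 1) * heatKernelOne (k + 1) a := by
  have := besselSum_recurrence k a
  unfold heatKernelOne
  linear_combination Real.exp (-2 * a) * this

lemma heatKernelOne_turan {a : ℝ} (ha : 0 ≤ a) (k : ℕ) :
    heatKernelOne k a * heatKernelOne (k + 2) a ≤ heatKernelOne (k + 1) a ^ 2 := by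
  have := besselSum_turan ha k
  unfold heatKernelOne
  have h : 0 ≤ Real.exp (-2 * a) ^ 2 := by positivity
  nlinarith [mul_le_mul_of_nonneg_left this h]

lemma hasDerivAt_heatKernelOne_zero (a : ℝ) : HasDerivAt (heatKernelOne 0)
    (2 * heatKernelOne 1 a - 2 * heatKernelOne 0 a) a := by
  have h1 : HasDerivAt (fun a : ℝ => Real.exp (-2 * a)) (Real.exp (-2 * a) * (-2)) a := by
    simpa using ((hasDerivAt_id a).const_mul (-2)).exp
  have h := h1.mul (hasDerivAt_besselSum_zero a)
  unfold heatKernelOne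
  convert! h using 1
  ring

lemma hasDerivAt_heatKernelOne_succ (k : ℕ) (a : ℝ) : HasDerivAt (heatKernelOne (k + 1))
    (heatKernelOne k a + heatKernelOne (k + 2) a - 2 * heatKernelOne (k + 1) a) a := by
  have h1 : HasDerivAt (fun a : ℝ => Real.exp (-2 * a)) (Real.exp (-2 * a) * (-2)) a := by
    simpa using ((hasDerivAt_id a).const_mul (-2)).exp
  have h := h1.mul (hasDerivAt_besselSum_succ k a)
  unfold heatKernelOne
  convert! h using 1
  ring

/-- The heat equation on `ℤ`. -/
lemma hasDerivAt_heatKernelOne_natAbs (k : ℤ) (a : ℝ) : HasDerivAt (heatKernelOne k.natAbs)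
    (heatKernelOne (k + 1).natAbs a + heatKernelOne (k - 1).natAbs a
      - 2 * heatKernelOne k.natAbs a) a := by
  rcases lt_trichotomy k 0 with hk | rfl | hk
  · obtain ⟨n, rfl⟩ : ∃ n : ℕ, k = -((n : ℤ) + 1) := ⟨(-k - 1).toNat, by omega⟩
    have e1 : (-((n : ℤ) + 1)).natAbs = n + 1 := by omega
    have e2 : (-((n : ℤ) + 1) + 1).natAbs = n := by omega
    have e3 : (-((n : ℤ) + 1) - 1).natAbs = n + 2 := by omega
    rw [e1, e2, e3]
    exact hasDerivAt_heatKernelOne_succ n a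
  · convert! hasDerivAt_heatKernelOne_zero a using 1
    simp
    ring
  · obtain ⟨n, rfl⟩ : ∃ n : ℕ, k = (n : ℤ) + 1 := ⟨(k - 1).toNat, by omega⟩
    have e1 : ((n : ℤ) + 1).natAbs = n + 1 := by omega
    have e2 : ((n : ℤ) + 1 + 1).natAbs = n + 2 := by omega
    have e3 : ((n : ℤ) + 1 - 1).natAbs = n := by omega
    rw [e1, e2, e3, add_comm (heatKernelOne (n + 2) a)]
    exact hasDerivAt_heatKernelOne_succ n a

/-- The recurrence trades the left neighbour `k - 1` for a multiple of the value at `k`, so that `a`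
times the time derivative involves only the ratio of two consecutive kernels. -/
lemma hasDerivAt_heatKernelOne (k : ℕ) (a : ℝ) :
    ∃ D, HasDerivAt (heatKernelOne k) D a ∧
      a * D = k * heatKernelOne k a + 2 * a * (heatKernelOne (k + 1) a - heatKernelOne k a) := by
  rcases k with _ | k
  · exact ⟨_, hasDerivAt_heatKernelOne_zero a, by push_cast; ring⟩
  · refine ⟨_, hasDerivAt_heatKernelOne_succ k a, ?_⟩
    have := heatKernelOne_recurrence k a
    push_cast
    linear_combination this

/-- The discrete form of the Gaussian gradient bound `|∂_x p| ≤ (x/a) p`: the recurrence evaluates a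
two-step difference, which dominates the one-step difference by monotonicity. -/
lemma heatKernelOne_sub_succ_le {a : ℝ} (ha : 0 ≤ a) (k : ℕ) :
    a * (heatKernelOne k a - heatKernelOne (k + 1) a) ≤ (k + 1) * heatKernelOne k a := by
  rcases k with _ | k
  · have h1 := heatKernelOne_recurrence 0 a
    have h2 := heatKernelOne_succ_le ha 0
    have h3 := heatKernelOne_succ_le ha 1
    simp only [Nat.cast_zero, zero_add] at *
    nlinarith
  · have h1 := heatKernelOne_recurrence k a
    have h2 := heatKernelOne_succ_le ha k
    have h3 := heatKernelOne_nonneg ha (k + 1)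
    push_cast
    rw [show k + 1 + 1 = k + 2 by ring]
    nlinarith

/-- A lower bound for the logarithmic derivative of the heat kernel. -/
lemma heatKernelOne_logDeriv_ge {a : ℝ} (ha : 0 < a) (k : ℕ) :
    (-1 + min (((k : ℝ) + 1) ^ 2 / (2 * a)) ((k : ℝ) + 1) / 3) * heatKernelOne k a
      ≤ k * heatKernelOne k a + 2 * a * (heatKernelOne (k + 1) a - heatKernelOne k a) := by
  set q := heatKernelOne k a with hq
  set r := heatKernelOne (k + 1) a with hr
  have hq0 : 0 < q := heatKernelOne_pos ha k
  have hr0 : 0 < r := heatKernelOne_pos ha (k + 1)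
  have h1 := heatKernelOne_recurrence k a
  have h2 := heatKernelOne_turan ha.le k
  rw [← hq, ← hr] at *
  -- Eliminating the kernel at `k + 2` between the recurrence and Turán's inequality leaves a
  -- quadratic inequality for the ratio `r / q`.
  have hquad : a * q ^ 2 ≤ a * r ^ 2 + (k + 1) * r * q := by nlinarith
  set n : ℝ := k + 1 with hn
  have hn0 : 0 < n := by positivity
  have hk : (k : ℝ) = n - 1 := by rw [hn]; ring
  set m := min (n ^ 2 / (2 * a)) n with hm
  have hm1 : m * (2 * a) ≤ n ^ 2 := by
    have : m ≤ n ^ 2 / (2 * a) := min_le_left _ _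
    rwa [le_div_iff₀ (by positivity)] at this
  have hm2 : m ≤ n := min_le_right _ _
  rw [hk]
  by_contra! hcon
  -- `X` is the right-hand side plus `q`, and it completes the square in the quadratic inequality.
  -- If `X < m q / 3`, the two members of the minimum `m` bound `4aXq` by `(2/3) n²q²` and `X²` by
  -- `(1/9) n²q²`, whose sum is too small.
  set X := n * q + 2 * a * (r - q) with hX
  have hX1 : X < m / 3 * q := by linarith
  have hX2 : n ^ 2 * q ^ 2 ≤ 4 * a * X * q + X ^ 2 := by
    rw [hX]
    nlinarith
  rcases le_or_gt X 0 with hX0 | hX0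
  · have : -(2 * a * q) ≤ X := by rw [hX]; nlinarith [mul_pos ha hr0, mul_pos hn0 hq0]
    have h5 : 4 * a * X * q + X ^ 2 ≤ 0 := by
      have : 0 ≤ 4 * a * q + X := by nlinarith [mul_pos ha hq0]
      nlinarith
    nlinarith [mul_pos (mul_pos hn0 hn0) (mul_pos hq0 hq0)]
  · have h5 : 4 * a * X * q ≤ 2 / 3 * n ^ 2 * q ^ 2 := by
      have : 4 * a * X * q ≤ 4 * a * (m / 3 * q) * q := by gcongr
      nlinarith [mul_le_mul_of_nonneg_right hm1 (sq_nonneg q)]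
    have h6 : X ^ 2 ≤ (n / 3 * q) ^ 2 := by
      have : X ≤ n / 3 * q := hX1.le.trans (by gcongr)
      gcongr
    nlinarith [mul_pos (mul_pos hn0 hn0) (mul_pos hq0 hq0)]

/-- The mass of `[-M, M]` under the heat kernel. -/
def heatMass (M : ℕ) (a : ℝ) : ℝ :=
  heatKernelOne 0 a + 2 * ∑ k ∈ Finset.range M, heatKernelOne (k + 1) a

lemma hasDerivAt_heatMass (M : ℕ) (a : ℝ) : HasDerivAt (heatMass M)
    (2 * heatKernelOne (M + 1) a - 2 * heatKernelOne M a) a := by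
  induction M with
  | zero =>
    have : heatMass 0 = heatKernelOne 0 := by funext y; simp [heatMass]
    rw [this]
    exact hasDerivAt_heatKernelOne_zero a
  | succ M ih =>
    have h := ih.add ((hasDerivAt_heatKernelOne_succ M a).const_mul 2)
    convert! h using 1
    · funext y; simp only [heatMass, Finset.sum_range_succ, Pi.add_apply]; ring
    · ring

lemma heatMass_zero_right (M : ℕ) : heatMass M 0 = 1 := by
  simp [heatMass, heatKernelOne_zero_right]

/-- The heat equation telescopes over the interval: the time derivative of the mass is the flux
through the ends, which is outward by monotonicity in space. -/
lemma heatMass_le_one (M : ℕ) {a : ℝ} (ha : 0 ≤ a) : heatMass M a ≤ 1 := by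
  rw [← heatMass_zero_right M]
  refine antitoneOn_of_deriv_nonpos (convex_Ici (0 : ℝ))
    (fun x _ => (hasDerivAt_heatMass M x).continuousAt.continuousWithinAt)
    (fun x _ => (hasDerivAt_heatMass M x).differentiableAt.differentiableWithinAt)
    (fun x hx => ?_) Set.self_mem_Ici ha ha
  rw [(hasDerivAt_heatMass M x).deriv]
  have := heatKernelOne_succ_le (by simpa using (interior_subset hx : x ∈ Set.Ici (0:ℝ))) M
  linarith

lemma heatKernelOne_zero_le_one {a : ℝ} (ha : 0 ≤ a) : heatKernelOne 0 a ≤ 1 := by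
  simpa [heatMass] using heatMass_le_one 0 ha

lemma two_mul_heatKernelOne_le (M : ℕ) {a : ℝ} (ha : 0 ≤ a) :
    2 * M * heatKernelOne M a ≤ 1 := by
  have h1 := heatMass_le_one M ha
  have h2 : M * heatKernelOne M a ≤ ∑ k ∈ Finset.range M, heatKernelOne (k + 1) a := by
    have := Finset.card_nsmul_le_sum (Finset.range M) (fun k => heatKernelOne (k + 1) a)
      (heatKernelOne M a) fun k hk =>
        heatKernelOne_anti ha (by have := Finset.mem_range.1 hk; omega)
    simpa using this
  have h3 := heatKernelOne_nonneg ha 0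
  unfold heatMass at h1
  nlinarith

lemma heatMass_mono {a : ℝ} (ha : 0 ≤ a) : Monotone fun M => heatMass M a :=
  monotone_nat_of_le_succ fun M => by
    have := heatKernelOne_nonneg ha (M + 1)
    simp only [heatMass, Finset.sum_range_succ]
    linarith

/-- A substitute for Chebyshev's inequality. Summed over the `M` intervals of half-width `M, …, 2M -
1` the fluxes telescope, so the total mass is lost at rate at most `2 q_M ≤ 1/M`. All these
intervals lie in the one of half-width `2M`. -/
lemma heatMass_ge (M : ℕ) (hM : 0 < M) {a : ℝ} (ha : 0 ≤ a) :
    1 - a / M ^ 2 ≤ heatMass (2 * M) a := by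
  have hM' : (0 : ℝ) < M := by exact_mod_cast hM
  have hd : ∀ N : ℕ, ∀ x, HasDerivAt (fun y => ∑ m ∈ Finset.range N, heatMass (M + m) y)
      (2 * heatKernelOne (M + N) x - 2 * heatKernelOne M x) x := by
    intro N x
    induction N with
    | zero => simpa using hasDerivAt_const x (0 : ℝ)
    | succ N ih =>
      simp only [Finset.sum_range_succ]
      convert! ih.add (hasDerivAt_heatMass (M + N) x) using 1
      rw [← add_assoc]
      ring
  have hd2 : ∀ x, HasDerivAt (fun y => (∑ m ∈ Finset.range M, heatMass (M + m) y) + y / M)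
      (2 * heatKernelOne (M + M) x - 2 * heatKernelOne M x + 1 / M) x := fun x =>
    (hd M x).add ((hasDerivAt_id x).div_const (M : ℝ))
  have hmono : MonotoneOn (fun y => (∑ m ∈ Finset.range M, heatMass (M + m) y) + y / M)
      (Set.Ici 0) := by
    refine monotoneOn_of_deriv_nonneg (convex_Ici (0 : ℝ))
      (fun x _ => (hd2 x).continuousAt.continuousWithinAt)
      (fun x _ => (hd2 x).differentiableAt.differentiableWithinAt) fun x hx => ?_
    have hx0 : 0 ≤ x := by simpa using (interior_subset hx : x ∈ Set.Ici (0:ℝ))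
    rw [(hd2 x).deriv]
    have h1 := two_mul_heatKernelOne_le M hx0
    have h2 := heatKernelOne_nonneg hx0 (M + M)
    have h3 : 2 * heatKernelOne M x ≤ 1 / M := by
      rw [le_div_iff₀ hM']; linarith
    linarith
  have h1 := hmono Set.self_mem_Ici ha ha
  simp only [heatMass_zero_right, Finset.sum_const, Finset.card_range, nsmul_eq_mul, mul_one,
    zero_div, add_zero] at h1
  have h2 : ∑ m ∈ Finset.range M, heatMass (M + m) a ≤ M * heatMass (2 * M) a := by
    have := Finset.sum_le_card_nsmul (Finset.range M) (fun m => heatMass (M + m) a)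
      (heatMass (2 * M) a) fun m hm => heatMass_mono ha (by
        have := Finset.mem_range.1 hm; omega)
    simpa using this
  have h3 : 1 - a / M ^ 2 = (M - a / M) / M := by field_simp
  rw [h3, div_le_iff₀ hM']
  linarith

/-- With `M = ⌈√(2a)⌉` at least half of the mass sits on the `1 + 4M ≤ 13 √a` sites of `[-2M, 2M]`,
and the kernel is largest at the origin. -/
lemma heatKernelOne_zero_ge {a : ℝ} (ha : 1 ≤ a) : 1 / (26 * √a) ≤ heatKernelOne 0 a := by
  have ha0 : 0 ≤ a := by linarith
  have hs : 1 ≤ √a := Real.one_le_sqrt.2 ha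
  have hss : √a ^ 2 = a := Real.sq_sqrt ha0
  set M := ⌈√(2 * a)⌉₊ with hM
  have h2s : √(2 * a) ≤ 2 * √a := by
    rw [Real.sqrt_le_left (by positivity)]; nlinarith
  have hM1 : √(2 * a) ≤ M := Nat.le_ceil _
  have hM2 : (M : ℝ) ≤ 3 * √a := by
    have := Nat.ceil_lt_add_one (Real.sqrt_nonneg (2 * a)); linarith
  have hM0 : 0 < M := Nat.ceil_pos.2 (Real.sqrt_pos.2 (by linarith))
  have hM3 : 2 * a ≤ (M : ℝ) ^ 2 := by
    rw [← Real.sqrt_le_left (by positivity)]; exact hM1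
  have h1 := heatMass_ge M hM0 ha0
  have h2 : a / (M : ℝ) ^ 2 ≤ 1 / 2 := by
    rw [div_le_iff₀ (by positivity)]; linarith
  have h3 : heatMass (2 * M) a ≤ (1 + 4 * M) * heatKernelOne 0 a := by
    have := Finset.sum_le_card_nsmul (Finset.range (2 * M)) (fun m => heatKernelOne (m + 1) a)
      (heatKernelOne 0 a) fun m _ => heatKernelOne_anti ha0 (Nat.zero_le _)
    simp only [Finset.card_range, nsmul_eq_mul] at this
    push_cast at this
    unfold heatMass
    linarith
  have h4 : (1 + 4 * M) * heatKernelOne 0 a ≤ 13 * √a * heatKernelOne 0 a :=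
    mul_le_mul_of_nonneg_right (by linarith) (heatKernelOne_nonneg ha0 0)
  rw [div_le_iff₀ (by positivity)]
  linarith

/-- Adding the gradient bounds at `0, …, k - 1` shows that the kernel has dropped by at most the
fraction `k(k+1)/(2a)` of its value at the origin. -/
lemma heatKernelOne_ge_half {a : ℝ} (ha : 0 < a) (k : ℕ) (hk : (k : ℝ) * (k + 1) ≤ a) :
    heatKernelOne 0 a / 2 ≤ heatKernelOne k a := by
  have h : ∀ m : ℕ, heatKernelOne 0 a * (2 * a - m * (m + 1)) ≤ 2 * a * heatKernelOne m a := by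
    intro m
    induction m with
    | zero => simp; linarith
    | succ m ih =>
      have h1 := heatKernelOne_sub_succ_le ha.le m
      have h2 : heatKernelOne m a ≤ heatKernelOne 0 a := heatKernelOne_anti ha.le (Nat.zero_le m)
      have h3 : ((m : ℝ) + 1) * heatKernelOne m a ≤ (m + 1) * heatKernelOne 0 a := by gcongr
      push_cast
      nlinarith
  have h1 := h k
  have h2 := heatKernelOne_nonneg ha.le 0
  have h3 : a * heatKernelOne 0 a ≤ 2 * a * heatKernelOne k a := by nlinarith
  have : heatKernelOne 0 a ≤ 2 * heatKernelOne k a := by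
    refine le_of_mul_le_mul_left ?_ ha
    linarith
  linarith

/-- The kernel is at least half its maximum at distances below about `√a`, and its mass there is at
most one. For `a ≤ 1` the trivial bound by one suffices. -/
lemma heatKernelOne_zero_le {a : ℝ} (ha : 0 < a) : heatKernelOne 0 a ≤ 2 / √a := by
  have hsp : 0 < √a := Real.sqrt_pos.2 ha
  rcases le_or_gt a 1 with h1 | h1
  · refine (heatKernelOne_zero_le_one ha.le).trans ?_
    rw [le_div_iff₀ hsp]
    have : √a ≤ 1 := Real.sqrt_le_one.2 h1
    linarith
  · have hs : 1 ≤ √a := Real.one_le_sqrt.2 h1.le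
    have hss : √a ^ 2 = a := Real.sq_sqrt ha.le
    obtain ⟨m, hm⟩ : ∃ m, ⌊√a⌋₊ = m + 1 :=
      Nat.exists_eq_succ_of_ne_zero (Nat.floor_pos.2 hs).ne'
    have hm1 : ((m : ℝ) + 1) ≤ √a := by
      have := Nat.floor_le hsp.le; rw [hm] at this; exact_mod_cast this
    have hm2 : √a ≤ 2 * ((m : ℝ) + 1) := by
      have := Nat.lt_floor_add_one (√a); rw [hm] at this; push_cast at this
      have : (0 : ℝ) ≤ m := by positivity
      linarith
    have h2 : (m : ℝ) * (heatKernelOne 0 a / 2)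
        ≤ ∑ k ∈ Finset.range m, heatKernelOne (k + 1) a := by
      have := Finset.card_nsmul_le_sum (Finset.range m) (fun k => heatKernelOne (k + 1) a)
        (heatKernelOne 0 a / 2) fun k hk => (heatKernelOne_ge_half ha m (by
          have : (0 : ℝ) ≤ m := by positivity
          nlinarith)).trans
          (heatKernelOne_anti ha.le (by have := Finset.mem_range.1 hk; omega))
      simpa using this
    have h3 := heatMass_le_one m ha.le
    unfold heatMass at h3
    rw [le_div_iff₀ hsp]
    have h4 := heatKernelOne_nonneg ha.le 0
    nlinarith


/-! ### The heat kernel and the Green function on the lattice -/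

/-- The (unnormalized) discrete Laplacian. -/
def lap {d : ℕ} (f : Site d → ℝ) (x : Site d) : ℝ :=
  ∑ i, (f (x + Pi.single i 1) + f (x - Pi.single i 1) - 2 * f x)

/-- The `ℓ^∞`-norm on `ℤ^d`, as a natural number. -/
def supNorm {d : ℕ} (x : Site d) : ℕ := Finset.univ.sup fun i => (x i).natAbs

lemma natAbs_le_supNorm {d : ℕ} (x : Site d) (i : Fin d) : (x i).natAbs ≤ supNorm x :=
  Finset.le_sup (f := fun i => (x i).natAbs) (Finset.mem_univ i)

lemma supNorm_le_iff {d : ℕ} {x : Site d} {n : ℕ} : supNorm x ≤ n ↔ ∀ i, (x i).natAbs ≤ n := by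
  simp [supNorm]

lemma exists_natAbs_eq_supNorm {d : ℕ} [NeZero d] (x : Site d) :
    ∃ i, (x i).natAbs = supNorm x := by
  obtain ⟨i, -, hi⟩ := Finset.exists_mem_eq_sup (Finset.univ : Finset (Fin d)) ⟨0, Finset.mem_univ _⟩
    fun i => (x i).natAbs
  exact ⟨i, hi.symm⟩

lemma supNorm_add_le {d : ℕ} (x y : Site d) : supNorm (x + y) ≤ supNorm x + supNorm y :=
  supNorm_le_iff.2 fun i => (Int.natAbs_add_le _ _).trans
    (add_le_add (natAbs_le_supNorm x i) (natAbs_le_supNorm y i))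

lemma supNorm_neg {d : ℕ} (x : Site d) : supNorm (-x) = supNorm x := by
  simp [supNorm]

lemma supNorm_single_one {d : ℕ} (i : Fin d) : supNorm (Pi.single i 1 : Site d) ≤ 1 :=
  supNorm_le_iff.2 fun j => by
    rcases eq_or_ne j i with rfl | h <;> simp [*]

/-- The heat kernel of the continuous-time simple random walk on `ℤ^d` with jump rate `2d`. -/
def latticeHeat {d : ℕ} (x : Site d) (a : ℝ) : ℝ := ∏ i, heatKernelOne (x i).natAbs a

section heat
variable {d : ℕ}

lemma latticeHeat_pos (x : Site d) {a : ℝ} (ha : 0 < a) : 0 < latticeHeat x a :=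
  Finset.prod_pos fun _ _ => heatKernelOne_pos ha _

lemma latticeHeat_nonneg (x : Site d) {a : ℝ} (ha : 0 ≤ a) : 0 ≤ latticeHeat x a :=
  Finset.prod_nonneg fun _ _ => heatKernelOne_nonneg ha _

lemma latticeHeat_zero_right (x : Site d) : latticeHeat x 0 = if x = 0 then 1 else 0 := by
  unfold latticeHeat
  simp only [heatKernelOne_zero_right, Int.natAbs_eq_zero]
  split_ifs with h
  · simp [h]
  · obtain ⟨i, hi⟩ := Function.ne_iff.1 h
    exact Finset.prod_eq_zero (Finset.mem_univ i) (if_neg hi)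

lemma latticeHeat_eq_mul (x : Site d) (a : ℝ) (i : Fin d) : latticeHeat x a
    = (∏ j ∈ Finset.univ.erase i, heatKernelOne (x j).natAbs a) * heatKernelOne (x i).natAbs a :=
  (Finset.prod_erase_mul _ _ (Finset.mem_univ i)).symm

lemma latticeHeat_add_single (x : Site d) (a : ℝ) (i : Fin d) (c : ℤ) :
    latticeHeat (x + Pi.single i c) a
    = (∏ j ∈ Finset.univ.erase i, heatKernelOne (x j).natAbs a)
      * heatKernelOne (x i + c).natAbs a := by
  rw [latticeHeat_eq_mul _ _ i]
  congr 1
  · refine Finset.prod_congr rfl fun j hj => ?_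
    simp [Finset.ne_of_mem_erase hj]
  · simp

lemma lap_latticeHeat (x : Site d) (a : ℝ) : lap (fun y => latticeHeat y a) x
    = ∑ i, (∏ j ∈ Finset.univ.erase i, heatKernelOne (x j).natAbs a) *
      (heatKernelOne (x i + 1).natAbs a + heatKernelOne (x i - 1).natAbs a
        - 2 * heatKernelOne (x i).natAbs a) := by
  unfold lap
  refine Finset.sum_congr rfl fun i _ => ?_
  rw [sub_eq_add_neg x, ← Pi.single_neg]
  simp only [latticeHeat_add_single]
  rw [latticeHeat_eq_mul x a i, ← sub_eq_add_neg]
  ring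

/-- The heat equation on `ℤ^d`. -/
lemma hasDerivAt_latticeHeat (x : Site d) (a : ℝ) :
    HasDerivAt (latticeHeat x) (lap (fun y => latticeHeat y a) x) a := by
  rw [lap_latticeHeat]
  exact HasDerivAt.fun_finsetProd fun i _ => hasDerivAt_heatKernelOne_natAbs (x i) a

lemma continuous_latticeHeat (x : Site d) : Continuous (latticeHeat x) :=
  continuous_iff_continuousAt.2 fun a => (hasDerivAt_latticeHeat x a).continuousAt

/-- The logarithmic derivative of a product is a sum. Each coordinate contributes at least `-1`, and
only the gain of the coordinate `i` is kept. -/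
lemma latticeHeat_logDeriv_ge (x : Site d) (i : Fin d) {a : ℝ} (ha : 0 < a) :
    (-d + min (((x i).natAbs + 1 : ℝ) ^ 2 / (2 * a)) ((x i).natAbs + 1 : ℝ) / 3)
      * latticeHeat x a ≤ a * lap (fun y => latticeHeat y a) x := by
  set m : Fin d → ℝ := fun i =>
    min (((x i).natAbs + 1 : ℝ) ^ 2 / (2 * a)) ((x i).natAbs + 1 : ℝ) with hm
  have hm0 : ∀ j, 0 ≤ m j := fun j => by simp only [hm]; positivity
  have h : ∀ j, (-1 + m j / 3) * latticeHeat x a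
      ≤ a * ((∏ l ∈ Finset.univ.erase j, heatKernelOne (x l).natAbs a) *
      (heatKernelOne (x j + 1).natAbs a + heatKernelOne (x j - 1).natAbs a
        - 2 * heatKernelOne (x j).natAbs a)) := by
    intro j
    obtain ⟨D, hD, hD'⟩ := hasDerivAt_heatKernelOne (x j).natAbs a
    rw [(hasDerivAt_heatKernelOne_natAbs (x j) a).unique hD, mul_left_comm, hD',
      latticeHeat_eq_mul x a j, mul_left_comm]
    exact mul_le_mul_of_nonneg_left (heatKernelOne_logDeriv_ge ha _)
      (Finset.prod_nonneg fun _ _ => heatKernelOne_nonneg ha.le _)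
  rw [lap_latticeHeat, Finset.mul_sum]
  refine le_trans ?_ (Finset.sum_le_sum fun j _ => h j)
  rw [← Finset.sum_mul]
  refine mul_le_mul_of_nonneg_right ?_ (latticeHeat_nonneg x ha.le)
  rw [Finset.sum_add_distrib]
  have : m i / 3 ≤ ∑ j, m j / 3 :=
    Finset.single_le_sum (f := fun j => m j / 3) (fun j _ => by have := hm0 j; positivity)
      (Finset.mem_univ i)
  simp only [Finset.sum_const, Finset.card_univ, Fintype.card_fin, nsmul_eq_mul, mul_neg, mul_one]
  linarith

lemma latticeHeat_le (x : Site d) {a : ℝ} (ha : 0 ≤ a) :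
    latticeHeat x a ≤ heatKernelOne 0 a ^ d := by
  have : latticeHeat x a ≤ ∏ _i : Fin d, heatKernelOne 0 a :=
    Finset.prod_le_prod (fun _ _ => heatKernelOne_nonneg ha _)
      fun _ _ => heatKernelOne_anti ha (Nat.zero_le _)
  simpa using this

lemma inv_sqrt_pow {a : ℝ} (ha : 0 ≤ a) (d : ℕ) : (1 / √a) ^ d = a ^ (-(d : ℝ) / 2) := by
  rw [one_div, inv_pow, Real.sqrt_eq_rpow, ← Real.rpow_natCast (a ^ (1 / 2 : ℝ)),
    ← Real.rpow_mul ha, ← Real.rpow_neg ha]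
  congr 1
  ring

lemma latticeHeat_le_rpow (x : Site d) {a : ℝ} (ha : 0 < a) :
    latticeHeat x a ≤ 2 ^ d * a ^ (-(d : ℝ) / 2) := by
  refine (latticeHeat_le x ha.le).trans
    ((pow_le_pow_left₀ (heatKernelOne_nonneg ha.le 0) (heatKernelOne_zero_le ha) d).trans_eq ?_)
  rw [← inv_sqrt_pow ha.le, ← mul_pow, mul_one_div]

lemma latticeHeat_ge_rpow (x : Site d) {a : ℝ} (ha : ((supNorm x : ℝ) + 1) ^ 2 ≤ a) :
    (1 / 52) ^ d * a ^ (-(d : ℝ) / 2) ≤ latticeHeat x a := by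
  have hs : (0 : ℝ) ≤ supNorm x := by positivity
  have ha1 : 1 ≤ a := by nlinarith
  have ha0 : 0 < a := by linarith
  have h1 : (1 / (52 * √a)) ^ d ≤ latticeHeat x a := by
    have : ∏ _i : Fin d, (1 / (52 * √a)) ≤ latticeHeat x a := by
      refine Finset.prod_le_prod (fun i _ => by positivity) fun i _ => ?_
      refine le_trans ?_ (heatKernelOne_ge_half ha0 _ ?_)
      · have := heatKernelOne_zero_ge ha1
        calc 1 / (52 * √a) = 1 / (26 * √a) / 2 := by rw [div_div]; ring
          _ ≤ _ := by gcongr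
      · have : ((x i).natAbs : ℝ) ≤ supNorm x := by exact_mod_cast natAbs_le_supNorm x i
        have h0 : (0 : ℝ) ≤ (x i).natAbs := by positivity
        nlinarith
    simpa using this
  refine le_of_eq_of_le ?_ h1
  rw [← inv_sqrt_pow ha0.le, ← mul_pow, one_div_mul_one_div]

lemma integrableOn_latticeHeat (hd : 3 ≤ d) (x : Site d) :
    IntegrableOn (latticeHeat x) (Set.Ioi 0) := by
  have hd' : (3 : ℝ) ≤ d := by exact_mod_cast hd
  rw [← Set.Ioc_union_Ioi_eq_Ioi zero_le_one]
  refine IntegrableOn.union ?_ ?_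
  · exact ((continuous_latticeHeat x).integrableOn_Icc).mono_set Set.Ioc_subset_Icc_self
  · have h := (integrableOn_Ioi_rpow_of_lt (show -(d : ℝ) / 2 < -1 by linarith)
      zero_lt_one).const_mul (2 ^ d)
    refine h.mono' (continuous_latticeHeat x).aestronglyMeasurable ?_
    refine (ae_restrict_iff' measurableSet_Ioi).2 (Filter.Eventually.of_forall fun a ha => ?_)
    have ha0 : 0 < a := zero_lt_one.trans ha
    rw [Real.norm_of_nonneg (latticeHeat_nonneg x ha0.le)]
    exact latticeHeat_le_rpow x ha0

lemma tendsto_mul_latticeHeat (hd : 3 ≤ d) (x : Site d) :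
    Filter.Tendsto (fun a => a * latticeHeat x a) Filter.atTop (nhds 0) := by
  have hd' : (3 : ℝ) ≤ d := by exact_mod_cast hd
  have h := (tendsto_rpow_neg_atTop (show 0 < (d : ℝ) / 2 - 1 by linarith)).const_mul (2 ^ d)
  rw [mul_zero] at h
  refine tendsto_of_tendsto_of_tendsto_of_le_of_le' tendsto_const_nhds h ?_ ?_
  · filter_upwards [Filter.eventually_gt_atTop 0] with a ha
    exact mul_nonneg ha.le (latticeHeat_nonneg x ha.le)
  · filter_upwards [Filter.eventually_gt_atTop 0] with a ha
    calc a * latticeHeat x a ≤ a * (2 ^ d * a ^ (-(d : ℝ) / 2)) := by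
          gcongr; exact latticeHeat_le_rpow x ha
      _ = 2 ^ d * (a ^ (1 : ℝ) * a ^ (-(d : ℝ) / 2)) := by rw [Real.rpow_one]; ring
      _ = _ := by rw [← Real.rpow_add ha]; congr 2; ring

lemma tendsto_latticeHeat (hd : 3 ≤ d) (x : Site d) :
    Filter.Tendsto (latticeHeat x) Filter.atTop (nhds 0) := by
  refine tendsto_of_tendsto_of_tendsto_of_le_of_le' tendsto_const_nhds
    (tendsto_mul_latticeHeat hd x) ?_ ?_
  · filter_upwards [Filter.eventually_gt_atTop 0] with a ha
    exact latticeHeat_nonneg x ha.le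
  · filter_upwards [Filter.eventually_ge_atTop 1] with a ha
    exact le_mul_of_one_le_left (latticeHeat_nonneg x (by linarith)) ha

/-- The Green function of the lattice: `lap greenFn = - 1_{0}`. -/
def greenFn (x : Site d) : ℝ := ∫ a in Set.Ioi 0, latticeHeat x a

lemma greenFn_nonneg (x : Site d) : 0 ≤ greenFn x :=
  setIntegral_nonneg measurableSet_Ioi fun _ ha => latticeHeat_nonneg x (le_of_lt ha)

lemma integrableOn_lap_latticeHeat (hd : 3 ≤ d) (x : Site d) :
    IntegrableOn (fun a => lap (fun y => latticeHeat y a) x) (Set.Ioi 0) := by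
  unfold lap
  exact integrable_finsetSum _ fun i _ => ((integrableOn_latticeHeat hd _).add
    (integrableOn_latticeHeat hd _)).sub ((integrableOn_latticeHeat hd x).const_mul 2)

/-- Integrate the heat equation over all times: the kernel goes from `1_{0}` at time zero to `0` at
infinity. -/
lemma lap_greenFn (hd : 3 ≤ d) (x : Site d) : lap greenFn x = if x = 0 then -1 else 0 := by
  have hi := fun y : Site d => integrableOn_latticeHeat hd y
  have h1 : lap greenFn x = ∫ a in Set.Ioi 0, lap (fun y => latticeHeat y a) x := by
    unfold lap
    have hs : ∀ i : Fin d, IntegrableOn (fun a => latticeHeat (x + Pi.single i 1) a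
        + latticeHeat (x - Pi.single i 1) a - 2 * latticeHeat x a) (Set.Ioi 0) := fun i =>
      ((hi _).add (hi _)).sub ((hi x).const_mul 2)
    rw [integral_finsetSum _ fun i _ => hs i]
    refine Finset.sum_congr rfl fun i _ => ?_
    have h2 : IntegrableOn (fun a => latticeHeat (x + Pi.single i 1) a
        + latticeHeat (x - Pi.single i 1) a) (Set.Ioi 0) := (hi _).add (hi _)
    rw [integral_sub h2 ((hi x).const_mul 2), integral_add (hi _) (hi _), integral_const_mul]
    rfl
  rw [h1, integral_Ioi_of_hasDerivAt_of_tendsto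
    (continuous_latticeHeat x).continuousAt.continuousWithinAt
    (fun a _ => hasDerivAt_latticeHeat x a) (integrableOn_lap_latticeHeat hd x)
    (tendsto_latticeHeat hd x), latticeHeat_zero_right]
  split_ifs <;> simp

lemma greenFn_pos (hd : 3 ≤ d) (x : Site d) : 0 < greenFn x := by
  unfold greenFn
  rw [setIntegral_pos_iff_support_of_nonneg_ae]
  · have : Function.support (latticeHeat x) ∩ Set.Ioi 0 = Set.Ioi 0 :=
      Set.inter_eq_right.2 fun a ha => (latticeHeat_pos x ha).ne'
    simp [this]
  · exact (ae_restrict_iff' measurableSet_Ioi).2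
      (Filter.Eventually.of_forall fun a ha => latticeHeat_nonneg x (le_of_lt ha))
  · exact integrableOn_latticeHeat hd x

lemma integrableOn_min_mul_latticeHeat (hd : 3 ≤ d) (x : Site d) {n : ℝ} (hn : 0 ≤ n) :
    IntegrableOn (fun a => min (n ^ 2 / (2 * a)) n * latticeHeat x a) (Set.Ioi 0) := by
  refine ((integrableOn_latticeHeat hd x).const_mul n).mono' ?_ ?_
  · have : Measurable fun a : ℝ => min (n ^ 2 / (2 * a)) n * latticeHeat x a :=
      (Measurable.min (by fun_prop) measurable_const).mul (continuous_latticeHeat x).measurable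
    exact this.aestronglyMeasurable
  · refine (ae_restrict_iff' measurableSet_Ioi).2 (Filter.Eventually.of_forall fun a ha => ?_)
    have ha' : 0 < a := ha
    have h1 : 0 ≤ min (n ^ 2 / (2 * a)) n := by positivity
    rw [Real.norm_of_nonneg (mul_nonneg h1 (latticeHeat_nonneg x ha'.le))]
    exact mul_le_mul_of_nonneg_right (min_le_right _ _) (latticeHeat_nonneg x ha'.le)

/-- Under the measure `latticeHeat x a da`, the time `a` is at least of order `|x|^2`. -/
lemma integral_min_mul_latticeHeat_le (hd : 3 ≤ d) (x : Site d) (i : Fin d) :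
    ∫ a in Set.Ioi 0, min (((x i).natAbs + 1 : ℝ) ^ 2 / (2 * a)) ((x i).natAbs + 1 : ℝ)
      * latticeHeat x a ≤ 3 * (d - 1) * greenFn x := by
  set n : ℝ := (x i).natAbs + 1 with hn
  have hd' : (3 : ℝ) ≤ d := by exact_mod_cast hd
  have hI := integrableOn_min_mul_latticeHeat hd x (n := n) (by positivity)
  have hp := integrableOn_latticeHeat hd x
  have hcl : Continuous fun a => lap (fun y => latticeHeat y a) x := by
    unfold lap
    have := fun y : Site d => continuous_latticeHeat y
    fun_prop
  have hc := continuous_latticeHeat x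
  have hder : ∀ a, HasDerivAt (fun a => a * latticeHeat x a)
      (latticeHeat x a + a * lap (fun y => latticeHeat y a) x) a := fun a => by
    simpa using (hasDerivAt_id a).fun_mul (hasDerivAt_latticeHeat x a)
  -- The bound on the logarithmic derivative reads `m p ≤ 3(d-1) p + 3 (a p)'`. The last term
  -- integrates to a boundary term, which vanishes as `A → ∞` because `d ≥ 3`.
  have hfin : ∀ A : ℝ, 0 ≤ A → ∫ a in (0 : ℝ)..A, min (n ^ 2 / (2 * a)) n * latticeHeat x a
      ≤ 3 * (d - 1) * greenFn x + 3 * (A * latticeHeat x A) := by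
    intro A hA
    have h1 : ∫ a in (0 : ℝ)..A, (latticeHeat x a + a * lap (fun y => latticeHeat y a) x)
        = A * latticeHeat x A := by
      rw [intervalIntegral.integral_eq_sub_of_hasDerivAt (fun a _ => hder a)
        (Continuous.intervalIntegrable (by fun_prop) _ _)]
      simp
    have hI' : IntervalIntegrable (fun a => min (n ^ 2 / (2 * a)) n * latticeHeat x a)
        volume 0 A := by
      rw [intervalIntegrable_iff_integrableOn_Ioc_of_le hA]
      exact hI.mono_set Set.Ioc_subset_Ioi_self
    have h2 : ∫ a in (0 : ℝ)..A, min (n ^ 2 / (2 * a)) n * latticeHeat x a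
        ≤ ∫ a in (0 : ℝ)..A, (3 * (d - 1) * latticeHeat x a
          + 3 * (latticeHeat x a + a * lap (fun y => latticeHeat y a) x)) := by
      refine intervalIntegral.integral_mono_on_of_le_Ioo hA hI'
        (Continuous.intervalIntegrable (by fun_prop) _ _) fun a ha => ?_
      have := latticeHeat_logDeriv_ge x i ha.1
      linarith
    rw [intervalIntegral.integral_add (Continuous.intervalIntegrable (by fun_prop) _ _)
      (Continuous.intervalIntegrable (by fun_prop) _ _), intervalIntegral.integral_const_mul,
      intervalIntegral.integral_const_mul, h1] at h2
    have h3 : ∫ a in (0 : ℝ)..A, latticeHeat x a ≤ greenFn x := by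
      rw [intervalIntegral.integral_of_le hA]
      exact setIntegral_mono_set hp ((ae_restrict_iff' measurableSet_Ioi).2
        (Filter.Eventually.of_forall fun a ha => latticeHeat_nonneg x (le_of_lt ha)))
        (Filter.Eventually.of_forall Set.Ioc_subset_Ioi_self)
    refine h2.trans ?_
    gcongr
    linarith
  have hlim := intervalIntegral_tendsto_integral_Ioi 0 hI Filter.tendsto_id
  have hlim2 := ((tendsto_mul_latticeHeat hd x).const_mul 3).const_add
    (3 * (d - 1) * greenFn x)
  rw [mul_zero, add_zero] at hlim2
  refine le_of_tendsto_of_tendsto hlim hlim2 ?_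
  filter_upwards [Filter.eventually_ge_atTop 0] with A hA
  exact hfin A hA

/-- The gradient of the Green function, in a direction that increases a coordinate. -/
lemma abs_greenFn_sub_le_of_natAbs (hd : 3 ≤ d) (x : Site d) (i l : Fin d) (c : ℤ)
    (hc : (x i + c).natAbs = (x i).natAbs + 1) (hl : (x i).natAbs ≤ (x l).natAbs) :
    |greenFn x - greenFn (x + Pi.single i c)|
      ≤ 6 * d / ((x l).natAbs + 1) * greenFn x := by
  set n : ℝ := (x l).natAbs + 1 with hn
  have hn0 : 0 < n := by positivity
  have hp := integrableOn_latticeHeat hd x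
  have hp' := integrableOn_latticeHeat hd (x + Pi.single i c)
  have hI := integrableOn_min_mul_latticeHeat hd x hn0.le
  have hle : (((x i).natAbs : ℝ) + 1) ≤ n := by
    rw [hn]; gcongr
  have h1 : |greenFn x - greenFn (x + Pi.single i c)|
      ≤ ∫ a in Set.Ioi 0, 2 / n * (min (n ^ 2 / (2 * a)) n * latticeHeat x a) := by
    unfold greenFn
    rw [← integral_sub hp hp', ← Real.norm_eq_abs]
    refine norm_integral_le_of_norm_le (hI.const_mul _) ?_
    refine (ae_restrict_iff' measurableSet_Ioi).2 (Filter.Eventually.of_forall fun a ha => ?_)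
    have ha' : 0 < a := ha
    rw [latticeHeat_add_single, hc, latticeHeat_eq_mul x a i, ← mul_sub]
    set P := ∏ j ∈ Finset.univ.erase i, heatKernelOne (x j).natAbs a
    set q := heatKernelOne (x i).natAbs a with hq
    have hP : 0 ≤ P := Finset.prod_nonneg fun _ _ => heatKernelOne_nonneg ha'.le _
    have hq0 : 0 ≤ q := heatKernelOne_nonneg ha'.le _
    have g1 := heatKernelOne_succ_le ha'.le (x i).natAbs
    have g2 := heatKernelOne_sub_succ_le ha'.le (x i).natAbs
    have g3 := heatKernelOne_nonneg ha'.le ((x i).natAbs + 1)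
    rw [← hq] at g1 g2
    rw [Real.norm_of_nonneg (mul_nonneg hP (sub_nonneg.2 g1))]
    -- The decrement is at most `(n/a) q` by the gradient bound in one dimension and at most `q`
    -- trivially, which matches the two members of the minimum.
    have g4 : q - heatKernelOne ((x i).natAbs + 1) a
        ≤ 2 / n * min (n ^ 2 / (2 * a)) n * q := by
      rcases min_cases (n ^ 2 / (2 * a)) n with h | h <;> rw [h.1]
      · have : 2 / n * (n ^ 2 / (2 * a)) = n / a := by field_simp
        rw [this, div_mul_eq_mul_div, le_div_iff₀ ha']
        nlinarith
      · rw [div_mul_cancel₀ _ hn0.ne']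
        linarith
    calc P * (q - heatKernelOne ((x i).natAbs + 1) a)
        ≤ P * (2 / n * min (n ^ 2 / (2 * a)) n * q) := mul_le_mul_of_nonneg_left g4 hP
      _ = _ := by ring
  rw [integral_const_mul] at h1
  refine h1.trans ?_
  have h2 := integral_min_mul_latticeHeat_le hd x l
  rw [← hn] at h2
  have hg := greenFn_nonneg x
  calc 2 / n * _ ≤ 2 / n * (3 * (d - 1) * greenFn x) := by gcongr
    _ = 6 * (d - 1) / n * greenFn x := by ring
    _ ≤ 6 * d / n * greenFn x := by gcongr; linarith

/-- Markov's inequality: for `a ≤ n²/(12d)` the minimum is at least `6d`, whereas its integral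
against `latticeHeat x a da` is at most `3(d-1)` times the Green function. Hence these times carry
at most half of the Green function. -/
lemma greenFn_le_two_mul (hd : 3 ≤ d) (x : Site d) (i : Fin d)
    (hi : 6 * d ≤ (x i).natAbs + 1) :
    greenFn x ≤ 2 * ∫ a in Set.Ioi (((x i).natAbs + 1 : ℝ) ^ 2 / (12 * d)), latticeHeat x a := by
  set n : ℝ := (x i).natAbs + 1 with hn
  have hn0 : 0 < n := by positivity
  have hd' : (3 : ℝ) ≤ d := by exact_mod_cast hd
  have hi' : (6 * d : ℝ) ≤ n := by rw [hn]; exact_mod_cast hi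
  set A := n ^ 2 / (12 * d) with hA
  have hA0 : 0 ≤ A := by positivity
  have hp := integrableOn_latticeHeat hd x
  have hI := integrableOn_min_mul_latticeHeat hd x hn0.le
  have h2 := integral_min_mul_latticeHeat_le hd x i
  rw [← hn] at h2
  have h3 : 6 * d * ∫ a in Set.Ioc 0 A, latticeHeat x a
      ≤ ∫ a in Set.Ioi 0, min (n ^ 2 / (2 * a)) n * latticeHeat x a := by
    rw [← integral_const_mul]
    refine le_trans (setIntegral_mono_on ((hp.mono_set Set.Ioc_subset_Ioi_self).const_mul _)
      (hI.mono_set Set.Ioc_subset_Ioi_self) measurableSet_Ioc fun a ha => ?_)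
      (setIntegral_mono_set hI ((ae_restrict_iff' measurableSet_Ioi).2
        (Filter.Eventually.of_forall fun a ha => ?_))
        (Filter.Eventually.of_forall Set.Ioc_subset_Ioi_self))
    · refine mul_le_mul_of_nonneg_right (le_min ?_ hi') (latticeHeat_nonneg x ha.1.le)
      rw [le_div_iff₀ (by have := ha.1; positivity)]
      have := ha.2
      rw [hA, le_div_iff₀ (by positivity)] at this
      linarith
    · have ha' : 0 < a := ha
      exact mul_nonneg (by positivity) (latticeHeat_nonneg x ha'.le)
  have h4 : greenFn x = (∫ a in Set.Ioc 0 A, latticeHeat x a) + ∫ a in Set.Ioi A, latticeHeat x a := by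
    unfold greenFn
    rw [← Set.Ioc_union_Ioi_eq_Ioi hA0]
    exact setIntegral_union Set.Ioc_disjoint_Ioi_same measurableSet_Ioi
      (hp.mono_set Set.Ioc_subset_Ioi_self) (hp.mono_set (Set.Ioi_subset_Ioi hA0))
  have hg := greenFn_nonneg x
  have h5 : 6 * d * ∫ a in Set.Ioc 0 A, latticeHeat x a ≤ 6 * d * (greenFn x / 2) := by
    nlinarith
  have h6 := le_of_mul_le_mul_left h5 (by positivity)
  linarith

/-- The Green function decays at infinity: it is halved at a sufficiently larger distance. -/
lemma greenFn_le_half (hd : 3 ≤ d) (x y : Site d)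
    (h : 48 * d * 104 ^ d * (supNorm y + 1) ≤ supNorm x) : greenFn x ≤ greenFn y / 2 := by
  have : NeZero d := ⟨by omega⟩
  have hd' : (3 : ℝ) ≤ d := by exact_mod_cast hd
  obtain ⟨i, hi⟩ := exists_natAbs_eq_supNorm x
  set n : ℝ := (x i).natAbs + 1 with hn
  set k : ℝ := (supNorm y : ℝ) + 1 with hk
  have hk1 : 1 ≤ k := by rw [hk]; have : (0 : ℝ) ≤ supNorm y := by positivity
                         linarith
  set T : ℝ := 104 ^ d with hT
  have hT1 : 1 ≤ T := one_le_pow₀ (by norm_num)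
  have hnk : 48 * d * T * k ≤ n := by
    have : ((48 * d * 104 ^ d * (supNorm y + 1) : ℕ) : ℝ) ≤ supNorm x := by exact_mod_cast h
    push_cast at this
    rw [hn, hi]
    linarith
  have hn0 : 0 < n := by positivity
  have h6 : 6 * d ≤ (x i).natAbs + 1 := by
    rw [hi]
    have : 6 * d * 1 ≤ 48 * d * 104 ^ d * (supNorm y + 1) := by
      have := Nat.one_le_pow d 104 (by norm_num)
      have : 1 ≤ 104 ^ d * (supNorm y + 1) := Nat.one_le_iff_ne_zero.2 (by positivity)
      calc 6 * d * 1 ≤ 48 * d * (104 ^ d * (supNorm y + 1)) :=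
            Nat.mul_le_mul (by omega) this
        _ = _ := by ring
    omega
  set A := n ^ 2 / (12 * d) with hA
  have hA0 : 0 < A := by positivity
  set s : ℝ := 1 - d / 2 with hs
  have hs0 : s ≤ -(1 / 2) := by rw [hs]; linarith
  have hint : ∀ B : ℝ, 0 < B → ∫ a in Set.Ioi B, a ^ (-(d : ℝ) / 2) = B ^ s / (-s) := by
    intro B hB
    rw [integral_Ioi_rpow_of_lt (by linarith) hB]
    rw [show -(d : ℝ) / 2 + 1 = s by rw [hs]; ring, div_neg, neg_div]
  have hup : ∫ a in Set.Ioi A, latticeHeat x a ≤ 2 ^ d * (A ^ s / (-s)) := by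
    rw [← hint A hA0, ← integral_const_mul]
    refine setIntegral_mono_on ((integrableOn_latticeHeat hd x).mono_set
      (Set.Ioi_subset_Ioi hA0.le)) ((integrableOn_Ioi_rpow_of_lt (by linarith) hA0).const_mul _)
      measurableSet_Ioi fun a ha => latticeHeat_le_rpow x (hA0.trans ha)
  have hlow : (1 / 52) ^ d * ((k ^ 2) ^ s / (-s)) ≤ greenFn y := by
    have hk0 : 0 < k ^ 2 := by positivity
    rw [← hint _ hk0, ← integral_const_mul]
    refine le_trans (setIntegral_mono_on
      ((integrableOn_Ioi_rpow_of_lt (by linarith) hk0).const_mul _)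
      ((integrableOn_latticeHeat hd y).mono_set (Set.Ioi_subset_Ioi hk0.le))
      measurableSet_Ioi fun a ha => latticeHeat_ge_rpow y (le_of_lt ha))
      (setIntegral_mono_set (integrableOn_latticeHeat hd y) ((ae_restrict_iff' measurableSet_Ioi).2
        (Filter.Eventually.of_forall fun a ha => latticeHeat_nonneg y (le_of_lt ha)))
        (Filter.Eventually.of_forall (Set.Ioi_subset_Ioi hk0.le)))
  have hmain := greenFn_le_two_mul hd x i h6
  rw [← hn, ← hA] at hmain
  -- Upper and lower heat kernel bounds differ by the factor `104 ^ d = T` and the tails of `a ^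
  -- (-d/2)` scale with the power `s = 1 - d/2 ≤ -1/2`. So `lam ≥ (4T)²` makes up for `T`, for the
  -- factor `2` in `hmain`, and gains a half.
  set lam : ℝ := A / k ^ 2 with hlam
  have hlam1 : (4 * T) ^ 2 ≤ lam := by
    rw [hlam, hA, div_div, le_div_iff₀ (by positivity)]
    have : (48 * d * T * k) ^ 2 ≤ n ^ 2 := by gcongr
    refine le_trans ?_ this
    have e1 : (4 * T) ^ 2 * (12 * d * k ^ 2) = (T * k) ^ 2 * (192 * d) := by ring
    have e2 : (48 * d * T * k) ^ 2 = (T * k) ^ 2 * (2304 * d ^ 2) := by ring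
    rw [e1, e2]
    gcongr
    all_goals nlinarith
  have hlam2 : lam ^ s ≤ 1 / (4 * T) := by
    have h1 : 1 ≤ lam := le_trans (by nlinarith) hlam1
    calc lam ^ s ≤ lam ^ (-(1 / 2) : ℝ) := Real.rpow_le_rpow_of_exponent_le h1 hs0
      _ = 1 / √lam := by rw [Real.rpow_neg (by linarith), ← Real.sqrt_eq_rpow, one_div]
      _ ≤ 1 / (4 * T) := by
        refine one_div_le_one_div_of_le (by positivity) ?_
        exact Real.le_sqrt_of_sq_le hlam1
  have hAs : A ^ s = (k ^ 2) ^ s * lam ^ s := by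
    rw [← Real.mul_rpow (by positivity) (by positivity), hlam, mul_div_cancel₀ _ (by positivity)]
  have hX : 0 ≤ (k ^ 2) ^ s / (-s) := div_nonneg (by positivity) (by linarith)
  have hT2 : (2 : ℝ) ^ d = T * (1 / 52) ^ d := by
    rw [hT, ← mul_pow]; norm_num
  calc greenFn x ≤ 2 * (2 ^ d * (A ^ s / (-s))) := by linarith
    _ = 2 * T * lam ^ s * ((1 / 52) ^ d * ((k ^ 2) ^ s / (-s))) := by rw [hAs, hT2]; ring
    _ ≤ 2 * T * (1 / (4 * T)) * ((1 / 52) ^ d * ((k ^ 2) ^ s / (-s))) := by gcongr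
    _ = ((1 / 52) ^ d * ((k ^ 2) ^ s / (-s))) / 2 := by field_simp; ring
    _ ≤ greenFn y / 2 := by linarith

end heat

section gradient
variable {d : ℕ}

/-! ### Gradient bounds for the Green function -/

lemma abs_greenFn_sub_single_le (hd : 3 ≤ d) (x : Site d) (i : Fin d) {c : ℤ}
    (hc : c.natAbs = 1) (hx : 12 * d ≤ supNorm x) :
    |greenFn (x + Pi.single i c) - greenFn x| ≤ 12 * d / supNorm x * greenFn x := by
  have : NeZero d := ⟨by omega⟩
  have hg := greenFn_nonneg x
  have hx' : (12 * d : ℝ) ≤ supNorm x := by exact_mod_cast hx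
  have hd' : (3 : ℝ) ≤ d := by exact_mod_cast hd
  have hx0 : (0 : ℝ) < supNorm x := by linarith
  by_cases h : (x i + c).natAbs = (x i).natAbs + 1
  · obtain ⟨l, hl⟩ := exists_natAbs_eq_supNorm x
    rw [abs_sub_comm]
    refine (abs_greenFn_sub_le_of_natAbs hd x i l c h (hl ▸ natAbs_le_supNorm x i)).trans ?_
    rw [hl]
    gcongr
    · norm_num
    · linarith
  -- The step lowers `|x i|`, so the gradient bound is applied to the reversed step from `x'`.
  -- Returning from `greenFn x'` to `greenFn x` costs a factor two, hence `12` instead of `6`.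
  · set x' := x + Pi.single i c with hx'def
    have e1 : x' + Pi.single i (-c) = x := by
      rw [hx'def, add_assoc, ← Pi.single_add]; simp
    have e2 : x' i = x i + c := by simp [hx'def]
    obtain ⟨l, hl⟩ := exists_natAbs_eq_supNorm x'
    have h1 := abs_greenFn_sub_le_of_natAbs hd x' i l (-c) (by rw [e2]; omega)
      (hl ▸ natAbs_le_supNorm x' i)
    rw [e1, hl] at h1
    have h2 : supNorm x ≤ supNorm x' + 1 := by
      have := supNorm_add_le x' (Pi.single i (-c))
      rw [e1] at this
      refine this.trans (Nat.add_le_add_left (supNorm_le_iff.2 fun j => ?_) _)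
      rcases eq_or_ne j i with rfl | h <;> simp [*]
    have h2' : (supNorm x : ℝ) ≤ supNorm x' + 1 := by exact_mod_cast h2
    have hg' := greenFn_nonneg x'
    have h3 : |greenFn x' - greenFn x| ≤ 6 * d / supNorm x * greenFn x' :=
      h1.trans (by gcongr)
    have h4 : 6 * d / supNorm x ≤ (1 / 2 : ℝ) := by
      rw [div_le_iff₀ hx0]; linarith
    have h5 : greenFn x' ≤ 2 * greenFn x := by
      have := (abs_le.1 h3).2
      nlinarith
    calc _ ≤ 6 * d / supNorm x * greenFn x' := h3
      _ ≤ 6 * d / supNorm x * (2 * greenFn x) := by gcongr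
      _ = _ := by ring

/-- Follow a path of at most `n` unit steps from `x` to `x + v`. It stays at distance at least `M`
from the origin, so each step changes the Green function by a factor at most `1 + 12d/M`. -/
lemma abs_greenFn_add_sub_le_pow (hd : 3 ≤ d) {M : ℕ} (hM : 12 * d ≤ M) (x : Site d) (n : ℕ)
    (hx : M + n ≤ supNorm x) (v : Site d) (hv : ∑ i, (v i).natAbs ≤ n) :
    |greenFn (x + v) - greenFn x| ≤ ((1 + 12 * d / M : ℝ) ^ n - 1) * greenFn x := by
  have hg := greenFn_nonneg x
  have hd' : (3 : ℝ) ≤ d := by exact_mod_cast hd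
  have hM0 : (0 : ℝ) < M := by
    have : (12 * d : ℝ) ≤ M := by exact_mod_cast hM
    linarith
  have hη : (0 : ℝ) ≤ 12 * d / M := by positivity
  induction n generalizing v with
  | zero =>
    have : v = 0 := by
      funext i
      have := (Finset.sum_eq_zero_iff.1 (Nat.le_zero.1 hv)) i (Finset.mem_univ i)
      simpa using this
    simp [this]
  | succ n ih =>
    by_cases h0 : v = 0
    · subst h0
      simp only [add_zero, sub_self, abs_zero]
      exact mul_nonneg (sub_nonneg.2 (one_le_pow₀ (by linarith))) hg
    obtain ⟨i, hi⟩ := Function.ne_iff.1 h0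
    simp only [Pi.zero_apply] at hi
    obtain ⟨c, hc1, hc2⟩ : ∃ c : ℤ, c.natAbs = 1 ∧ (v i - c).natAbs + 1 = (v i).natAbs := by
      rcases lt_or_gt_of_ne hi with h | h
      · exact ⟨-1, by simp, by omega⟩
      · exact ⟨1, by simp, by omega⟩
    set v' := v - Pi.single i c with hv'
    have hvv : v = v' + Pi.single i c := by simp [hv']
    have hsum : ∑ j, (v' j).natAbs + 1 = ∑ j, (v j).natAbs := by
      rw [← Finset.sum_erase_add _ _ (Finset.mem_univ i),
        ← Finset.sum_erase_add _ (fun j => (v j).natAbs) (Finset.mem_univ i), add_assoc]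
      congr 1
      · refine Finset.sum_congr rfl fun j hj => ?_
        simp [hv', Finset.ne_of_mem_erase hj]
      · simp [hv', hc2]
    have h1 := ih (by omega) v' (by omega)
    have hsn : supNorm v' ≤ n := supNorm_le_iff.2 fun j =>
      (Finset.single_le_sum (f := fun j => (v' j).natAbs) (fun _ _ => Nat.zero_le _)
        (Finset.mem_univ j)).trans (by omega)
    have hxv : M ≤ supNorm (x + v') := by
      have := supNorm_add_le (x + v') (-v')
      rw [add_neg_cancel_right, supNorm_neg] at this
      omega
    have h2 := abs_greenFn_sub_single_le hd (x + v') i hc1 (hM.trans hxv)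
    rw [add_assoc, ← hvv] at h2
    have hg' := greenFn_nonneg (x + v')
    have h3 : |greenFn (x + v) - greenFn (x + v')| ≤ 12 * d / M * greenFn (x + v') :=
      h2.trans (by gcongr)
    have h4 : greenFn (x + v') ≤ (1 + 12 * d / M : ℝ) ^ n * greenFn x := by
      have := (abs_le.1 h1).2
      linarith
    have h5 : 12 * d / M * greenFn (x + v')
        ≤ 12 * d / M * ((1 + 12 * d / M : ℝ) ^ n * greenFn x) := by gcongr
    have h6 := abs_sub_le (greenFn (x + v)) (greenFn (x + v')) (greenFn x)
    rw [pow_succ]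
    linarith

/-- Far from the origin the Green function has a small relative variation. -/
lemma abs_greenFn_add_sub_le (hd : 3 ≤ d) {M r : ℕ} (hr : 1 ≤ r) (hM : 12 * d ^ 2 * r ≤ M)
    (x v : Site d) (hx : M + d * r ≤ supNorm x) (hv : supNorm v ≤ r) :
    |greenFn (x + v) - greenFn x| ≤ 24 * d ^ 2 * r / M * greenFn x := by
  have hd' : (3 : ℝ) ≤ d := by exact_mod_cast hd
  have hr' : (1 : ℝ) ≤ r := by exact_mod_cast hr
  have hM' : (12 * d ^ 2 * r : ℝ) ≤ M := by exact_mod_cast hM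
  have hM0 : (0 : ℝ) < M := lt_of_lt_of_le (by positivity) hM'
  have h12 : 12 * d ≤ M := by
    refine le_trans ?_ hM
    have : 1 ≤ d * r := Nat.one_le_iff_ne_zero.2 (Nat.mul_ne_zero (by omega) (by omega))
    calc 12 * d = 12 * d * 1 := by ring
      _ ≤ 12 * d * (d * r) := Nat.mul_le_mul_left _ this
      _ = _ := by ring
  have hsum : ∑ i, (v i).natAbs ≤ d * r := by
    have := Finset.sum_le_card_nsmul Finset.univ (fun i => (v i).natAbs) r
      fun i _ => (natAbs_le_supNorm v i).trans hv
    simpa using this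
  refine (abs_greenFn_add_sub_le_pow hd h12 x (d * r) hx v hsum).trans ?_
  refine mul_le_mul_of_nonneg_right ?_ (greenFn_nonneg x)
  -- The power is at most `exp t`, and `exp t - 1 ≤ t + t² ≤ 2t` as `t ≤ 1`.
  set t : ℝ := 12 * d ^ 2 * r / M with ht
  have ht0 : 0 ≤ t := by positivity
  have ht1 : t ≤ 1 := by rw [ht, div_le_one hM0]; exact hM'
  have h1 : (1 + 12 * d / M : ℝ) ^ (d * r) ≤ Real.exp t := by
    calc (1 + 12 * d / M : ℝ) ^ (d * r) ≤ Real.exp (12 * d / M) ^ (d * r) := by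
          gcongr
          rw [add_comm]
          exact Real.add_one_le_exp _
      _ = Real.exp t := by
          rw [← Real.exp_nat_mul, ht]
          congr 1
          push_cast
          ring
  have h2 := (abs_le.1 (Real.abs_exp_sub_one_sub_id_le (x := t) (by rwa [abs_of_nonneg ht0]))).2
  have h3 : 24 * d ^ 2 * r / M = 2 * t := by rw [ht]; ring
  rw [h3]
  nlinarith

end gradient

/-! ### The Dirichlet problem on finite sets -/

section dirichlet
variable {d : ℕ}

lemma lap_sub (f k : Site d → ℝ) (x : Site d) : lap (f - k) x = lap f x - lap k x := by
  unfold lap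
  rw [← Finset.sum_sub_distrib]
  exact Finset.sum_congr rfl fun i _ => by simp only [Pi.sub_apply]; ring

lemma lap_neg (f : Site d → ℝ) (x : Site d) : lap (-f) x = -lap f x := by
  unfold lap
  rw [← Finset.sum_neg_distrib]
  exact Finset.sum_congr rfl fun i _ => by simp only [Pi.neg_apply]; ring

lemma lap_smul (c : ℝ) (f : Site d → ℝ) (x : Site d) : lap (c • f) x = c * lap f x := by
  unfold lap
  rw [Finset.mul_sum]
  exact Finset.sum_congr rfl fun i _ => by simp only [Pi.smul_apply, smul_eq_mul]; ring

lemma lap_comp_sub_right (f : Site d → ℝ) (w x : Site d) :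
    lap (fun y => f (y - w)) x = lap f (x - w) := by
  unfold lap
  refine Finset.sum_congr rfl fun i _ => ?_
  rw [show x - w + Pi.single i 1 = x + Pi.single i 1 - w by abel,
    show x - w - Pi.single i 1 = x - Pi.single i 1 - w by abel]

lemma lap_mono_of_eq {f k : Site d → ℝ} {x : Site d} (h : f x = k x)
    (hn : ∀ i, f (x + Pi.single i 1) ≤ k (x + Pi.single i 1) ∧
      f (x - Pi.single i 1) ≤ k (x - Pi.single i 1)) : lap f x ≤ lap k x := by
  unfold lap
  exact Finset.sum_le_sum fun i _ => by have := hn i; linarith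

lemma lap_congr {f k : Site d → ℝ} {x : Site d} (h : f x = k x)
    (hn : ∀ i, f (x + Pi.single i 1) = k (x + Pi.single i 1) ∧
      f (x - Pi.single i 1) = k (x - Pi.single i 1)) : lap f x = lap k x :=
  le_antisymm (lap_mono_of_eq h fun i => ⟨(hn i).1.le, (hn i).2.le⟩)
    (lap_mono_of_eq h.symm fun i => ⟨(hn i).1.ge, (hn i).2.ge⟩)

/-- The maximum principle. -/
lemma le_of_lap_nonneg [NeZero d] (S : Finset (Site d)) (u : Site d → ℝ) (c : ℝ)
    (hu : ∀ x ∈ S, 0 ≤ lap u x) (hc : ∀ x ∉ S, u x ≤ c) (x : Site d) : u x ≤ c := by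
  by_contra! hx
  have hxS : x ∈ S := by by_contra h; exact absurd (hc x h) (not_le.2 hx)
  obtain ⟨m, hmS, hm⟩ := S.exists_max_image u ⟨x, hxS⟩
  have hmc : c < u m := hx.trans_le (hm x hxS)
  -- Among the maximizers in `S`, one with the largest first coordinate has a strictly lower
  -- neighbour in that direction, so the Laplacian there is negative.
  obtain ⟨y, hyT, hy⟩ := (S.filter fun y => u y = u m).exists_max_image (fun y => y 0)
    ⟨m, by simp [hmS]⟩
  obtain ⟨hyS, hym⟩ := Finset.mem_filter.1 hyT
  have hle : ∀ v, u v ≤ u y := fun v => by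
    by_cases h : v ∈ S
    · exact hym ▸ hm v h
    · exact (hc v h).trans (hym ▸ hmc.le)
  have hlt : u (y + Pi.single 0 1) < u y := by
    refine lt_of_le_of_ne (hle _) fun heq => ?_
    have hS : y + Pi.single 0 1 ∈ S := by
      by_contra h
      have := hc _ h
      rw [heq, hym] at this
      exact absurd this (not_le.2 hmc)
    have := hy _ (Finset.mem_filter.2 ⟨hS, heq.trans hym⟩)
    simp at this
  refine absurd (hu y hyS) (not_le.2 ?_)
  unfold lap
  refine Finset.sum_neg' (fun i _ => ?_) ⟨0, Finset.mem_univ _, ?_⟩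
  · have := hle (y + Pi.single i 1); have := hle (y - Pi.single i 1); linarith
  · have := hle (y - Pi.single 0 1); linarith

lemma ge_of_lap_nonpos [NeZero d] (S : Finset (Site d)) (u : Site d → ℝ) (c : ℝ)
    (hu : ∀ x ∈ S, lap u x ≤ 0) (hc : ∀ x ∉ S, c ≤ u x) (x : Site d) : c ≤ u x := by
  have := le_of_lap_nonneg S (-u) (-c) (fun x hx => by rw [lap_neg]; linarith [hu x hx])
    (fun x hx => neg_le_neg (hc x hx)) x
  simpa using this

-- Uniqueness, given by the maximum principle, implies existence: the Laplacian of the extension by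
-- zero is an injective endomorphism of the finite-dimensional space `S → ℝ`, hence surjective.
open Classical in
lemma exists_dirichlet [NeZero d] (S : Finset (Site d)) (f : Site d → ℝ) :
    ∃ u : Site d → ℝ, (∀ x ∉ S, u x = f x) ∧ ∀ x ∈ S, lap u x = 0 := by
  let E : (S → ℝ) →ₗ[ℝ] (Site d → ℝ) :=
    { toFun := fun u x => if h : x ∈ S then u ⟨x, h⟩ else 0
      map_add' := fun u v => by funext x; simp only [Pi.add_apply]; split_ifs <;> simp
      map_smul' := fun c u => by
        funext x; simp only [Pi.smul_apply, RingHom.id_apply]; split_ifs <;> simp }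
  let T : (S → ℝ) →ₗ[ℝ] (S → ℝ) :=
    { toFun := fun u x => lap (E u) x
      map_add' := fun u v => by
        funext x
        rw [map_add, show E u + E v = E u - (-E v) by simp, lap_sub, lap_neg]
        simp
      map_smul' := fun c u => by funext x; rw [map_smul, lap_smul]; simp }
  have hE : ∀ u x, x ∉ S → E u x = 0 := fun u x hx => by simp [E, hx]
  have hinj : Function.Injective T := by
    rw [injective_iff_map_eq_zero]
    intro u hu
    have hl : ∀ x ∈ S, lap (E u) x = 0 := fun x hx => congrFun hu ⟨x, hx⟩
    funext x
    have h1 := le_of_lap_nonneg S (E u) 0 (fun y hy => (hl y hy).ge)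
      (fun y hy => (hE u y hy).le) x
    have h2 := ge_of_lap_nonpos S (E u) 0 (fun y hy => (hl y hy).le)
      (fun y hy => (hE u y hy).ge) x
    have h3 : E u x = u x := by simp [E]
    rw [h3] at h1 h2
    exact le_antisymm h1 h2
  obtain ⟨v, hv⟩ := (LinearMap.injective_iff_surjective.1 hinj)
    (fun x => lap (fun y => if y ∈ S then 0 else f y) x)
  refine ⟨(fun y => if y ∈ S then 0 else f y) - E v, fun x hx => ?_, fun x hx => ?_⟩
  · simp [hx, hE v x hx]
  · rw [lap_sub]
    have := congrFun hv ⟨x, hx⟩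
    simp only [T, LinearMap.coe_mk, AddHom.coe_mk] at this
    rw [this, sub_self]

/-- Symmetry of the Laplacian on finitely supported functions. -/
lemma sum_mul_lap_comm (S : Finset (Site d)) (f k : Site d → ℝ) (hf : ∀ x ∉ S, f x = 0)
    (hk : ∀ x ∉ S, k x = 0) : ∑ x ∈ S, f x * lap k x = ∑ x ∈ S, k x * lap f x := by
  have key : ∀ (f k : Site d → ℝ), (∀ x ∉ S, f x = 0) → (∀ x ∉ S, k x = 0) → ∀ e : Site d,
      ∑ x ∈ S, f x * k (x + e) = ∑ x ∈ S, k x * f (x - e) := by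
    intro f k hf hk e
    have h1 : ∑' x, f x * k (x + e) = ∑ x ∈ S, f x * k (x + e) :=
      tsum_eq_sum fun x hx => by simp [hf x hx]
    have h2 : ∑' x, k x * f (x - e) = ∑ x ∈ S, k x * f (x - e) :=
      tsum_eq_sum fun x hx => by simp [hk x hx]
    rw [← h1, ← h2, ← (Equiv.addRight e).tsum_eq fun x => k x * f (x - e)]
    exact tsum_congr fun x => by simp [mul_comm]
  simp only [lap, Finset.mul_sum]
  rw [Finset.sum_comm, Finset.sum_comm (s := S)]
  refine Finset.sum_congr rfl fun i _ => ?_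
  have h1 := key f k hf hk (Pi.single i 1)
  have h2 := key k f hk hf (Pi.single i 1)
  simp only [mul_add, mul_sub, Finset.sum_add_distrib, Finset.sum_sub_distrib]
  rw [h1, h2, add_comm]
  congr 1
  exact Finset.sum_congr rfl fun x _ => by ring

end dirichlet

/-! ### Harnack inequality -/

section harnack
variable {d : ℕ}

/-- The closed `ℓ^∞`-ball. -/
def siteBall (z : Site d) (n : ℕ) : Finset (Site d) :=
  Fintype.piFinset fun i => Finset.Icc (z i - n) (z i + n)

lemma mem_siteBall {z w : Site d} {n : ℕ} : w ∈ siteBall z n ↔ supNorm (w - z) ≤ n := by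
  simp only [siteBall, Fintype.mem_piFinset, Finset.mem_Icc, supNorm_le_iff, Pi.sub_apply]
  exact forall_congr' fun i => by omega

lemma supNorm_add_single_sub_le (w z : Site d) (i : Fin d) :
    supNorm (w + Pi.single i 1 - z) ≤ supNorm (w - z) + 1 := by
  rw [add_sub_right_comm]
  exact (supNorm_add_le _ _).trans (Nat.add_le_add_left (supNorm_single_one i) _)

lemma supNorm_sub_single_sub_le (w z : Site d) (i : Fin d) :
    supNorm (w - Pi.single i 1 - z) ≤ supNorm (w - z) + 1 := by
  rw [sub_right_comm, sub_eq_add_neg]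
  refine (supNorm_add_le _ _).trans (Nat.add_le_add_left ?_ _)
  rw [supNorm_neg]
  exact supNorm_single_one i

/-- A gradient estimate for positive harmonic functions on large balls. -/
theorem abs_sub_le_of_harmonic (hd : 3 ≤ d) {N M r : ℕ} (hr : 1 ≤ r) (hM : 12 * d ^ 2 * r ≤ M)
    (hN : 48 * d * 104 ^ d * (M + d * r + 1) ≤ N) (z : Site d) (h : Site d → ℝ)
    (h0 : ∀ x, 0 ≤ h x) (hh : ∀ x, supNorm (x - z) ≤ N → lap h x = 0)
    (w : Site d) (hw : supNorm (w - z) ≤ r) :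
    |h w - h z| ≤ 72 * d ^ 2 * r / M * h z := by
  have : NeZero d := ⟨by omega⟩
  set m := M + d * r with hm
  have hdr : r ≤ d * r := Nat.le_mul_of_pos_left r (by omega)
  have hmN : m < N := by
    refine lt_of_lt_of_le (Nat.lt_succ_self m) (le_trans ?_ hN)
    exact Nat.le_mul_of_pos_left _ (by positivity)
  set η : ℝ := 24 * d ^ 2 * r / M with hη
  have hη0 : 0 ≤ η := by positivity
  -- the reduced function of `h` on the ball of radius `m`
  obtain ⟨k, hk1, hk2⟩ := exists_dirichlet (siteBall z N \ siteBall z m)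
    (fun x => if supNorm (x - z) ≤ m then h x else 0)
  have hkin : ∀ x, supNorm (x - z) ≤ m → k x = h x := fun x hx => by
    rw [hk1 x (by simp [mem_siteBall, hx]), if_pos hx]
  have hkout : ∀ x ∉ siteBall z N, k x = 0 := fun x hx => by
    rw [mem_siteBall, not_le] at hx
    rw [hk1 x (by simp [mem_siteBall, hx]), if_neg (by omega)]
  have hk0 : ∀ x, 0 ≤ k x := ge_of_lap_nonpos _ k 0 (fun x hx => (hk2 x hx).le) fun x hx => by
    rw [hk1 x hx]; split_ifs
    exacts [h0 x, le_rfl]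
  have hkh : ∀ x, k x ≤ h x := fun x => by
    have := le_of_lap_nonneg _ (k - h) 0 (fun x hx => by
      rw [lap_sub, hk2 x hx, hh x (mem_siteBall.1 (Finset.mem_sdiff.1 hx).1), sub_zero])
      (fun x hx => by
        simp only [Pi.sub_apply, hk1 x hx]
        split_ifs
        · simp
        · simpa using h0 x) x
    simpa using this
  -- Where `k` touches its harmonic majorant `h`, its Laplacian is at most that of `h`. Inside the
  -- ball of radius `m` the two agree at all neighbours, so by `hμ0` the charge `-lap k` is carried
  -- by the sphere of radius `m`.
  have hμ : ∀ y ∈ siteBall z N, lap k y ≤ 0 := fun y hy => by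
    by_cases hym : supNorm (y - z) ≤ m
    · rw [← hh y (mem_siteBall.1 hy)]
      exact lap_mono_of_eq (hkin y hym) fun i => ⟨hkh _, hkh _⟩
    · exact (hk2 y (by simp [mem_siteBall, hym, mem_siteBall.1 hy])).le
  have hμ0 : ∀ y ∈ siteBall z N, supNorm (y - z) ≠ m → lap k y = 0 := fun y hy hym => by
    rcases lt_or_gt_of_ne hym with hlt | hlt
    · rw [← hh y (mem_siteBall.1 hy)]
      exact lap_congr (hkin y hlt.le) fun i =>
        ⟨hkin _ ((supNorm_add_single_sub_le y z i).trans hlt),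
          hkin _ ((supNorm_sub_single_sub_le y z i).trans hlt)⟩
    · exact hk2 y (by simp [mem_siteBall, hlt, mem_siteBall.1 hy])
  -- Green functions killed outside of the ball of radius `N`
  choose D hD1 hD2 using fun v : Site d => exists_dirichlet (siteBall z N) fun y => greenFn (y - v)
  set γ : Site d → Site d → ℝ := fun v => (fun y => greenFn (y - v)) - D v with hγ
  have hγout : ∀ v, ∀ y ∉ siteBall z N, γ v y = 0 := fun v y hy => by
    simp [hγ, hD1 v y hy]
  have hγlap : ∀ v, ∀ y ∈ siteBall z N, lap (γ v) y = if y = v then -1 else 0 := fun v y hy => by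
    rw [hγ, lap_sub, hD2 v y hy, sub_zero, lap_comp_sub_right, lap_greenFn hd]
    simp [sub_eq_zero]
  -- Green's identity for `k` and `γ v`, both zero off the large ball. The variation of `h` now
  -- reduces to that of the killed Green function in its pole, since the charge is nonnegative.
  have hrep : ∀ v, supNorm (v - z) ≤ m → h v = ∑ y ∈ siteBall z N, γ v y * (-lap k y) := by
    intro v hv
    have h1 := sum_mul_lap_comm (siteBall z N) k (γ v) hkout (hγout v)
    have h2 : ∑ y ∈ siteBall z N, k y * lap (γ v) y = -h v := by
      rw [Finset.sum_eq_single_of_mem v (mem_siteBall.2 (by omega)) fun y hy hyv => by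
        simp [hγlap v y hy, hyv], hγlap v v (mem_siteBall.2 (by omega)), hkin v hv]
      simp
    simp only [mul_neg, Finset.sum_neg_distrib]
    rw [← h1, h2, neg_neg]
  -- Moving the pole changes `greenFn` by at most `η G` and, by the maximum principle, the
  -- correction `D` by at most `η G / 2`. The radius `N` is so large that `D z ≤ G / 2`, whence `G ≤
  -- 2 γ z y`.
  have hγdiff : ∀ y, supNorm (y - z) = m → |γ w y - γ z y| ≤ 3 * η * γ z y := by
    intro y hy
    set G : ℝ := greenFn (y - z) with hG
    have hG0 : 0 ≤ G := greenFn_nonneg _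
    have hdiff : ∀ b, m ≤ supNorm (b - z) →
        |greenFn (b - w) - greenFn (b - z)| ≤ η * greenFn (b - z) := fun b hb => by
      have := abs_greenFn_add_sub_le hd hr hM (b - z) (z - w) hb
        (by rw [← supNorm_neg]; simpa using hw)
      simpa using this
    have hfar : ∀ b ∉ siteBall z N, greenFn (b - z) ≤ G / 2 := fun b hb => by
      rw [mem_siteBall, not_le] at hb
      refine greenFn_le_half hd _ _ ?_
      rw [hy]
      exact hN.trans hb.le
    have hbd : ∀ b ∉ siteBall z N, |D w b - D z b| ≤ η * (G / 2) := fun b hb => by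
      have hb' := hb
      rw [mem_siteBall, not_le] at hb'
      rw [hD1 w b hb, hD1 z b hb]
      exact (hdiff b (by omega)).trans (mul_le_mul_of_nonneg_left (hfar b hb) hη0)
    have hlap : ∀ x ∈ siteBall z N, lap (D w - D z) x = 0 := fun x hx => by
      rw [lap_sub, hD2 w x hx, hD2 z x hx, sub_zero]
    have h1 : |D w y - D z y| ≤ η * (G / 2) := abs_le.2
      ⟨ge_of_lap_nonpos _ (D w - D z) _ (fun x hx => (hlap x hx).le)
        (fun x hx => (abs_le.1 (hbd x hx)).1) y,
      le_of_lap_nonneg _ (D w - D z) _ (fun x hx => (hlap x hx).ge)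
        (fun x hx => (abs_le.1 (hbd x hx)).2) y⟩
    have h2 : D z y ≤ G / 2 := le_of_lap_nonneg _ (D z) _ (fun x hx => (hD2 z x hx).ge)
      (fun x hx => by rw [hD1 z x hx]; exact hfar x hx) y
    have h3 := hdiff y hy.ge
    rw [← hG] at h3
    have h4 : γ w y - γ z y = (greenFn (y - w) - G) - (D w y - D z y) := by
      simp only [hγ, Pi.sub_apply]; ring
    have h5 : γ z y = G - D z y := rfl
    rw [h4, h5]
    have h6 := abs_sub (greenFn (y - w) - G) (D w y - D z y)
    nlinarith
  rw [hrep w (by omega), hrep z (by simp [supNorm]), ← Finset.sum_sub_distrib, Finset.mul_sum]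
  refine (Finset.abs_sum_le_sum_abs _ _).trans (Finset.sum_le_sum fun y hy => ?_)
  by_cases hym : supNorm (y - z) = m
  · rw [← sub_mul, abs_mul, abs_of_nonneg (neg_nonneg.2 (hμ y hy)), ← mul_assoc]
    refine mul_le_mul_of_nonneg_right ?_ (neg_nonneg.2 (hμ y hy))
    refine (hγdiff y hym).trans_eq ?_
    rw [hη]; ring
  · simp [hμ0 y hy hym]

end harnack

/-! ### Boundary Harnack comparison of normal derivatives. -/

section comparison
variable {d : ℕ}

/-- One half of the boundary Harnack comparison, with the harmonic extensions `h₁`, `h₂` of the two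
functions to the whole ball. -/
lemma mul_sub_mul_le_of_potentials {η a b h₁ h₂ s₁ s₂ : ℝ} (hη0 : 0 ≤ η)
    (ha : 0 ≤ a) (hb : 0 ≤ b) (h1 : |h₁ - a| ≤ η * a) (h2 : |h₂ - b| ≤ η * b)
    (hs : (1 - η) * a * s₂ ≤ (1 + η) * b * s₁) (hs2 : s₂ ≤ (1 + η) * b) :
    b * (h₁ - s₁) - a * (h₂ - s₂) ≤ 6 * η * (a * b) := by
  have e1 := (abs_le.1 h1).2
  have e2 := (abs_le.1 h2).1
  have hab := mul_nonneg ha hb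
  have f1 : b * h₁ ≤ b * ((1 + η) * a) := mul_le_mul_of_nonneg_left (by linarith) hb
  have f2 : a * ((1 - η) * b) ≤ a * h₂ := mul_le_mul_of_nonneg_left (by linarith) ha
  -- By `hs` the cross difference is a small multiple of `a * s₂`, which the bound `hs2` makes
  -- comparable to `a * b`.
  have f3 : a * s₂ - b * s₁ ≤ 4 * η * (a * b) := by
    have g1 : a * s₂ ≤ a * ((1 + η) * b) := mul_le_mul_of_nonneg_left hs2 ha
    have g2 : (1 + η) * (a * s₂ - b * s₁) ≤ 2 * η * (a * s₂) := by linarith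
    have g3 : 2 * η * (a * s₂) ≤ 2 * η * (a * ((1 + η) * b)) := by gcongr
    have g4 : (1 + η) * (a * s₂ - b * s₁) ≤ (1 + η) * (2 * η * (a * b)) := by linarith
    have g5 := le_of_mul_le_mul_left g4 (by linarith)
    have : 0 ≤ η * (a * b) := by positivity
    linarith
  linarith

/-- Two nonnegative functions that vanish on `D` and are harmonic on a large ball around `D`,
outside of `D`, have nearly proportional normal derivatives on `D`. -/
theorem exists_lap_comparison (hd : 3 ≤ d) {N M r : ℕ} (hr : 1 ≤ r) (hM : 12 * d ^ 2 * r ≤ M)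
    (hN : 48 * d * 104 ^ d * (M + d * r + 1) ≤ N) {η : ℝ} (hη : 72 * d ^ 2 * r / M ≤ η)
    (hη1 : 12 * η ≤ 1) (z : Site d) (D : Finset (Site d))
    (hD : ∀ x ∈ D, supNorm (x - z) + 1 ≤ r) (q p : Site d → ℝ)
    (hq0 : ∀ x, 0 ≤ q x) (hp0 : ∀ x, 0 ≤ p x) (hqD : ∀ x ∈ D, q x = 0) (hpD : ∀ x ∈ D, p x = 0)
    (hq : ∀ x ∉ D, supNorm (x - z) ≤ N → lap q x = 0)
    (hp : ∀ x ∉ D, supNorm (x - z) ≤ N → lap p x = 0)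
    (hp1 : ∀ x, p x ≤ 1) (hp2 : ∀ x, supNorm (x - z) = r → 1 / 2 ≤ p x) :
    ∃ lam : ℝ, 0 ≤ lam ∧ ∀ x ∈ D, (1 - 12 * η) * lam * lap p x ≤ lap q x ∧
      lap q x ≤ (1 + 12 * η) * lam * lap p x := by
  have : NeZero d := ⟨by omega⟩
  have hη0 : 0 ≤ η := le_trans (by positivity) hη
  have hη1' : η ≤ 1 := by linarith
  have hdr : r ≤ d * r := Nat.le_mul_of_pos_left r (by omega)
  have hrN : r < N := by
    have : 1 * (M + d * r + 1) ≤ 48 * d * 104 ^ d * (M + d * r + 1) :=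
      Nat.mul_le_mul_right _ (Nat.one_le_iff_ne_zero.2 (by positivity))
    omega
  have hDN : ∀ x ∈ D, supNorm (x - z) ≤ N := fun x hx => by have := hD x hx; omega
  -- extension of a function to the ball by harmonic continuation across `D`
  have ext : ∀ q : Site d → ℝ, (∀ x, 0 ≤ q x) → (∀ x ∈ D, q x = 0) →
      (∀ x ∉ D, supNorm (x - z) ≤ N → lap q x = 0) → ∃ h : Site d → ℝ,
      (∀ x ∉ siteBall z N, h x = q x) ∧ (∀ x ∈ siteBall z N, lap h x = 0) ∧ (∀ x, q x ≤ h x) ∧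
      (∀ x, supNorm (x - z) ≤ r → |h x - h z| ≤ η * h z) := by
    intro q hq0 hqD hq
    obtain ⟨h, hh1, hh2⟩ := exists_dirichlet (siteBall z N) q
    have hqh : ∀ x, q x ≤ h x := fun x => by
      have := le_of_lap_nonneg (siteBall z N) (q - h) 0 (fun x hx => by
        rw [lap_sub, hh2 x hx, sub_zero]
        by_cases hxD : x ∈ D
        · unfold lap
          refine Finset.sum_nonneg fun i _ => ?_
          rw [hqD x hxD]
          have := hq0 (x + Pi.single i 1); have := hq0 (x - Pi.single i 1); linarith
        · exact (hq x hxD (mem_siteBall.1 hx)).ge) (fun x hx => by simp [hh1 x hx]) x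
      simpa using this
    have hh0 : ∀ x, 0 ≤ h x := fun x => (hq0 x).trans (hqh x)
    refine ⟨h, hh1, hh2, hqh, fun x hx => ?_⟩
    exact (abs_sub_le_of_harmonic hd hr hM hN z h hh0
      (fun x hx => hh2 x (mem_siteBall.2 hx)) x hx).trans (mul_le_mul_of_nonneg_right hη (hh0 z))
  obtain ⟨h, hh1, hh2, hqh, hhz⟩ := ext q hq0 hqD hq
  obtain ⟨k, hk1, hk2, hpk, hkz⟩ := ext p hp0 hpD hp
  have ha : 0 ≤ h z := (hq0 z).trans (hqh z)
  have hb : 0 ≤ k z := (hp0 z).trans (hpk z)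
  have hk_le : ∀ x, k x ≤ 1 := le_of_lap_nonneg _ k 1 (fun x hx => (hk2 x hx).ge)
    fun x hx => by rw [hk1 x hx]; exact hp1 x
  -- comparison of potentials supported by `D`
  have hpot : ∀ q p h k : Site d → ℝ, (∀ x ∈ D, q x = 0) → (∀ x ∈ D, p x = 0) →
      (∀ x ∉ D, supNorm (x - z) ≤ N → lap q x = 0) →
      (∀ x ∉ D, supNorm (x - z) ≤ N → lap p x = 0) →
      (∀ x ∉ siteBall z N, h x = q x) → (∀ x ∈ siteBall z N, lap h x = 0) →
      (∀ x ∉ siteBall z N, k x = p x) → (∀ x ∈ siteBall z N, lap k x = 0) →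
      (∀ x, supNorm (x - z) ≤ r → |h x - h z| ≤ η * h z) →
      (∀ x, supNorm (x - z) ≤ r → |k x - k z| ≤ η * k z) → 0 ≤ h z → 0 ≤ k z →
      (∀ x, (1 - η) * h z * (k x - p x) ≤ (1 + η) * k z * (h x - q x)) ∧
      ∀ x, k x - p x ≤ (1 + η) * k z := by
    intro q p h k hqD hpD hq hp hh1 hh2 hk1 hk2 hhz hkz ha hb
    -- `h - q` vanishes outside the ball, is harmonic off `D`, and on `D` equals `h`, hence is
    -- nearly the constant `h z`. The same holds for `k - p`, so the maximum principle extends the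
    -- comparison from `D` to everywhere.
    have hlq : ∀ x ∈ siteBall z N \ D, lap (h - q) x = 0 := fun x hx => by
      obtain ⟨h1, h2⟩ := Finset.mem_sdiff.1 hx
      rw [lap_sub, hh2 x h1, hq x h2 (mem_siteBall.1 h1), sub_zero]
    have hlp : ∀ x ∈ siteBall z N \ D, lap (k - p) x = 0 := fun x hx => by
      obtain ⟨h1, h2⟩ := Finset.mem_sdiff.1 hx
      rw [lap_sub, hk2 x h1, hp x h2 (mem_siteBall.1 h1), sub_zero]
    have hcase : ∀ x ∉ siteBall z N \ D, x ∉ siteBall z N ∨ x ∈ D := fun x hx => by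
      by_contra! hcon
      exact hx (Finset.mem_sdiff.2 hcon)
    constructor
    · intro x
      have := le_of_lap_nonneg (siteBall z N \ D)
        (((1 - η) * h z) • (k - p) - ((1 + η) * k z) • (h - q)) 0 (fun x hx => by
          rw [lap_sub, lap_smul, lap_smul, hlq x hx, hlp x hx]; simp) (fun x hx => by
          simp only [Pi.sub_apply, Pi.smul_apply, smul_eq_mul]
          rcases hcase x hx with hx | hx
          · simp [hh1 x hx, hk1 x hx]
          · rw [hqD x hx, hpD x hx, sub_zero, sub_zero, sub_nonpos]
            have e1 := (abs_le.1 (hhz x (by have := hD x hx; omega))).1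
            have e2 := (abs_le.1 (hkz x (by have := hD x hx; omega))).2
            calc (1 - η) * h z * k x ≤ (1 - η) * h z * ((1 + η) * k z) :=
                  mul_le_mul_of_nonneg_left (by linarith) (mul_nonneg (by linarith) ha)
              _ = (1 + η) * k z * ((1 - η) * h z) := by ring
              _ ≤ (1 + η) * k z * h x :=
                  mul_le_mul_of_nonneg_left (by linarith) (mul_nonneg (by linarith) hb)) x
      simp only [Pi.sub_apply, Pi.smul_apply, smul_eq_mul] at this
      linarith
    · refine le_of_lap_nonneg (siteBall z N \ D) (k - p) _ (fun x hx => (hlp x hx).ge)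
        fun x hx => ?_
      simp only [Pi.sub_apply]
      rcases hcase x hx with hx | hx
      · rw [hk1 x hx, sub_self]
        exact mul_nonneg (by linarith) hb
      · rw [hpD x hx, sub_zero]
        have e2 := (abs_le.1 (hkz x (by have := hD x hx; omega))).2
        linarith
  obtain ⟨P1, P2⟩ := hpot q p h k hqD hpD hq hp hh1 hh2 hk1 hk2 hhz hkz ha hb
  obtain ⟨P3, P4⟩ := hpot p q k h hpD hqD hp hq hk1 hk2 hh1 hh2 hkz hhz hb ha
  have hU : ∀ x, supNorm (x - z) ≤ r → |k z * q x - h z * p x| ≤ 6 * η * (h z * k z) := by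
    intro x hx
    have e1 := mul_sub_mul_le_of_potentials hη0 ha hb (hhz x hx) (hkz x hx) (P1 x) (P2 x)
    have e2 := mul_sub_mul_le_of_potentials hη0 hb ha (hkz x hx) (hhz x hx) (P3 x) (P4 x)
    rw [sub_sub_cancel, sub_sub_cancel] at e1 e2
    rw [abs_le]
    constructor <;> linarith
  -- On the sphere `k z ≤ 1 ≤ 2 p x`, which turns the absolute error into an error relative to `p`.
  -- This is the only place where the upper bound `p ≤ 1` matters.
  have hsph : ∀ x, supNorm (x - z) = r → |k z * q x - h z * p x| ≤ 12 * η * h z * p x := by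
    intro x hx
    refine (hU x hx.le).trans ?_
    have h1 := hp2 x hx
    have h2 := hk_le z
    have : 6 * η * (h z * k z) ≤ 6 * η * (h z * (2 * p x)) := by gcongr; linarith
    linarith
  have hlapq : ∀ x ∈ siteBall z (r - 1) \ D, lap q x = 0 := fun x hx => by
    obtain ⟨h1, h2⟩ := Finset.mem_sdiff.1 hx
    exact hq x h2 (by have := mem_siteBall.1 h1; omega)
  have hlapp : ∀ x ∈ siteBall z (r - 1) \ D, lap p x = 0 := fun x hx => by
    obtain ⟨h1, h2⟩ := Finset.mem_sdiff.1 hx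
    exact hp x h2 (by have := mem_siteBall.1 h1; omega)
  -- the comparison extends from the sphere of radius `r` to the inside
  have hin : ∀ c e : ℝ, (∀ x, supNorm (x - z) = r → c * q x - e * p x ≤ 0) →
      ∀ x, supNorm (x - z) ≤ r → c * q x - e * p x ≤ 0 := by
    intro c e hce x hx
    classical
    -- The function is cut off outside the ball of radius `r`, where no sign is known. The cut does
    -- not affect the Laplacian at distance at most `r - 1`.
    obtain ⟨u, hu1, hu2⟩ : ∃ u : Site d → ℝ, (∀ x, supNorm (x - z) ≤ r → u x = c * q x - e * p x) ∧
        ∀ x, r < supNorm (x - z) → u x = 0 :=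
      ⟨fun x => if supNorm (x - z) ≤ r then c * q x - e * p x else 0,
        fun x hx => if_pos hx, fun x hx => if_neg (not_le.2 hx)⟩
    have hlap : ∀ x ∈ siteBall z (r - 1) \ D, 0 ≤ lap u x := fun x hx => by
      have h1 := mem_siteBall.1 (Finset.mem_sdiff.1 hx).1
      have : lap u x = lap (c • q - e • p) x :=
        lap_congr (hu1 x (by omega)) fun i =>
          ⟨hu1 _ ((supNorm_add_single_sub_le x z i).trans (by omega)),
            hu1 _ ((supNorm_sub_single_sub_le x z i).trans (by omega))⟩
      rw [this, lap_sub, lap_smul, lap_smul, hlapq x hx, hlapp x hx]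
      simp
    have := le_of_lap_nonneg _ u 0 hlap (fun x hx => by
      rcases lt_trichotomy (supNorm (x - z)) r with h1 | h1 | h1
      · have hxD : x ∈ D := by
          by_contra hcon
          exact hx (Finset.mem_sdiff.2 ⟨mem_siteBall.2 (by omega), hcon⟩)
        rw [hu1 x h1.le, hqD x hxD, hpD x hxD]; simp
      · rw [hu1 x h1.le]; exact hce x h1
      · exact (hu2 x h1).le) x
    rwa [hu1 x hx] at this
  have hup := hin (k z) ((1 + 12 * η) * h z) fun x hx => by
    have := (abs_le.1 (hsph x hx)).2; linarith
  have hlow := hin (-k z) (-((1 - 12 * η) * h z)) fun x hx => by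
    have := (abs_le.1 (hsph x hx)).1; linarith
  -- If `k z` were zero, then `k`, and with it `p`, would vanish on the sphere of radius `r`, where
  -- `p ≥ 1/2`.
  have hkpos : 0 < k z := by
    obtain ⟨v, hv⟩ : ∃ v : Site d, supNorm (v - z) = r := by
      refine ⟨z + fun _ => (r : ℤ), le_antisymm (supNorm_le_iff.2 fun i => by simp) ?_⟩
      have := natAbs_le_supNorm (z + (fun _ => (r : ℤ)) - z) 0
      simpa using this
    have h1 := hp2 v hv
    have h2 := hpk v
    have h3 := (abs_le.1 (hkz v hv.le)).2
    by_contra! hcon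
    have : k z = 0 := le_antisymm hcon hb
    rw [this] at h3
    linarith
  -- The factor is the ratio of the harmonic extensions at the centre. As `q` and `p` vanish on `D`,
  -- their Laplacians there are sums of neighbouring values, so the inequalities pass to the
  -- Laplacians.
  refine ⟨h z / k z, by positivity, fun x hx => ?_⟩
  have hn : ∀ i, supNorm (x + Pi.single i 1 - z) ≤ r ∧ supNorm (x - Pi.single i 1 - z) ≤ r :=
    fun i => ⟨(supNorm_add_single_sub_le x z i).trans (hD x hx),
      (supNorm_sub_single_sub_le x z i).trans (hD x hx)⟩
  have e1 : k z * lap q x ≤ (1 + 12 * η) * h z * lap p x := by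
    rw [← lap_smul, ← lap_smul]
    refine lap_mono_of_eq (by simp [hqD x hx, hpD x hx]) fun i => ?_
    have h1 := hup _ (hn i).1
    have h2 := hup _ (hn i).2
    simp only [Pi.smul_apply, smul_eq_mul]
    exact ⟨by linarith, by linarith⟩
  have e2 : (1 - 12 * η) * h z * lap p x ≤ k z * lap q x := by
    rw [← lap_smul, ← lap_smul]
    refine lap_mono_of_eq (by simp [hqD x hx, hpD x hx]) fun i => ?_
    have h1 := hlow _ (hn i).1
    have h2 := hlow _ (hn i).2
    simp only [Pi.smul_apply, smul_eq_mul]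
    exact ⟨by linarith, by linarith⟩
  constructor
  · refine le_of_mul_le_mul_left ?_ hkpos
    calc k z * ((1 - 12 * η) * (h z / k z) * lap p x) = (1 - 12 * η) * h z * lap p x := by
          field_simp
      _ ≤ _ := e2
  · refine le_of_mul_le_mul_left ?_ hkpos
    calc k z * lap q x ≤ _ := e1
      _ = k z * ((1 + 12 * η) * (h z / k z) * lap p x) := by field_simp

end comparison

/-! ### The walk on sequences and its one-step decomposition -/

section cons
variable {E : Type*}

/-- The sequence `(a, w_0, w_1, …)`. -/
def consSeq (a : E) (w : ℕ → E) : ℕ → E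
  | 0 => a
  | n + 1 => w n

@[simp] lemma consSeq_zero (a : E) (w : ℕ → E) : consSeq a w 0 = a := rfl

@[simp] lemma consSeq_succ (a : E) (w : ℕ → E) (n : ℕ) : consSeq a w (n + 1) = w n := rfl

variable [MeasurableSpace E]

lemma measurable_consSeq : Measurable fun p : E × (ℕ → E) => consSeq p.1 p.2 := by
  refine measurable_pi_iff.2 fun n => ?_
  rcases n with _ | n
  · exact measurable_fst
  · exact (measurable_pi_apply n).comp measurable_snd

/-- An independent entry put in front of an i.i.d. sequence gives an i.i.d. sequence. This is
checked on cylinders, padded with `univ` to an initial segment of indices so that the index shift is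
harmless. -/
lemma map_consSeq_infinitePi (ν : Measure E) [IsProbabilityMeasure ν] :
    (ν.prod (Measure.infinitePi fun _ : ℕ => ν)).map (fun p => consSeq p.1 p.2)
      = Measure.infinitePi fun _ : ℕ => ν := by
  classical
  refine Measure.eq_infinitePi _ fun s t ht => ?_
  obtain ⟨N, hN⟩ : ∃ N, s ⊆ Finset.range (N + 1) :=
    ⟨s.sup id, fun i hi => Finset.mem_range.2 (Nat.lt_succ_of_le (Finset.le_sup (f := id) hi))⟩
  set t' : ℕ → Set E := fun i => if i ∈ s then t i else Set.univ with ht'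
  have ht'm : ∀ i, MeasurableSet (t' i) := fun i => by
    simp only [ht']; split_ifs
    exacts [ht i, .univ]
  have h1 : Set.pi (s : Set ℕ) t = {w | ∀ i ∈ Finset.range (N + 1), w i ∈ t' i} := by
    ext w
    simp only [Set.mem_pi, Finset.mem_coe, Set.mem_ofPred_eq, ht']
    refine ⟨fun h i _ => ?_, fun h i hi => by simpa [hi] using h i (hN hi)⟩
    split_ifs with hi
    exacts [h i hi, trivial]
  have h2 : ∏ i ∈ s, ν (t i) = ∏ i ∈ Finset.range (N + 1), ν (t' i) := by
    rw [← Finset.prod_subset hN fun i _ hi => by simp [ht', hi]]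
    exact Finset.prod_congr rfl fun i hi => by simp [ht', hi]
  have h3 : (fun p : E × (ℕ → E) => consSeq p.1 p.2) ⁻¹' Set.pi (s : Set ℕ) t
      = t' 0 ×ˢ Set.pi (Finset.range N : Set ℕ) fun i => t' (i + 1) := by
    rw [h1]
    ext ⟨a, w⟩
    simp only [Set.mem_preimage, Set.mem_ofPred_eq, Set.mem_prod, Set.mem_pi, Finset.mem_coe,
      Finset.mem_range]
    refine ⟨fun h => ⟨h 0 (by omega), fun i hi => h (i + 1) (by omega)⟩, fun h i hi => ?_⟩
    rcases i with _ | i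
    exacts [h.1, h.2 i (by omega)]
  rw [Measure.map_apply measurable_consSeq (MeasurableSet.pi s.countable_toSet fun i _ => ht i), h3,
    Measure.prod_prod, Measure.infinitePi_pi _ (fun i _ => ht'm (i + 1)), h2,
    Finset.prod_range_succ']
  rw [mul_comm]

lemma lintegral_infinitePi_consSeq (ν : Measure E) [IsProbabilityMeasure ν] {F : (ℕ → E) → ℝ≥0∞}
    (hF : Measurable F) : ∫⁻ w, F w ∂(Measure.infinitePi fun _ : ℕ => ν)
      = ∫⁻ a, ∫⁻ w, F (consSeq a w) ∂(Measure.infinitePi fun _ : ℕ => ν) ∂ν := by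
  conv_lhs => rw [← map_consSeq_infinitePi ν]
  rw [lintegral_map hF measurable_consSeq, lintegral_prod _ (by
    exact (hF.comp measurable_consSeq).aemeasurable)]

end cons

/-! ### The law of the walk: Markov property, infinite lifetime, transience. -/

section walk
variable {d : ℕ}

instance isProbabilityMeasure_expMeasure_one : IsProbabilityMeasure (expMeasure 1) :=
  isProbabilityMeasure_expMeasure one_pos

lemma lintegral_stepLaw (f : Site d → ℝ≥0∞) : ∫⁻ e, f e ∂(stepLaw d)
    = (2 * d : ℝ≥0∞)⁻¹ * ∑ i, (f (Pi.single i 1) + f (-Pi.single i 1)) := by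
  unfold stepLaw
  rw [lintegral_smul_measure, lintegral_finsetSum_measure, smul_eq_mul]
  congr 1
  refine Finset.sum_congr rfl fun i _ => ?_
  rw [lintegral_add_measure, lintegral_dirac, lintegral_dirac]

instance isProbabilityMeasure_stepLaw [NeZero d] : IsProbabilityMeasure (stepLaw d) := ⟨by
  rw [← lintegral_one, lintegral_stepLaw]
  simp only [Finset.sum_const, Finset.card_univ, Fintype.card_fin, nsmul_eq_mul]
  rw [show (d : ℝ≥0∞) * (1 + 1) = 2 * d by ring]
  refine ENNReal.inv_mul_cancel ?_ ?_
  · have := NeZero.ne d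
    simp [this]
  · exact ENNReal.mul_ne_top (by simp) (by simp)⟩

lemma lintegral_stepLaw_ofReal [NeZero d] (f : Site d → ℝ) (hf : ∀ x, 0 ≤ f x) (x : Site d) :
    ∫⁻ e, ENNReal.ofReal (f (x + e)) ∂(stepLaw d) = ENNReal.ofReal (f x + lap f x / (2 * d)) := by
  have hd : (0 : ℝ) < d := by exact_mod_cast Nat.pos_of_ne_zero (NeZero.ne d)
  rw [lintegral_stepLaw]
  have h1 : f x + lap f x / (2 * d)
      = (2 * d : ℝ)⁻¹ * ∑ i, (f (x + Pi.single i 1) + f (x - Pi.single i 1)) := by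
    unfold lap
    rw [Finset.sum_sub_distrib]
    simp only [Finset.sum_const, Finset.card_univ, Fintype.card_fin, nsmul_eq_mul]
    field_simp
    ring
  rw [h1, ENNReal.ofReal_mul (by positivity), ENNReal.ofReal_inv_of_pos (by positivity),
    ENNReal.ofReal_mul (by norm_num), ENNReal.ofReal_sum_of_nonneg fun i _ =>
      add_nonneg (hf _) (hf _)]
  simp only [ENNReal.ofReal_ofNat, ENNReal.ofReal_natCast, ENNReal.ofReal_add (hf _) (hf _),
    sub_eq_add_neg]

lemma ae_stepLaw_mem : ∀ᵐ e ∂(stepLaw d), ∃ i, e = Pi.single i 1 ∨ e = -Pi.single i 1 := by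
  rw [ae_iff, ← lintegral_indicator_one (MeasurableSet.of_discrete), lintegral_stepLaw]
  simp only [mul_eq_zero, Finset.sum_eq_zero_iff]
  refine Or.inr fun i _ => ?_
  rw [add_eq_zero, Set.indicator_apply_eq_zero, Set.indicator_apply_eq_zero]
  exact ⟨fun h => absurd ⟨i, Or.inl rfl⟩ h, fun h => absurd ⟨i, Or.inr rfl⟩ h⟩

lemma measurable_walkOfSteps (x : Site d) : Measurable (walkOfSteps x) := by
  unfold walkOfSteps
  fun_prop

/-- The law of the walk started at `x`, on the space of all sequences. -/
def pathLaw (x : Site d) : Measure (ℕ → Site d × ℝ) :=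
  (Measure.infinitePi fun _ : ℕ => (stepLaw d).prod (expMeasure 1)).map (walkOfSteps x)

instance isProbabilityMeasure_pathLaw [NeZero d] (x : Site d) :
    IsProbabilityMeasure (pathLaw x) :=
  Measure.isProbabilityMeasure_map (measurable_walkOfSteps x).aemeasurable

lemma walkOfSteps_consSeq (x : Site d) (a : Site d × ℝ) (s : ℕ → Site d × ℝ) :
    walkOfSteps x (consSeq a s) = consSeq (x, a.2) (walkOfSteps (x + a.1) s) := by
  funext n
  rcases n with _ | n
  · simp [walkOfSteps]
  · simp only [walkOfSteps, consSeq_succ, Finset.sum_range_succ', consSeq_zero]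
    rw [add_assoc x, add_comm a.1]

/-- The Markov property at the first jump. -/
lemma lintegral_pathLaw [NeZero d] (x : Site d) {F : (ℕ → Site d × ℝ) → ℝ≥0∞} (hF : Measurable F) :
    ∫⁻ w, F w ∂(pathLaw x)
      = ∫⁻ e, ∫⁻ s, ∫⁻ w, F (consSeq (x, s) w) ∂(pathLaw (x + e)) ∂(expMeasure 1) ∂(stepLaw d) := by
  unfold pathLaw
  have hG : Measurable fun s => F (walkOfSteps x s) := hF.comp (measurable_walkOfSteps x)
  rw [lintegral_map hF (measurable_walkOfSteps x), lintegral_infinitePi_consSeq _ hG]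
  simp only [walkOfSteps_consSeq]
  rw [lintegral_prod]
  · refine lintegral_congr fun e => lintegral_congr fun s => ?_
    have hc : Measurable fun w => F (consSeq (x, s) w) :=
      hF.comp (measurable_consSeq.comp (measurable_const.prodMk measurable_id))
    rw [lintegral_map hc (measurable_walkOfSteps _)]
  · refine Measurable.aemeasurable ?_
    have h : Measurable fun p : (Site d × ℝ) × (ℕ → Site d × ℝ) =>
        F (walkOfSteps x (consSeq p.1 p.2)) :=
      hF.comp ((measurable_walkOfSteps x).comp measurable_consSeq)
    simp only [walkOfSteps_consSeq] at h
    exact h.lintegral_prod_right'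

/-- The Markov property, for events that depend only on the path after the first jump. -/
lemma pathLaw_shift [NeZero d] (x : Site d) {S : Set (ℕ → Site d × ℝ)} (hS : MeasurableSet S) :
    pathLaw x {w | (fun n => w (n + 1)) ∈ S} = ∫⁻ e, pathLaw (x + e) S ∂(stepLaw d) := by
  have hm : Measurable fun w : ℕ → Site d × ℝ => fun n => w (n + 1) := by fun_prop
  have hS' : MeasurableSet {w : ℕ → Site d × ℝ | (fun n => w (n + 1)) ∈ S} := hm hS
  rw [← lintegral_indicator_one hS', lintegral_pathLaw x (measurable_one.indicator hS')]
  refine lintegral_congr fun e => ?_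
  have : ∀ (s : ℝ) (w : ℕ → Site d × ℝ),
      ({w | (fun n => w (n + 1)) ∈ S}.indicator 1 (consSeq (x, s) w) : ℝ≥0∞) = S.indicator 1 w :=
    fun s w => rfl
  simp only [this, lintegral_const, measure_univ, mul_one]
  rw [lintegral_indicator_one hS]

lemma ae_pathLaw_zero (x : Site d) : ∀ᵐ w ∂(pathLaw x), (w 0).1 = x := by
  unfold pathLaw
  rw [ae_map_iff (measurable_walkOfSteps x).aemeasurable]
  · exact Filter.Eventually.of_forall fun s => by simp [walkOfSteps]
  · have hm : Measurable fun w : ℕ → Site d × ℝ => (w 0).1 := by fun_prop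
    exact hm (MeasurableSet.of_discrete (s := {x}))

lemma ae_steps [NeZero d] {p : Site d × ℝ → Prop}
    (hp : ∀ᵐ a ∂((stepLaw d).prod (expMeasure 1)), p a) (n : ℕ) :
    ∀ᵐ s ∂(Measure.infinitePi fun _ : ℕ => (stepLaw d).prod (expMeasure 1)), p (s n) :=
  (measurePreserving_eval_infinitePi (fun _ : ℕ => (stepLaw d).prod (expMeasure 1)) n)
    |>.quasiMeasurePreserving.ae hp

lemma ae_pathLaw_isNeighbor [NeZero d] (x : Site d) :
    ∀ᵐ w ∂(pathLaw x), ∀ n, IsNeighbor (w n).1 (w (n + 1)).1 := by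
  rw [ae_all_iff]
  intro n
  unfold pathLaw
  rw [ae_map_iff (measurable_walkOfSteps x).aemeasurable (measurableSet_isNeighbor n (n + 1))]
  have h : ∀ᵐ a ∂((stepLaw d).prod (expMeasure 1)),
      ∃ i, a.1 = Pi.single i 1 ∨ a.1 = -Pi.single i 1 :=
    Measure.quasiMeasurePreserving_fst.ae ae_stepLaw_mem
  filter_upwards [ae_steps h n] with s hs
  obtain ⟨i, hi⟩ := hs
  simp only [walkOfSteps, Finset.sum_range_succ, IsNeighbor]
  have : ∀ j, ((x + ∑ k ∈ Finset.range n, (s k).1) j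
      - (x + (∑ k ∈ Finset.range n, (s k).1 + (s n).1)) j) ^ 2 = ((s n).1 j) ^ 2 := fun j => by
    simp only [Pi.add_apply]; ring
  simp only [this]
  rw [Finset.sum_eq_single i]
  · rcases hi with hi | hi <;> simp [hi]
  · intro j _ hj
    rcases hi with hi | hi <;> simp [hi, hj]
  · simp

lemma ae_expMeasure_pos : ∀ᵐ s ∂(expMeasure 1), 0 < s := by
  have h : (expMeasure 1) (Set.Iic 0) = 0 := by
    unfold expMeasure gammaMeasure
    rw [withDensity_apply _ measurableSet_Iic]
    rw [← setLIntegral_congr Iio_ae_eq_Iic]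
    exact lintegral_exponentialPDF_of_nonpos (r := 1) le_rfl
  rw [ae_iff]
  simpa [Set.Iic] using h

lemma ae_pathLaw_pos [NeZero d] (x : Site d) : ∀ᵐ w ∂(pathLaw x), ∀ n, 0 < (w n).2 := by
  rw [ae_all_iff]
  intro n
  unfold pathLaw
  rw [ae_map_iff (measurable_walkOfSteps x).aemeasurable
    (measurableSet_lt measurable_const (by fun_prop))]
  exact ae_steps (Measure.quasiMeasurePreserving_snd.ae ae_expMeasure_pos) n

lemma lintegral_exp_expMeasure {a : ℝ} (ha : a < 1) :
    ∫⁻ s, ENNReal.ofReal (Real.exp (a * s)) ∂(expMeasure 1) = ENNReal.ofReal (1 / (1 - a)) := by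
  have h0 : 0 < 1 - a := by linarith
  have hm : Measurable (exponentialPDF 1) := (measurable_exponentialPDFReal 1).ennreal_ofReal
  have h1 : expMeasure 1 = volume.withDensity (exponentialPDF 1) := rfl
  rw [h1, lintegral_withDensity_eq_lintegral_mul _ hm (by fun_prop)]
  have h2 : ∀ s : ℝ, (exponentialPDF 1 * fun s => ENNReal.ofReal (Real.exp (a * s))) s
      = ENNReal.ofReal (1 / (1 - a)) * exponentialPDF (1 - a) s := by
    intro s
    simp only [Pi.mul_apply]
    rcases lt_or_ge s 0 with hs | hs
    · simp [exponentialPDF_of_neg hs]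
    · rw [exponentialPDF_of_nonneg hs, exponentialPDF_of_nonneg hs, ← ENNReal.ofReal_mul
        (by positivity), ← ENNReal.ofReal_mul (by positivity)]
      congr 1
      rw [one_mul, one_mul, ← mul_assoc, one_div, inv_mul_cancel₀ h0.ne', one_mul, ← Real.exp_add]
      congr 1
      ring
  simp only [h2]
  have hm' : Measurable (exponentialPDF (1 - a)) :=
    (measurable_exponentialPDFReal _).ennreal_ofReal
  rw [lintegral_const_mul _ hm', lintegral_exponentialPDF_eq_one h0, mul_one]

/-- Exponential functionals of the additive functional `∑ ζ_k e(w_k)`, when `f` solves the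
corresponding Feynman–Kac equation. -/
lemma lintegral_pathLaw_prod_exp [NeZero d] (e : Site d → ℝ) (he : ∀ x, e x < 1)
    (f : Site d → ℝ≥0∞)
    (hf : ∀ x, ENNReal.ofReal (1 / (1 - e x)) * ∫⁻ y, f (x + y) ∂(stepLaw d) = f x) (n : ℕ)
    (x : Site d) : ∫⁻ w, (∏ k ∈ Finset.range n, ENNReal.ofReal (Real.exp (e (w k).1 * (w k).2)))
      * f (w n).1 ∂(pathLaw x) = f x := by
  have hem : Measurable e := Measurable.of_discrete
  have hfm : Measurable f := Measurable.of_discrete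
  induction n generalizing x with
  | zero =>
    simp only [Finset.range_zero, Finset.prod_empty, one_mul]
    rw [lintegral_congr_ae (g := fun _ => f x)]
    · simp
    · filter_upwards [ae_pathLaw_zero x] with w hw
      rw [hw]
  | succ n ih =>
    rw [lintegral_pathLaw x (by fun_prop)]
    simp only [Finset.prod_range_succ', consSeq_succ, consSeq_zero]
    have h1 : ∀ (y : Site d) (s : ℝ), ∫⁻ w, (∏ k ∈ Finset.range n,
        ENNReal.ofReal (Real.exp (e (w k).1 * (w k).2))) * ENNReal.ofReal (Real.exp (e x * s))
        * f (w n).1 ∂(pathLaw (x + y)) = ENNReal.ofReal (Real.exp (e x * s)) * f (x + y) := by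
      intro y s
      rw [← ih (x + y), ← lintegral_const_mul _ (by fun_prop)]
      exact lintegral_congr fun w => by ring
    simp only [h1]
    have h2 : ∀ y : Site d, ∫⁻ s, ENNReal.ofReal (Real.exp (e x * s)) * f (x + y) ∂(expMeasure 1)
        = ENNReal.ofReal (1 / (1 - e x)) * f (x + y) := fun y => by
      rw [lintegral_mul_const _ (by fun_prop), lintegral_exp_expMeasure (he x)]
    simp only [h2]
    rw [lintegral_const_mul _ (by fun_prop), hf x]

/-- The expectation of `∏_{k<n} exp(-ζ_k)` is `2⁻ⁿ`, so the infimum of these products is almost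
surely zero, whereas a finite total time would keep them bounded away from zero. -/
lemma ae_pathLaw_tsum_eq_top [NeZero d] (x : Site d) :
    ∀ᵐ w ∂(pathLaw x), ∑' n, ENNReal.ofReal (w n).2 = ∞ := by
  have hn : ∀ n, ∫⁻ w, ∏ k ∈ Finset.range n, ENNReal.ofReal (Real.exp (-(w k).2)) ∂(pathLaw x)
      = (2⁻¹ : ℝ≥0∞) ^ n := by
    intro n
    induction n generalizing x with
    | zero => simp
    | succ n ih =>
      rw [lintegral_pathLaw x (by fun_prop)]
      simp only [Finset.prod_range_succ', consSeq_succ, consSeq_zero]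
      have h1 : ∀ (y : Site d) (s : ℝ), ∫⁻ w, (∏ k ∈ Finset.range n,
          ENNReal.ofReal (Real.exp (-(w k).2))) * ENNReal.ofReal (Real.exp (-s))
          ∂(pathLaw (x + y)) = (2⁻¹ : ℝ≥0∞) ^ n * ENNReal.ofReal (Real.exp (-1 * s)) := by
        intro y s
        rw [lintegral_mul_const _ (by fun_prop), ih, neg_one_mul]
      simp only [h1]
      rw [lintegral_const_mul _ (by fun_prop), lintegral_exp_expMeasure (by norm_num)]
      rw [lintegral_const, measure_univ, mul_one, pow_succ]
      congr 1
      rw [show (1 / (1 - -1) : ℝ) = 2⁻¹ by norm_num, ENNReal.ofReal_inv_of_pos two_pos,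
        ENNReal.ofReal_ofNat]
  have hz : ∫⁻ w, ⨅ n, ∏ k ∈ Finset.range n, ENNReal.ofReal (Real.exp (-(w k).2)) ∂(pathLaw x)
      = 0 := by
    refine le_antisymm (ge_of_tendsto' (ENNReal.tendsto_pow_atTop_nhds_zero_of_lt_one
      (r := 2⁻¹) (by simp)) fun n => ?_) zero_le
    rw [← hn n]
    exact lintegral_mono fun w => iInf_le _ n
  rw [lintegral_eq_zero_iff (Measurable.iInf fun n => by fun_prop)] at hz
  filter_upwards [hz, ae_pathLaw_pos x] with w hw hpos
  by_contra hne
  have hle : ∀ n, ENNReal.ofReal (Real.exp (-(∑' n, ENNReal.ofReal (w n).2).toReal))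
      ≤ ∏ k ∈ Finset.range n, ENNReal.ofReal (Real.exp (-(w k).2)) := by
    intro n
    rw [← ENNReal.ofReal_prod_of_nonneg fun k _ => (Real.exp_pos _).le, ← Real.exp_sum,
      Finset.sum_neg_distrib]
    refine ENNReal.ofReal_le_ofReal (Real.exp_le_exp.2 (neg_le_neg ?_))
    rw [← ENNReal.ofReal_le_iff_le_toReal hne, ENNReal.ofReal_sum_of_nonneg fun k _ => (hpos k).le]
    exact ENNReal.sum_le_tsum _
  have := le_iInf hle
  rw [hw] at this
  simp only [Pi.zero_apply, nonpos_iff_eq_zero, ENNReal.ofReal_eq_zero] at this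
  exact absurd this (not_le.2 (Real.exp_pos _))

/-- Transience of the walk in dimension at least three. -/
lemma ae_pathLaw_finite (hd : 3 ≤ d) (x : Site d) :
    ∀ᵐ w ∂(pathLaw x), ∀ y, {n | (w n).1 = y}.Finite := by
  have : NeZero d := ⟨by omega⟩
  have hd0 : (0 : ℝ) < d := by exact_mod_cast (show 0 < d by omega)
  rw [ae_all_iff]
  intro y
  set I : Site d → ℝ≥0∞ := Set.indicator {y} 1 with hI
  have hIm : Measurable I := Measurable.of_discrete
  -- The expected number of visits to `y` is bounded by induction on the number of steps: averaged
  -- over one step, `2d * greenFn (· - y)` loses exactly the indicator of `y`.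
  have hn : ∀ (n : ℕ) (x : Site d), ∫⁻ w, ∑ k ∈ Finset.range n, I (w k).1 ∂(pathLaw x)
      ≤ ENNReal.ofReal (2 * d * greenFn (x - y)) := by
    intro n
    induction n with
    | zero => simp
    | succ n ih =>
      intro x
      rw [lintegral_pathLaw x (by fun_prop)]
      simp only [Finset.sum_range_succ', consSeq_succ, consSeq_zero]
      have h1 : ∀ (e : Site d) (s : ℝ), ∫⁻ w, ∑ k ∈ Finset.range n, I (w k).1 + I x
          ∂(pathLaw (x + e)) ≤ ENNReal.ofReal (2 * d * greenFn (x + e - y)) + I x := by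
        intro e s
        rw [lintegral_add_right _ measurable_const, lintegral_const, measure_univ, mul_one]
        exact add_le_add_left (ih _) _
      refine (lintegral_mono fun e => lintegral_mono fun s => h1 e s).trans ?_
      simp only [lintegral_const, measure_univ, mul_one]
      rw [lintegral_add_right _ measurable_const, lintegral_const, measure_univ, mul_one,
        lintegral_stepLaw_ofReal (fun v => 2 * d * greenFn (v - y))
          (fun v => mul_nonneg (by positivity) (greenFn_nonneg _))]
      have h2 : lap (fun v => 2 * d * greenFn (v - y)) x = 2 * d * (if x = y then -1 else 0) := by
        have h3 := lap_smul (2 * d) (fun v => greenFn (v - y)) x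
        rw [lap_comp_sub_right, lap_greenFn hd] at h3
        simp only [sub_eq_zero] at h3
        exact h3
      rw [h2, mul_div_cancel_left₀ _ (by positivity)]
      by_cases hxy : x = y
      · subst hxy
        simp only [hI, Set.indicator_of_mem (Set.mem_singleton _), Pi.one_apply, if_true]
        have h3 : 1 ≤ 2 * d * greenFn (x - x) := by
          have h4 := lap_greenFn hd (0 : Site d)
          simp only [if_true, lap] at h4
          have h5 : ∑ _i : Fin d, (-(2 * greenFn (0 : Site d))) ≤ -1 := by
            rw [← h4]
            exact Finset.sum_le_sum fun i _ => by
              have := greenFn_nonneg (0 + Pi.single i 1 : Site d)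
              have := greenFn_nonneg (0 - Pi.single i 1 : Site d)
              linarith
          simp only [Finset.sum_const, Finset.card_univ, Fintype.card_fin, nsmul_eq_mul] at h5
          rw [sub_self]
          linarith
        rw [← ENNReal.ofReal_one, ← ENNReal.ofReal_add (by linarith) zero_le_one]
        exact ENNReal.ofReal_le_ofReal (by linarith)
      · simp [hI, hxy]
  have hIk : ∀ k, Measurable fun w : ℕ → Site d × ℝ => I (w k).1 := fun k => by fun_prop
  have hsum : ∫⁻ w, ∑' k, I (w k).1 ∂(pathLaw x) ≠ ∞ := by
    rw [lintegral_tsum fun k => (hIk k).aemeasurable]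
    refine ne_top_of_le_ne_top ENNReal.ofReal_ne_top (ENNReal.tsum_le_of_sum_range_le
      (c := ENNReal.ofReal (2 * d * greenFn (x - y))) fun n => ?_)
    rw [← lintegral_finsetSum _ fun k _ => by fun_prop]
    exact hn n x
  filter_upwards [ae_lt_top (Measurable.tsum fun k => by fun_prop) hsum] with w hw
  refine (ENNReal.finite_const_le_of_tsum_ne_top hw.ne one_ne_zero).subset fun n hn => ?_
  simp only [Set.mem_ofPred_eq] at hn ⊢
  simp [hI, hn]

lemma ae_pathLaw_mem_forwardSet (hd : 3 ≤ d) (x : Site d) :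
    ∀ᵐ w ∂(pathLaw x), w ∈ forwardSet d := by
  have : NeZero d := ⟨by omega⟩
  filter_upwards [ae_pathLaw_isNeighbor x, ae_pathLaw_pos x, ae_pathLaw_finite hd x,
    ae_pathLaw_tsum_eq_top x] with w h1 h2 h3 h4
  exact ⟨h1, h2, h3, h4⟩

/-- Restricting to `forwardSet d` loses no mass, since almost every path is transient with infinite
lifetime. -/
lemma map_walkLaw (hd : 3 ≤ d) (x : Site d) : (walkLaw x).map Subtype.val = pathLaw x := by
  unfold walkLaw
  rw [map_comap_subtype_coe (measurableSet_forwardSet d)]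
  exact Measure.restrict_eq_self_of_ae_mem (ae_pathLaw_mem_forwardSet hd x)

lemma lintegral_walkLaw (hd : 3 ≤ d) (x : Site d) {F : (ℕ → Site d × ℝ) → ℝ≥0∞}
    (hF : Measurable F) : ∫⁻ w, F w.1 ∂(walkLaw x) = ∫⁻ w, F w ∂(pathLaw x) := by
  rw [← map_walkLaw hd x, lintegral_map hF measurable_subtype_coe]

lemma walkLaw_apply (hd : 3 ≤ d) (x : Site d) {S : Set (ℕ → Site d × ℝ)} (hS : MeasurableSet S) :
    walkLaw x {w | w.1 ∈ S} = pathLaw x S := by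
  rw [← map_walkLaw hd x, Measure.map_apply measurable_subtype_coe hS]
  rfl

lemma isProbabilityMeasure_walkLaw (hd : 3 ≤ d) (x : Site d) :
    IsProbabilityMeasure (walkLaw x) := by
  have : NeZero d := ⟨by omega⟩
  have := walkLaw_apply hd x MeasurableSet.univ
  exact ⟨by simpa using this⟩

end walk

section position
variable {d : ℕ}

/-! ### Continuous time -/

/-- The time of the `k`-th jump. -/
def jumpTime (w : ForwardPath d) (k : ℕ) : ℝ := ∑ i ∈ Finset.range k, (w.1 i).2

lemma jumpTime_strictMono (w : ForwardPath d) : StrictMono (jumpTime w) :=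
  strictMono_nat_of_lt_succ fun k => by
    simp only [jumpTime, Finset.sum_range_succ]
    linarith [w.2.2.1 k]

lemma exists_lt_jumpTime (w : ForwardPath d) (t : ℝ) : ∃ k, t < jumpTime w k := by
  by_contra! h
  refine absurd w.2.2.2.2 (ne_top_of_le_ne_top (ENNReal.ofReal_ne_top (r := t))
    (ENNReal.tsum_le_of_sum_range_le fun n => ?_))
  rw [← ENNReal.ofReal_sum_of_nonneg fun k _ => (w.2.2.1 k).le]
  exact ENNReal.ofReal_le_ofReal (h n)

lemma position_eq (w : ForwardPath d) {t : ℝ} {k : ℕ} (h1 : jumpTime w k ≤ t)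
    (h2 : t < jumpTime w (k + 1)) : position w t = (w.1 k).1 := by
  unfold position
  have : IsLeast {k : ℕ | t < ∑ i ∈ Finset.range (k + 1), (w.1 i).2} k := by
    refine ⟨h2, fun j hj => ?_⟩
    have : jumpTime w k < jumpTime w (j + 1) := h1.trans_lt hj
    have := (jumpTime_strictMono w).lt_iff_lt.1 this
    omega
  rw [this.csInf_eq]

lemma exists_jumpTime_le (w : ForwardPath d) {t : ℝ} (ht : 0 ≤ t) :
    ∃ k, jumpTime w k ≤ t ∧ t < jumpTime w (k + 1) := by
  classical
  obtain ⟨n, hn, hmin⟩ : ∃ n, t < jumpTime w n ∧ ∀ m < n, ¬ t < jumpTime w m :=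
    ⟨_, Nat.find_spec (exists_lt_jumpTime w t), fun m hm => Nat.find_min _ hm⟩
  rcases n with _ | n
  · simp only [jumpTime, Finset.range_zero, Finset.sum_empty] at hn
    exact absurd ht (not_le.2 hn)
  · exact ⟨n, not_lt.1 (hmin n (by omega)), hn⟩

/-- Times from the first jump on correspond to the indices at least `1` of the sequence of
positions; this removes continuous time from the equilibrium measure. -/
lemma returnTime_eq_top_iff (K : Finset (Site d)) (w : ForwardPath d) :
    returnTime K w = ∞ ↔ ∀ n, (w.1 (n + 1)).1 ∉ K := by
  have h1 : jumpTime w 1 = (w.1 0).2 := by simp [jumpTime]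
  simp only [returnTime, iInf_eq_top, ENNReal.ofReal_ne_top, imp_false, not_and]
  constructor
  · intro h n hn
    refine h (jumpTime w (n + 1)) ?_ ?_
    · rw [← h1]
      exact (jumpTime_strictMono w).monotone (by omega)
    · rwa [position_eq w le_rfl (jumpTime_strictMono w (Nat.lt_succ_self _))]
  · intro h t ht
    have h0 := w.2.2.1 0
    obtain ⟨k, hk1, hk2⟩ := exists_jumpTime_le w (t := t) (by linarith)
    rw [position_eq w hk1 hk2]
    have : 1 < k + 1 := (jumpTime_strictMono w).lt_iff_lt.1 (by rw [h1]; linarith)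
    obtain ⟨m, rfl⟩ : ∃ m, k = m + 1 := ⟨k - 1, by omega⟩
    exact h m

/-- The occupation-time functional of a trajectory as a series. -/
lemma lintegral_position (w : ForwardPath d) (V : Site d → ℝ) :
    ∫⁻ s in Set.Ici (0 : ℝ), ENNReal.ofReal (V (position w s))
      = ∑' k, ENNReal.ofReal ((w.1 k).2 * V (w.1 k).1) := by
  have hU : Set.Ici (0 : ℝ) = ⋃ k, Set.Ico (jumpTime w k) (jumpTime w (k + 1)) := by
    ext t
    simp only [Set.mem_Ici, Set.mem_iUnion, Set.mem_Ico]
    refine ⟨fun ht => exists_jumpTime_le w ht, fun ⟨k, hk, _⟩ => le_trans ?_ hk⟩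
    simpa [jumpTime] using (jumpTime_strictMono w).monotone (Nat.zero_le k)
  have hdisj : Pairwise (Function.onFun Disjoint
      fun k => Set.Ico (jumpTime w k) (jumpTime w (k + 1))) :=
    (jumpTime_strictMono w).monotone.pairwise_disjoint_on_Ico_succ
  rw [hU, lintegral_iUnion (fun k => measurableSet_Ico) hdisj]
  refine tsum_congr fun k => ?_
  rw [setLIntegral_congr_fun (g := fun _ => ENNReal.ofReal (V (w.1 k).1)) measurableSet_Ico
    fun t ht => by simp only [position_eq w ht.1 ht.2]]
  rw [setLIntegral_const, Real.volume_Ico, mul_comm, ENNReal.ofReal_mul (w.2.2.1 k).le]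
  congr 2
  simp [jumpTime, Finset.sum_range_succ]

end position

/-! ### Escape probabilities and the equilibrium measure -/

section escape
variable {d : ℕ}

lemma measurableSet_forall_notMem (K : Finset (Site d)) (φ : ℕ → ℕ) :
    MeasurableSet {w : ℕ → Site d × ℝ | ∀ n, (w (φ n)).1 ∉ K} := by
  simp only [Set.ofPred_forall]
  refine MeasurableSet.iInter fun n => ?_
  have hm : Measurable fun w : ℕ → Site d × ℝ => (w (φ n)).1 := by fun_prop
  exact hm (MeasurableSet.of_discrete (s := {y | y ∉ K}))

/-- The probability never to visit `K`. -/
def escapeProb (K : Finset (Site d)) (x : Site d) : ℝ :=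
  (pathLaw x).real {w | ∀ n, (w n).1 ∉ K}

lemma escapeProb_nonneg (K : Finset (Site d)) (x : Site d) : 0 ≤ escapeProb K x :=
  measureReal_nonneg

lemma equilibrium_eq (hd : 3 ≤ d) {K : Finset (Site d)} {x : Site d} (hx : x ∈ K) :
    equilibrium K x = (pathLaw x).real {w | ∀ n, (w (n + 1)).1 ∉ K} := by
  rw [equilibrium, if_pos hx, measureReal_def, measureReal_def]
  simp only [returnTime_eq_top_iff]
  congr 1
  exact walkLaw_apply hd x (measurableSet_forall_notMem K Nat.succ)

lemma equilibrium_nonneg (K : Finset (Site d)) (x : Site d) : 0 ≤ equilibrium K x := by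
  unfold equilibrium
  split_ifs
  exacts [measureReal_nonneg, le_rfl]

variable [NeZero d]

lemma escapeProb_le_one (K : Finset (Site d)) (x : Site d) : escapeProb K x ≤ 1 :=
  measureReal_le_one

lemma ofReal_escapeProb (K : Finset (Site d)) (x : Site d) :
    ENNReal.ofReal (escapeProb K x) = pathLaw x {w | ∀ n, (w n).1 ∉ K} :=
  ofReal_measureReal

lemma escapeProb_of_mem {K : Finset (Site d)} {x : Site d} (hx : x ∈ K) : escapeProb K x = 0 := by
  rw [escapeProb, measureReal_eq_zero_iff, measure_eq_zero_iff_ae_notMem]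
  filter_upwards [ae_pathLaw_zero x] with w hw hcon
  exact hcon 0 (hw ▸ hx)

lemma pathLaw_forall_succ (K : Finset (Site d)) (x : Site d) :
    (pathLaw x).real {w | ∀ n, (w (n + 1)).1 ∉ K}
      = escapeProb K x + lap (escapeProb K) x / (2 * d) := by
  have h := pathLaw_shift x (measurableSet_forall_notMem K id)
  simp only [id] at h
  simp only [← ofReal_escapeProb] at h
  rw [lintegral_stepLaw_ofReal _ (escapeProb_nonneg K)] at h
  have h2 : 0 ≤ escapeProb K x + lap (escapeProb K) x / (2 * d) := by
    have hd : (0 : ℝ) < d := by exact_mod_cast Nat.pos_of_ne_zero (NeZero.ne d)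
    have h3 : -(2 * d * escapeProb K x) ≤ lap (escapeProb K) x := by
      have : ∑ _i : Fin d, (-(2 * escapeProb K x)) ≤ lap (escapeProb K) x :=
        Finset.sum_le_sum fun i _ => by
          have := escapeProb_nonneg K (x + Pi.single i 1)
          have := escapeProb_nonneg K (x - Pi.single i 1)
          linarith
      simp only [Finset.sum_const, Finset.card_univ, Fintype.card_fin, nsmul_eq_mul] at this
      linarith
    have : -escapeProb K x ≤ lap (escapeProb K) x / (2 * d) := by
      rw [le_div_iff₀ (by positivity)]; linarith
    linarith
  rw [measureReal_def]
  exact (congrArg ENNReal.toReal h).trans (ENNReal.toReal_ofReal h2)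

lemma lap_escapeProb_of_notMem {K : Finset (Site d)} {x : Site d} (hx : x ∉ K) :
    lap (escapeProb K) x = 0 := by
  have hd : (0 : ℝ) < d := by exact_mod_cast Nat.pos_of_ne_zero (NeZero.ne d)
  have h1 : escapeProb K x = (pathLaw x).real {w | ∀ n, (w (n + 1)).1 ∉ K} := by
    refine measureReal_congr ?_
    filter_upwards [ae_pathLaw_zero x] with w hw
    refine propext ⟨fun h n => h (n + 1), fun h n => ?_⟩
    rcases n with _ | n
    exacts [hw ▸ hx, h n]
  have h2 := pathLaw_forall_succ K x
  rw [← h1] at h2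
  have h3 : lap (escapeProb K) x / (2 * d) = 0 := by linarith
  rcases div_eq_zero_iff.1 h3 with h | h
  · exact h
  · linarith

/-- The escape probability vanishes on `K`, so averaging it over the first jump leaves only the
Laplacian. This links the equilibrium measure to the Harnack comparison and to the Feynman–Kac
equation. -/
lemma lap_escapeProb_of_mem (hd : 3 ≤ d) {K : Finset (Site d)} {x : Site d} (hx : x ∈ K) :
    lap (escapeProb K) x = 2 * d * equilibrium K x := by
  have hd0 : (0 : ℝ) < d := by exact_mod_cast Nat.pos_of_ne_zero (NeZero.ne d)
  rw [equilibrium_eq hd hx, pathLaw_forall_succ, escapeProb_of_mem hx]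
  field_simp
  ring

lemma equilibrium_le_one (hd : 3 ≤ d) (K : Finset (Site d)) (x : Site d) :
    equilibrium K x ≤ 1 := by
  by_cases hx : x ∈ K
  · rw [equilibrium_eq hd hx]
    exact measureReal_le_one
  · simp [equilibrium, hx]

/-- A superharmonic majorant of the indicator function of `K` bounds the hitting probability. -/
lemma one_sub_le_escapeProb (K : Finset (Site d)) (φ : Site d → ℝ) (h0 : ∀ x, 0 ≤ φ x)
    (h1 : ∀ x ∈ K, 1 ≤ φ x) (h2 : ∀ x, lap φ x ≤ 0) (x : Site d) :
    1 - φ x ≤ escapeProb K x := by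
  have hm : ∀ n, MeasurableSet {w : ℕ → Site d × ℝ | ∃ k < n, (w k).1 ∈ K} := fun n => by
    have : {w : ℕ → Site d × ℝ | ∃ k < n, (w k).1 ∈ K} = ⋃ k, ⋃ (_ : k < n), {w | (w k).1 ∈ K} := by
      ext; simp
    rw [this]
    refine MeasurableSet.iUnion fun k => MeasurableSet.iUnion fun _ => ?_
    have hm : Measurable fun w : ℕ → Site d × ℝ => (w k).1 := by fun_prop
    exact hm (MeasurableSet.of_discrete (s := {y | y ∈ K}))
  -- The probability to hit before step `n` is bounded by induction on `n`, with the Markov property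
  -- at the first jump and superharmonicity.
  have hn : ∀ (n : ℕ) (x : Site d),
      pathLaw x {w | ∃ k < n, (w k).1 ∈ K} ≤ ENNReal.ofReal (φ x) := by
    intro n
    induction n with
    | zero => simp
    | succ n ih =>
      intro x
      by_cases hx : x ∈ K
      · refine prob_le_one.trans ?_
        rw [← ENNReal.ofReal_one]
        exact ENNReal.ofReal_le_ofReal (h1 x hx)
      · have hle : pathLaw x {w | ∃ k < n + 1, (w k).1 ∈ K}
            ≤ pathLaw x {w | (fun n => w (n + 1)) ∈ {w : ℕ → Site d × ℝ | ∃ k < n, (w k).1 ∈ K}} := by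
          refine measure_mono_ae ?_
          filter_upwards [ae_pathLaw_zero x] with w hw
          rintro ⟨k, hk, hkK⟩
          rcases k with _ | k
          · exact absurd (hw ▸ hkK) hx
          · exact ⟨k, by omega, hkK⟩
        refine hle.trans ?_
        rw [pathLaw_shift x (hm n)]
        refine (lintegral_mono fun e => ih (x + e)).trans ?_
        rw [lintegral_stepLaw_ofReal φ h0]
        refine ENNReal.ofReal_le_ofReal ?_
        have : lap φ x / (2 * d) ≤ 0 := div_nonpos_of_nonpos_of_nonneg (h2 x) (by positivity)
        linarith
  have hU : pathLaw x (⋃ n, {w | ∃ k < n, (w k).1 ∈ K}) ≤ ENNReal.ofReal (φ x) := by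
    rw [Monotone.measure_iUnion]
    · exact iSup_le fun n => hn n x
    · exact fun m n hmn w ⟨k, hk, h⟩ => ⟨k, hk.trans_le hmn, h⟩
  have hc : {w : ℕ → Site d × ℝ | ∀ n, (w n).1 ∉ K}ᶜ = ⋃ n, {w | ∃ k < n, (w k).1 ∈ K} := by
    ext w
    simp only [Set.mem_compl_iff, Set.mem_ofPred_eq, not_forall, not_not, Set.mem_iUnion]
    exact ⟨fun ⟨n, hn⟩ => ⟨n + 1, n, by omega, hn⟩, fun ⟨_, k, _, h⟩ => ⟨k, h⟩⟩
  rw [← hc] at hU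
  have h3 := probReal_compl_eq_one_sub (μ := pathLaw x) (measurableSet_forall_notMem K id)
  simp only [id] at h3
  have h4 : (pathLaw x).real {w | ∀ n, (w n).1 ∉ K}ᶜ ≤ φ x :=
    ENNReal.toReal_le_of_le_ofReal (h0 x) hU
  unfold escapeProb
  linarith

end escape

/-! ### Comparison of the potential with the equilibrium measure -/

section comparison
variable {d : ℕ}

lemma supNorm_sub_le_of_mem_box {L : ℕ} {x z : Site d} (hx : x ∈ box L z) :
    supNorm (x - z) ≤ 4 * L := by
  rw [supNorm_le_iff]
  intro i
  have h := Finset.mem_Ico.1 (Fintype.mem_piFinset.1 hx i)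
  simp only [Pi.sub_apply]
  omega

lemma norm_le_supNorm (x : Site d) : ‖x‖ ≤ supNorm x := by
  refine (pi_norm_le_iff_of_nonneg (by positivity)).2 fun i => ?_
  rw [Int.norm_eq_abs, ← Int.cast_abs, Int.abs_eq_natAbs, Int.cast_natCast]
  exact_mod_cast natAbs_le_supNorm x i

lemma lt_supNorm_of_mem_box {K L : ℕ} (hK : 100 ≤ K) (hL : 1 ≤ L) {C : Finset (Site d)}
    (hC : IsSeparated K L C) {x z z' : Site d} (hz : z ∈ C) (hz' : z' ∈ C) (hne : z ≠ z')
    (hx : x ∈ box L z') : 5 * K * L < supNorm (x - z) := by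
  have h1 := (hC.2.2 z hz z' hz' hne).trans (norm_le_supNorm _)
  have h2 : 10 * K * L ≤ supNorm (z - z') := by exact_mod_cast h1
  have h3 : supNorm (z - z') ≤ supNorm (x - z') + supNorm (x - z) := by
    have := supNorm_add_le (x - z') (-(x - z))
    rwa [supNorm_neg, show x - z' + -(x - z) = z - z' by abel] at this
  have h4 := supNorm_sub_le_of_mem_box hx
  nlinarith

lemma mem_boxUnion {L : ℕ} {C : Finset (Site d)} {x : Site d} :
    x ∈ boxUnion L C ↔ ∃ z ∈ C, x ∈ box L z := by
  simp [boxUnion]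

lemma equilibrium_of_notMem {K : Finset (Site d)} {x : Site d} (hx : x ∉ K) :
    equilibrium K x = 0 := if_neg hx

lemma capacity_nonneg (K : Finset (Site d)) : 0 ≤ capacity K :=
  Finset.sum_nonneg fun x _ => equilibrium_nonneg K x

/-- Far from a box, the probability never to visit it is at least `1 / 2`. -/
lemma half_le_escapeProb_box (hd : 3 ≤ d) {L : ℕ} (hL : 1 ≤ L) (x z : Site d)
    (hx : 48 * d * 104 ^ d * (5 * L) ≤ supNorm (x - z)) : 1 / 2 ≤ escapeProb (box L z) x := by
  have : NeZero d := ⟨by omega⟩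
  have hne : (box L z).Nonempty := ⟨z, by
    simp only [box, Fintype.mem_piFinset, Finset.mem_Ico]
    intro i
    omega⟩
  obtain ⟨y, hy, hmin⟩ := (box L z).exists_min_image (fun y => greenFn (y - z)) hne
  have hpos := greenFn_pos hd (y - z)
  -- Dividing the Green function by its minimum over the box gives a superharmonic majorant of the
  -- indicator. The minimum is attained within distance `4L`, where `4L + 1 ≤ 5L` meets the
  -- condition of `greenFn_le_half`.
  set φ : Site d → ℝ := fun x => (greenFn (y - z))⁻¹ * greenFn (x - z) with hφ
  have h1 := one_sub_le_escapeProb (box L z) φ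
    (fun x => mul_nonneg (inv_nonneg.2 hpos.le) (greenFn_nonneg _))
    (fun x hx => by
      rw [hφ]
      simp only
      rw [inv_mul_eq_div, one_le_div hpos]
      exact hmin x hx)
    (fun x => by
      have h2 := lap_smul (greenFn (y - z))⁻¹ (fun x => greenFn (x - z)) x
      rw [lap_comp_sub_right, lap_greenFn hd] at h2
      rw [show φ = (greenFn (y - z))⁻¹ • (fun x => greenFn (x - z)) from rfl, h2]
      refine mul_nonpos_of_nonneg_of_nonpos (inv_nonneg.2 hpos.le) ?_
      split_ifs <;> norm_num) x
  have h3 : greenFn (x - z) ≤ greenFn (y - z) / 2 := by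
    refine greenFn_le_half hd _ _ (le_trans (Nat.mul_le_mul_left _ ?_) hx)
    have := supNorm_sub_le_of_mem_box hy
    omega
  have h4 : φ x ≤ 1 / 2 := by
    rw [hφ]
    simp only
    rw [inv_mul_eq_div, div_le_iff₀ hpos]
    linarith
  linarith

/-- The equilibrium measure of a union of distant boxes is, on each of them, almost proportional
to the equilibrium measure of the box. -/
lemma exists_equilibrium_comparison (hd : 3 ≤ d) {ε : ℝ} (hε : 0 < ε) (hε1 : ε < 1) {K L : ℕ}
    (hK : 100 ≤ K) (hcK : 25920 * d ^ 2 * (48 * d * 104 ^ d) ^ 2 / ε ≤ K) (hL : 1 ≤ L)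
    {C : Finset (Site d)} (hC : IsSeparated K L C) {z : Site d} (hz : z ∈ C) :
    ∃ lam : ℝ, 0 ≤ lam ∧ ∀ x ∈ box L z,
      (1 - ε / 3) * lam * equilibrium (box L z) x ≤ equilibrium (boxUnion L C) x ∧
      equilibrium (boxUnion L C) x ≤ (1 + ε / 3) * lam * equilibrium (box L z) x := by
  have : NeZero d := ⟨by omega⟩
  have hd0 : (0 : ℝ) < d := by exact_mod_cast (by omega : 0 < d)
  -- `A` is the ratio of distances at which the Green function is halved. The scales are `r = 5AL`,
  -- where escaping the box has probability at least `1/2`; `N = 5KL`, within which there is no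
  -- other box; and `M = mL` with `m = ⌊K/A⌋`.
  obtain ⟨A, hA⟩ : ∃ A : ℕ, A = 48 * d * 104 ^ d := ⟨_, rfl⟩
  have hA1 : 1 ≤ A := by rw [hA]; exact Nat.succ_le_of_lt (by positivity)
  have hA' : (48 * d * 104 ^ d : ℝ) = A := by rw [hA]; push_cast; ring
  rw [hA', div_le_iff₀ hε] at hcK
  have hA1' : (1 : ℝ) ≤ A := by exact_mod_cast hA1
  obtain ⟨m, hm⟩ : ∃ m : ℕ, m = K / A := ⟨_, rfl⟩
  have hmA : m * A ≤ K := hm ▸ Nat.div_mul_le_self K A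
  have hKm : K < (m + 1) * A := by
    have := Nat.lt_mul_div_succ K (show 0 < A by omega)
    rw [← hm] at this
    linarith [mul_comm A (m + 1)]
  have hKm' : (K : ℝ) < (m + 1) * A := by exact_mod_cast hKm
  have hd1 : (1 : ℝ) ≤ d := by exact_mod_cast (by omega : 1 ≤ d)
  have hd2 : (1 : ℝ) ≤ (d : ℝ) ^ 2 := one_le_pow₀ hd1
  -- lower bounds for `m`
  have hm1 : 25920 * (d : ℝ) ^ 2 * A ≤ (m + 1) * ε := by
    by_contra! h
    nlinarith
  have hm0 : (1 : ℝ) ≤ m := by nlinarith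
  have hm2 : 12960 * (d : ℝ) ^ 2 * A ≤ m * ε := by nlinarith
  have hm3 : 12960 * d ^ 2 * A ≤ m := by
    have : 12960 * (d : ℝ) ^ 2 * A ≤ m := by nlinarith
    exact_mod_cast this
  have hKA : 12960 * d ^ 2 * A * A ≤ K := (Nat.mul_le_mul_right A hm3).trans hmA
  obtain ⟨lam, hlam, hcomp⟩ := exists_lap_comparison hd (N := 5 * K * L) (M := m * L)
    (r := 5 * A * L) (by nlinarith) (by nlinarith) (by
      rw [← hA]
      have e1 : A * (m * L) ≤ K * L := by nlinarith
      have e2 : A * (d * (5 * A * L)) ≤ K * L := by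
        have : A * (d * (5 * A * L)) = (5 * (d * A * A)) * L := by ring
        rw [this]
        refine Nat.mul_le_mul_right L (le_trans ?_ hKA)
        have : d ≤ d ^ 2 := by nlinarith
        have := Nat.mul_le_mul_right (A * A) this
        nlinarith
      have e3 : A ≤ K * L := by
        have : 1 ≤ d ^ 2 := Nat.one_le_pow _ _ (by omega)
        have : A ≤ K := by nlinarith [Nat.mul_le_mul this hA1]
        nlinarith
      calc A * (m * L + d * (5 * A * L) + 1) = A * (m * L) + A * (d * (5 * A * L)) + A := by ring
        _ ≤ 5 * K * L := by nlinarith)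
    -- The final error is `12η = ε/3`. The requirement `72 d² (5AL)/(mL) ≤ ε/36` is `12960 d² A ≤ m
    -- ε`; twice that constant in the bound on `K` absorbs the rounding in `m`.
    (η := ε / 36) (by
      have hL' : (0 : ℝ) < L := by exact_mod_cast hL
      push_cast
      rw [div_le_iff₀ (by positivity)]
      nlinarith) (by linarith) z (box L z)
    (fun x hx => by
      have := supNorm_sub_le_of_mem_box hx
      nlinarith)
    (escapeProb (boxUnion L C)) (escapeProb (box L z))
    (escapeProb_nonneg _) (escapeProb_nonneg _)
    (fun x hx => escapeProb_of_mem (mem_boxUnion.2 ⟨z, hz, hx⟩))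
    (fun x hx => escapeProb_of_mem hx)
    (fun x hx hxN => lap_escapeProb_of_notMem fun hmem => by
      obtain ⟨z', hz', hx'⟩ := mem_boxUnion.1 hmem
      by_cases hzz : z = z'
      · exact hx (hzz ▸ hx')
      · exact absurd (lt_supNorm_of_mem_box hK hL hC hz hz' hzz hx') (not_lt.2 hxN))
    (fun x hx _ => lap_escapeProb_of_notMem hx)
    (escapeProb_le_one _)
    (fun x hx => half_le_escapeProb_box hd hL x z (by rw [← hA, hx]; nlinarith))
  refine ⟨lam, hlam, fun x hx => ?_⟩
  have h := hcomp x hx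
  rw [lap_escapeProb_of_mem hd hx, lap_escapeProb_of_mem hd (mem_boxUnion.2 ⟨z, hz, hx⟩)] at h
  refine ⟨le_of_mul_le_mul_left ?_ (by positivity : (0 : ℝ) < 2 * d),
    le_of_mul_le_mul_left ?_ (by positivity : (0 : ℝ) < 2 * d)⟩ <;> linarith [h.1, h.2]

/-- The potential is close to the equilibrium measure of the union of the boxes. -/
theorem potential_comparison (hd : 3 ≤ d) {ε : ℝ} (hε : 0 < ε) (hε1 : ε < 1) {K L : ℕ}
    (hK : 100 ≤ K) (hcK : 25920 * d ^ 2 * (48 * d * 104 ^ d) ^ 2 / ε ≤ K) (hL : 1 ≤ L)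
    {C : Finset (Site d)} (hC : IsSeparated K L C) (x : Site d) :
    (1 - ε) * equilibrium (boxUnion L C) x ≤ potential L C x ∧
      potential L C x ≤ (1 + ε) * equilibrium (boxUnion L C) x := by
  by_cases hx : x ∈ boxUnion L C
  · obtain ⟨z, hz, hxz⟩ := mem_boxUnion.1 hx
    have hV : potential L C x = (∑ y ∈ box L z, equilibrium (boxUnion L C) y)
        * (equilibrium (box L z) x / capacity (box L z)) := by
      refine Finset.sum_eq_single_of_mem z hz fun z' hz' hne => ?_
      have : x ∉ box L z' := fun hx' => by
        have h1 := lt_supNorm_of_mem_box hK hL hC hz hz' hne.symm hx'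
        have h2 := supNorm_sub_le_of_mem_box hxz
        nlinarith
      rw [normalizedEquilibrium, equilibrium_of_notMem this]
      simp
    obtain ⟨lam, hlam, hcomp⟩ := exists_equilibrium_comparison hd hε hε1 hK hcK hL hC hz
    -- If the capacity were zero, the quotient would be zero by convention and both equilibrium
    -- measures would vanish at `x`, so positivity of the capacity need not be proved.
    rcases (capacity_nonneg (box L z)).eq_or_lt with hcap | hcap
    · have h0 : equilibrium (box L z) x = 0 :=
        (Finset.sum_eq_zero_iff_of_nonneg fun x _ => equilibrium_nonneg _ x).1 hcap.symm x hxz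
      have h1 := hcomp x hxz
      rw [h0, mul_zero, mul_zero] at h1
      have h2 : equilibrium (boxUnion L C) x = 0 := le_antisymm h1.2 h1.1
      rw [hV, h0, h2]
      simp
    -- The factor `lam` enters both `e_Σ(D_z)` and `e_Σ(x)` and cancels. Two errors `ε/3` combine to
    -- at most `ε`, since `1 + ε/3 ≤ (1+ε)(1-ε/3)` and `(1-ε)(1+ε/3) ≤ 1-ε/3`.
    · set e := equilibrium (box L z) x with he
      have he0 : 0 ≤ e := equilibrium_nonneg _ x
      have hE1 : (1 - ε / 3) * lam * capacity (box L z)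
          ≤ ∑ y ∈ box L z, equilibrium (boxUnion L C) y := by
        rw [capacity, Finset.mul_sum]
        exact Finset.sum_le_sum fun y hy => (hcomp y hy).1
      have hE2 : ∑ y ∈ box L z, equilibrium (boxUnion L C) y
          ≤ (1 + ε / 3) * lam * capacity (box L z) := by
        rw [capacity, Finset.mul_sum]
        exact Finset.sum_le_sum fun y hy => (hcomp y hy).2
      have h1 := hcomp x hxz
      rw [hV]
      have hle : 0 ≤ lam * e := mul_nonneg hlam he0
      constructor
      · rw [mul_div_assoc', le_div_iff₀ hcap]
        have h3 := mul_le_mul_of_nonneg_right hE1 he0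
        have h4 : (1 - ε) * equilibrium (boxUnion L C) x ≤ (1 - ε / 3) * lam * e := by
          nlinarith [mul_nonneg hle hε.le, mul_nonneg (mul_nonneg hle hε.le) hε.le]
        nlinarith
      · rw [mul_div_assoc', div_le_iff₀ hcap]
        have h3 := mul_le_mul_of_nonneg_right hE2 he0
        have h4 : (1 + ε / 3) * lam * e ≤ (1 + ε) * equilibrium (boxUnion L C) x := by
          nlinarith [mul_nonneg hle hε.le, mul_nonneg (mul_nonneg hle hε.le) (sub_nonneg.2 hε1.le)]
        nlinarith
  · have : potential L C x = 0 := Finset.sum_eq_zero fun z hz => by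
      have : x ∉ box L z := fun h => hx (mem_boxUnion.2 ⟨z, hz, h⟩)
      rw [normalizedEquilibrium, equilibrium_of_notMem this]
      simp
    rw [this, equilibrium_of_notMem hx]
    simp

end comparison

/-! ### The exponential on `[0, ∞]` -/

/-- The exponential function on `[0, ∞]`. -/
def ennExp (t : ℝ≥0∞) : ℝ≥0∞ := EReal.exp t

lemma ennExp_ofReal {t : ℝ} (ht : 0 ≤ t) :
    ennExp (ENNReal.ofReal t) = ENNReal.ofReal (Real.exp t) := by
  rw [ennExp, EReal.coe_ennreal_ofReal, max_eq_left ht, EReal.exp_coe]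

@[simp] lemma ennExp_zero : ennExp 0 = 1 := by simp [ennExp]

lemma ennExp_add (s t : ℝ≥0∞) : ennExp (s + t) = ennExp s * ennExp t := by
  rw [ennExp, EReal.coe_ennreal_add, EReal.exp_add, ennExp, ennExp]

lemma ennExp_sum {ι : Type*} (s : Finset ι) (f : ι → ℝ≥0∞) :
    ennExp (∑ i ∈ s, f i) = ∏ i ∈ s, ennExp (f i) := by
  classical
  induction s using Finset.induction_on with
  | empty => simp
  | insert i s hi ih => rw [Finset.sum_insert hi, Finset.prod_insert hi, ennExp_add, ih]

lemma ennExp_mono : Monotone ennExp := fun _ _ h =>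
  EReal.exp_monotone (EReal.coe_ennreal_le_coe_ennreal_iff.2 h)

lemma one_le_ennExp (t : ℝ≥0∞) : 1 ≤ ennExp t := by
  rw [← ennExp_zero]
  exact ennExp_mono zero_le

lemma continuous_ennExp : Continuous ennExp :=
  ENNReal.continuous_exp.comp continuous_coe_ennreal_ereal

@[fun_prop]
lemma measurable_ennExp : Measurable ennExp := continuous_ennExp.measurable

/-! ### Exponential moments of the occupation functional -/

section moments
variable {d : ℕ}

/-- The integral over time of the equilibrium measure of `K` along a path. -/
def occupation (K : Finset (Site d)) (w : ℕ → Site d × ℝ) : ℝ≥0∞ :=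
  ∑' k, ENNReal.ofReal ((w k).2 * equilibrium K (w k).1)

@[fun_prop]
lemma measurable_occupation (K : Finset (Site d)) : Measurable (occupation K) := by
  have he : Measurable (equilibrium K) := Measurable.of_discrete
  unfold occupation
  fun_prop

lemma lintegral_one_sub_escapeProb [NeZero d] (K : Finset (Site d)) (n : ℕ) (x : Site d) :
    ∫⁻ w, ENNReal.ofReal (1 - escapeProb K (w n).1) ∂(pathLaw x)
      = pathLaw x {w | ∃ k, (w (n + k)).1 ∈ K} := by
  have hG : Measurable fun y => ENNReal.ofReal (1 - escapeProb K y) := Measurable.of_discrete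
  induction n generalizing x with
  | zero =>
    rw [lintegral_congr_ae (g := fun _ => ENNReal.ofReal (1 - escapeProb K x))]
    · have h3 := probReal_compl_eq_one_sub (μ := pathLaw x) (measurableSet_forall_notMem K id)
      simp only [id] at h3
      have h4 : {w : ℕ → Site d × ℝ | ∃ k, (w (0 + k)).1 ∈ K}
          = {w : ℕ → Site d × ℝ | ∀ n, (w n).1 ∉ K}ᶜ := by
        ext w
        simp
      rw [lintegral_const, measure_univ, mul_one, h4, escapeProb, ← h3, ofReal_measureReal]
    · filter_upwards [ae_pathLaw_zero x] with w hw
      rw [hw]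
  | succ n ih =>
    have hF : Measurable fun w : ℕ → Site d × ℝ =>
        ENNReal.ofReal (1 - escapeProb K (w (n + 1)).1) := by
      have : Measurable fun w : ℕ → Site d × ℝ => (w (n + 1)).1 := by fun_prop
      exact hG.comp this
    have hS : MeasurableSet {w : ℕ → Site d × ℝ | ∃ k, (w (n + k)).1 ∈ K} := by
      have := (measurableSet_forall_notMem K fun k => n + k).compl
      convert! this using 1
      ext w
      simp
    have h2 := pathLaw_shift x hS
    rw [lintegral_pathLaw x hF]
    simp only [consSeq_succ, lintegral_const, measure_univ, mul_one, ih]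
    rw [← h2]
    congr 1
    ext w
    simp only [Set.mem_ofPred_eq, show ∀ k, n + 1 + k = n + k + 1 by intro k; omega]

/-- By the Markov property the integral is the probability of a visit to `K` from step `n` on, which
tends to zero by transience. -/
lemma tendsto_lintegral_one_sub_escapeProb (hd : 3 ≤ d) (K : Finset (Site d)) (x : Site d) :
    Filter.Tendsto (fun n => ∫⁻ w, ENNReal.ofReal (1 - escapeProb K (w n).1) ∂(pathLaw x))
      Filter.atTop (nhds 0) := by
  have : NeZero d := ⟨by omega⟩
  simp only [lintegral_one_sub_escapeProb]
  have h0 : pathLaw x (⋂ n, {w | ∃ k, (w (n + k)).1 ∈ K}) = 0 := by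
    rw [measure_eq_zero_iff_ae_notMem]
    filter_upwards [ae_pathLaw_finite hd x] with w hw hcon
    have hfin : {n | (w n).1 ∈ K}.Finite := by
      have : {n | (w n).1 ∈ K} = ⋃ y ∈ K, {n | (w n).1 = y} := by ext; simp
      rw [this]
      exact K.finite_toSet.biUnion fun y _ => hw y
    obtain ⟨B, hB⟩ := hfin.bddAbove
    obtain ⟨k, hk⟩ := Set.mem_iInter.1 hcon (B + 1)
    have := hB hk
    omega
  rw [← h0]
  refine tendsto_measure_iInter_atTop (fun n => ?_) (fun m n hmn w hw => ?_)
    ⟨0, measure_ne_top _ _⟩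
  · have := (measurableSet_forall_notMem K fun k => n + k).compl
    refine MeasurableSet.nullMeasurableSet ?_
    convert! this using 1
    ext w
    simp
  · obtain ⟨k, hk⟩ := hw
    exact ⟨n - m + k, by rwa [show m + (n - m + k) = n + k by omega]⟩

/-- The function `g = 1 + a/(1-a) · P[hit K]` has neighbour average `(1 - a e_K) g`. Off `K` it is
harmonic and `e_K = 0`; on `K` it equals `1/(1-a)` and its Laplacian is `-(a/(1-a)) · 2d e_K`.
Negative `a` is allowed and serves for the lower deviations. -/
lemma lintegral_prod_exp_equilibrium (hd : 3 ≤ d) (K : Finset (Site d)) {a : ℝ} (ha : a < 1)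
    {x : Site d} (hx : x ∈ K) (n : ℕ) :
    ∫⁻ w, (∏ k ∈ Finset.range n, ENNReal.ofReal (Real.exp (a * equilibrium K (w k).1 * (w k).2)))
      * ENNReal.ofReal (1 + a / (1 - a) * (1 - escapeProb K (w n).1)) ∂(pathLaw x)
      = ENNReal.ofReal (1 / (1 - a)) := by
  have : NeZero d := ⟨by omega⟩
  have hd0 : (0 : ℝ) < d := by exact_mod_cast (by omega : 0 < d)
  have ha' : 0 < 1 - a := by linarith
  have he : ∀ x, a * equilibrium K x < 1 := fun x => by
    rcases le_total a 0 with h | h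
    · exact (mul_nonpos_of_nonpos_of_nonneg h (equilibrium_nonneg K x)).trans_lt one_pos
    · exact (mul_le_of_le_one_right h (equilibrium_le_one hd K x)).trans_lt ha
  set g : Site d → ℝ := fun y => 1 + a / (1 - a) * (1 - escapeProb K y) with hg
  have hg0 : ∀ y, 0 ≤ g y := fun y => by
    have h1 := escapeProb_nonneg K y
    have h2 := escapeProb_le_one K y
    have : g y = (1 - a * escapeProb K y) / (1 - a) := by
      simp only [hg]; field_simp; ring
    rw [this]
    exact div_nonneg (by nlinarith) ha'.le
  have hlap : ∀ y, lap g y = -(a / (1 - a)) * lap (escapeProb K) y := fun y => by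
    simp only [lap, hg, Finset.mul_sum]
    exact Finset.sum_congr rfl fun i _ => by ring
  have key : ∀ y, ENNReal.ofReal (1 / (1 - a * equilibrium K y))
      * ∫⁻ e, ENNReal.ofReal (g (y + e)) ∂(stepLaw d) = ENNReal.ofReal (g y) := by
    intro y
    have hpos : 0 < 1 - a * equilibrium K y := by linarith [he y]
    rw [lintegral_stepLaw_ofReal g hg0, ← ENNReal.ofReal_mul (by positivity), hlap]
    congr 1
    by_cases hy : y ∈ K
    · rw [lap_escapeProb_of_mem hd hy]
      simp only [hg, escapeProb_of_mem hy]
      field_simp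
      ring
    · rw [lap_escapeProb_of_notMem hy, equilibrium_of_notMem hy]
      simp
  rw [lintegral_pathLaw_prod_exp (fun y => a * equilibrium K y) he (fun y => ENNReal.ofReal (g y))
    key n x]
  simp only [hg, escapeProb_of_mem hx]
  congr 1
  field_simp
  ring

lemma ennExp_mul_sum {a : ℝ} (ha : 0 ≤ a) (K : Finset (Site d)) {w : ℕ → Site d × ℝ}
    (hw : ∀ n, 0 < (w n).2) (n : ℕ) :
    ennExp (ENNReal.ofReal a
        * ∑ k ∈ Finset.range n, ENNReal.ofReal ((w k).2 * equilibrium K (w k).1))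
      = ∏ k ∈ Finset.range n, ENNReal.ofReal (Real.exp (a * equilibrium K (w k).1 * (w k).2)) := by
  rw [Finset.mul_sum, ennExp_sum]
  refine Finset.prod_congr rfl fun k _ => ?_
  have := equilibrium_nonneg K (w k).1
  have := (hw k).le
  rw [← ENNReal.ofReal_mul ha, ennExp_ofReal (by positivity)]
  congr 2
  ring

/-- For `a ≥ 0` the terminal factor `g` is at least one and can be dropped for every `n`; monotone
convergence does the rest. -/
theorem lintegral_ennExp_occupation_le (hd : 3 ≤ d) (K : Finset (Site d)) {a : ℝ} (ha0 : 0 ≤ a)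
    (ha : a < 1) {x : Site d} (hx : x ∈ K) :
    ∫⁻ w, ennExp (ENNReal.ofReal a * occupation K w) ∂(pathLaw x)
      ≤ ENNReal.ofReal (1 / (1 - a)) := by
  have : NeZero d := ⟨by omega⟩
  have he : Measurable (equilibrium K) := Measurable.of_discrete
  have ha' : 0 < 1 - a := by linarith
  set S : ℕ → (ℕ → Site d × ℝ) → ℝ≥0∞ := fun n w => ennExp (ENNReal.ofReal a
        * ∑ k ∈ Finset.range n, ENNReal.ofReal ((w k).2 * equilibrium K (w k).1)) with hS
  have hSm : ∀ n, Measurable (S n) := fun n => by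
    simp only [hS]
    fun_prop
  have hlim : ∀ w, Filter.Tendsto (fun n => S n w) Filter.atTop
      (nhds (ennExp (ENNReal.ofReal a * occupation K w))) := fun w =>
    (continuous_ennExp.tendsto _).comp (ENNReal.Tendsto.const_mul
      ENNReal.summable.hasSum.tendsto_sum_nat (Or.inr ENNReal.ofReal_ne_top))
  have hmono : ∀ w, Monotone fun n => S n w := fun w m n hmn =>
    ennExp_mono (mul_le_mul_right (Finset.sum_le_sum_of_subset (Finset.range_mono hmn)) _)
  have hT := lintegral_tendsto_of_tendsto_of_monotone (μ := pathLaw x)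
    (fun n => (hSm n).aemeasurable) (Filter.Eventually.of_forall hmono)
    (Filter.Eventually.of_forall hlim)
  refine le_of_tendsto' hT fun n => ?_
  rw [← lintegral_prod_exp_equilibrium hd K ha hx n]
  refine lintegral_mono_ae ?_
  filter_upwards [ae_pathLaw_pos x] with w hw
  simp only [hS]
  rw [ennExp_mul_sum ha0 K hw n]
  refine le_mul_of_one_le_right' ?_
  rw [← ENNReal.ofReal_one]
  refine ENNReal.ofReal_le_ofReal ?_
  have := escapeProb_le_one K (w n).1
  have : 0 ≤ a / (1 - a) * (1 - escapeProb K (w n).1) :=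
    mul_nonneg (by positivity) (by linarith)
  linarith

/-- With `a = -b` the terminal factor is below one. Its deficit is at most the probability of a
visit to `K` after step `n`, an error that vanishes as `n → ∞`. -/
theorem lintegral_inv_ennExp_occupation_le (hd : 3 ≤ d) (K : Finset (Site d)) {b : ℝ} (hb : 0 ≤ b)
    {x : Site d} (hx : x ∈ K) :
    ∫⁻ w, (ennExp (ENNReal.ofReal b * occupation K w))⁻¹ ∂(pathLaw x)
      ≤ ENNReal.ofReal (1 / (1 + b)) := by
  have : NeZero d := ⟨by omega⟩
  have hT := (tendsto_lintegral_one_sub_escapeProb hd K x).const_add (ENNReal.ofReal (1 / (1 + b)))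
  rw [add_zero] at hT
  refine ge_of_tendsto' hT fun n => ?_
  have h1 := lintegral_prod_exp_equilibrium hd K (a := -b) (by linarith) hx n
  rw [sub_neg_eq_add] at h1
  have hm : Measurable fun w : ℕ → Site d × ℝ =>
      ENNReal.ofReal (1 - escapeProb K (w n).1) := by
    have he : Measurable (escapeProb K) := Measurable.of_discrete
    fun_prop
  rw [← h1, ← lintegral_add_right _ hm]
  refine lintegral_mono_ae ?_
  filter_upwards [ae_pathLaw_pos x] with w hw
  set p : ℝ := Real.exp (∑ k ∈ Finset.range n, -b * equilibrium K (w k).1 * (w k).2) with hp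
  have hprod : ∏ k ∈ Finset.range n,
      ENNReal.ofReal (Real.exp (-b * equilibrium K (w k).1 * (w k).2)) = ENNReal.ofReal p := by
    rw [hp, Real.exp_sum, ENNReal.ofReal_prod_of_nonneg fun k _ => (Real.exp_pos _).le]
  have hp0 : 0 ≤ p := (Real.exp_pos _).le
  have hp1 : p ≤ 1 := by
    rw [hp, Real.exp_le_one_iff]
    refine Finset.sum_nonpos fun k _ => ?_
    have := mul_nonneg (mul_nonneg hb (equilibrium_nonneg K (w k).1)) (hw k).le
    linarith
  have hle : (ennExp (ENNReal.ofReal b * occupation K w))⁻¹ ≤ ENNReal.ofReal p := by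
    have h2 : (ENNReal.ofReal p) = (∏ k ∈ Finset.range n,
        ENNReal.ofReal (Real.exp (b * equilibrium K (w k).1 * (w k).2)))⁻¹ := by
      rw [← ENNReal.ofReal_prod_of_nonneg fun k _ => (Real.exp_pos _).le, ← Real.exp_sum,
        ← ENNReal.ofReal_inv_of_pos (Real.exp_pos _), ← Real.exp_neg, hp]
      congr 2
      rw [← Finset.sum_neg_distrib]
      exact Finset.sum_congr rfl fun k _ => by ring
    rw [h2, ← ennExp_mul_sum hb K hw n, ENNReal.inv_le_inv]
    exact ennExp_mono (mul_le_mul_right (ENNReal.sum_le_tsum _) _)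
  refine hle.trans ?_
  have hq0 := escapeProb_nonneg K (w n).1
  have hq1 := escapeProb_le_one K (w n).1
  have hb1 : -b / (1 + b) = -1 + 1 / (1 + b) := by
    field_simp; ring
  have hb2 : 0 ≤ 1 / (1 + b) := by positivity
  rw [hprod, ← ENNReal.ofReal_mul hp0, ← ENNReal.ofReal_add _ (by linarith)]
  · refine ENNReal.ofReal_le_ofReal ?_
    rw [hb1]
    nlinarith [mul_nonneg hp0 (mul_nonneg hb2 (sub_nonneg.2 hq1)),
      mul_nonneg (sub_nonneg.2 hp1) (sub_nonneg.2 hq1)]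
  · rw [hb1]
    refine mul_nonneg hp0 ?_
    nlinarith [mul_nonneg hb2 (sub_nonneg.2 hq1)]

end moments

/-! ### Laplace functionals of Poisson point processes -/

section poisson
open scoped NNReal

lemma lintegral_poissonMeasure_exp (r : ℝ≥0) (c : ℝ) :
    ∫⁻ n, ENNReal.ofReal (Real.exp (c * n)) ∂(poissonMeasure r)
      = ENNReal.ofReal (Real.exp (r * (Real.exp c - 1))) := by
  rw [lintegral_countable']
  simp only [poissonMeasure_singleton]
  have h1 : ∀ n : ℕ, ENNReal.ofReal (Real.exp (c * n))
      * ENNReal.ofReal (Real.exp (-r) * r ^ n / (n.factorial : ℝ))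
      = ENNReal.ofReal (Real.exp (-r) * ((Real.exp c * r) ^ n / (n.factorial : ℝ))) := fun n => by
    rw [← ENNReal.ofReal_mul (Real.exp_pos _).le]
    congr 1
    rw [mul_comm c, Real.exp_nat_mul, mul_pow]
    ring
  simp only [h1]
  have h2 := (NormedSpace.expSeries_div_hasSum_exp (𝔸 := ℝ) (Real.exp c * r)).mul_left
    (Real.exp (-r))
  rw [← Real.exp_eq_exp_ℝ, ← Real.exp_add] at h2
  rw [← ENNReal.ofReal_tsum_of_nonneg (fun n => by positivity) h2.summable, h2.tsum_eq]
  congr 2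
  ring

variable {Ω S : Type*} [MeasurableSpace Ω] [MeasurableSpace S] {P : Measure Ω}
  {N : Ω → Measure S} {lam : Measure S}

/-- Only the values of `G` at integers matter, as the counts are integers almost surely. So `G` may
be an exponential on `[0, ∞]` or its inverse. -/
lemma IsPoissonPointProcess.lintegral_exp (hN : IsPoissonPointProcess P N lam) {A : Set S}
    (hA : MeasurableSet A) (hlam : lam A ≠ ∞) (c : ℝ) {G : ℝ≥0∞ → ℝ≥0∞} (hG : Measurable G)
    (hGc : ∀ n : ℕ, G n = ENNReal.ofReal (Real.exp (c * n))) :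
    ∫⁻ ω, G (N ω A) ∂P = ENNReal.ofReal (Real.exp ((lam A).toReal * (Real.exp c - 1))) := by
  have hm : Measurable fun ω => N ω A := (Measure.measurable_coe hA).comp hN.measurable
  rw [← lintegral_map hG hm, hN.poisson A hA hlam, lintegral_map hG Measurable.of_discrete]
  simp only [hGc]
  rw [lintegral_poissonMeasure_exp]
  rfl

/-- The Laplace functional of a Poisson point process at a simple function, for an exponential
function `G`, when it is known at multiples of indicator functions. -/
lemma IsPoissonPointProcess.lintegral_simpleFunc (hN : IsPoissonPointProcess P N lam) {A : Set S}
    (hA : MeasurableSet A) (hlam : lam A ≠ ∞) {G h : ℝ≥0∞ → ℝ≥0∞} (hG : Measurable G)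
    (hG0 : G 0 = 1) (hGadd : ∀ s t, G (s + t) = G s * G t)
    (hGh : ∀ (B : Set S) (c : ℝ≥0∞), MeasurableSet B → lam B ≠ ∞ → c ≠ ∞ →
      ∫⁻ ω, G (c * N ω B) ∂P = G (h c * lam B))
    (φ : SimpleFunc S ℝ≥0∞) (hφ : ∀ x, φ x ≠ ∞) :
    ∫⁻ ω, G (∫⁻ x in A, φ x ∂(N ω)) ∂P = G (∫⁻ x in A, h (φ x) ∂lam) := by
  classical
  have hGsum : ∀ {ι : Type} (s : Finset ι) (f : ι → ℝ≥0∞),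
      G (∑ i ∈ s, f i) = ∏ i ∈ s, G (f i) := fun s f => by
    induction s using Finset.induction_on with
    | empty => simp [hG0]
    | insert i s hi ih => rw [Finset.sum_insert hi, Finset.prod_insert hi, hGadd, ih]
  have hB : ∀ c, MeasurableSet (φ ⁻¹' {c}) := fun c => φ.measurableSet_fiber c
  set n := Fintype.card φ.range
  set e : Fin n ≃ φ.range := (Fintype.equivFin φ.range).symm
  have hsum : ∀ (f : ℝ≥0∞ → ℝ≥0∞) (μ : Measure S), ∫⁻ x in A, f (φ x) ∂μ
      = ∑ i : Fin n, f (e i).1 * μ (φ ⁻¹' {(e i).1} ∩ A) := fun f μ => by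
    have h1 : ∫⁻ x in A, f (φ x) ∂μ = (φ.map f).lintegral (μ.restrict A) := by
      rw [← SimpleFunc.lintegral_eq_lintegral]
      rfl
    rw [h1, SimpleFunc.map_lintegral, ← Finset.sum_coe_sort, ← e.sum_comp]
    exact Finset.sum_congr rfl fun i _ => by rw [Measure.restrict_apply (hB _)]
  have hsum' := hsum id
  simp only [id] at hsum'
  simp only [hsum, hsum', hGsum]
  -- The level sets of `φ` are disjoint, so their counts are independent and the expectation
  -- factorizes over the values of `φ`.
  have hind := hN.indep n (fun i => φ ⁻¹' {(e i).1} ∩ A) (fun i => (hB _).inter hA)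
    fun i j hij => by
      refine Disjoint.mono Set.inter_subset_left Set.inter_subset_left ?_
      refine Disjoint.preimage _ (Set.disjoint_singleton.2 fun h => hij ?_)
      exact e.injective (Subtype.ext h)
  have hgm : ∀ i : Fin n, Measurable fun t : ℝ≥0∞ => G ((e i).1 * t) := fun i =>
    hG.comp (measurable_const_mul _)
  have hind2 := hind.comp (fun i t => G ((e i).1 * t)) hgm
  have hprod := lintegral_prod_eq_prod_lintegral_of_indepFun Finset.univ _ hind2 fun i =>
    (hgm i).comp ((Measure.measurable_coe ((hB _).inter hA)).comp hN.measurable)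
  refine hprod.trans (Finset.prod_congr rfl fun i _ => ?_)
  refine hGh _ _ ((hB _).inter hA) (ne_top_of_le_ne_top hlam (measure_mono Set.inter_subset_right))
    ?_
  obtain ⟨x, hx⟩ := SimpleFunc.mem_range.1 (e i).2
  rw [← hx]
  exact hφ x

lemma measurable_setLIntegral {A : Set S} (hA : MeasurableSet A) {F : S → ℝ≥0∞}
    (hF : Measurable F) : Measurable fun μ : Measure S => ∫⁻ x in A, F x ∂μ := by
  simp only [← lintegral_indicator hA]
  exact Measure.measurable_lintegral (hF.indicator hA)

lemma ennExp_ne_zero (t : ℝ≥0∞) : ennExp t ≠ 0 := (one_pos.trans_le (one_le_ennExp t)).ne'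

/-- Equality holds for simple functions. The left side increases to its limit along simple
approximations from below, and the right side is bounded by monotonicity, so no convergence is
needed there. -/
theorem IsPoissonPointProcess.lintegral_ennExp_le (hN : IsPoissonPointProcess P N lam) {A : Set S}
    (hA : MeasurableSet A) (hlam : lam A ≠ ∞) {F : S → ℝ≥0∞} (hF : Measurable F) :
    ∫⁻ ω, ennExp (∫⁻ x in A, F x ∂(N ω)) ∂P ≤ ennExp (∫⁻ x in A, (ennExp (F x) - 1) ∂lam) := by
  have hsimple : ∀ k, ∫⁻ ω, ennExp (∫⁻ x in A, SimpleFunc.eapprox F k x ∂(N ω)) ∂P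
      = ennExp (∫⁻ x in A, (ennExp (SimpleFunc.eapprox F k x) - 1) ∂lam) := fun k => by
    refine hN.lintegral_simpleFunc hA hlam (h := fun t => ennExp t - 1) measurable_ennExp
      ennExp_zero ennExp_add (fun B c hB hB' hc => ?_) _
      fun x => (SimpleFunc.eapprox_lt_top F k x).ne
    lift c to ℝ≥0 using hc
    rw [hN.lintegral_exp hB hB' c (G := fun t => ennExp (c * t)) (by fun_prop) fun n => by
      rw [← ennExp_ofReal (by positivity), ENNReal.ofReal_mul (by positivity),
        ENNReal.ofReal_coe_nnreal, ENNReal.ofReal_natCast]]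
    have h1 : (1 : ℝ) ≤ Real.exp c := Real.one_le_exp c.2
    rw [← ennExp_ofReal (mul_nonneg ENNReal.toReal_nonneg (by linarith)),
      ENNReal.ofReal_mul ENNReal.toReal_nonneg, ENNReal.ofReal_toReal hB', mul_comm,
      ENNReal.ofReal_sub _ zero_le_one, ENNReal.ofReal_one, ← ennExp_ofReal c.coe_nonneg,
      ENNReal.ofReal_coe_nnreal]
  have hφm : ∀ k, Measurable fun x => SimpleFunc.eapprox F k x := fun k =>
    (SimpleFunc.eapprox F k).measurable
  have hinner : ∀ ω, Filter.Tendsto (fun k => ennExp (∫⁻ x in A, SimpleFunc.eapprox F k x ∂(N ω)))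
      Filter.atTop (nhds (ennExp (∫⁻ x in A, F x ∂(N ω)))) := fun ω =>
    (continuous_ennExp.tendsto _).comp (lintegral_tendsto_of_tendsto_of_monotone
      (fun k => (hφm k).aemeasurable)
      (Filter.Eventually.of_forall fun x i j hij => SimpleFunc.monotone_eapprox F hij x)
      (Filter.Eventually.of_forall fun x => SimpleFunc.tendsto_eapprox hF x))
  have hT := lintegral_tendsto_of_tendsto_of_monotone (μ := P)
    (f := fun k ω => ennExp (∫⁻ x in A, SimpleFunc.eapprox F k x ∂(N ω)))
    (fun k => (measurable_ennExp.comp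
        ((measurable_setLIntegral hA (hφm k)).comp hN.measurable)).aemeasurable)
    (Filter.Eventually.of_forall fun ω i j hij => ennExp_mono
      (lintegral_mono fun x => SimpleFunc.monotone_eapprox F hij x))
    (Filter.Eventually.of_forall hinner)
  refine le_of_tendsto' hT fun k => ?_
  rw [hsimple]
  refine ennExp_mono (lintegral_mono fun x => tsub_le_tsub_right (ennExp_mono ?_) _)
  rw [← SimpleFunc.iSup_eapprox_apply hF x]
  exact le_iSup (fun k => SimpleFunc.eapprox F k x) k

/-- With the inverse the roles are exchanged: approximation from below only increases the left side,
and the limit is taken on the right. -/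
theorem IsPoissonPointProcess.lintegral_inv_ennExp_le (hN : IsPoissonPointProcess P N lam)
    {A : Set S} (hA : MeasurableSet A) (hlam : lam A ≠ ∞) {F : S → ℝ≥0∞} (hF : Measurable F) :
    ∫⁻ ω, (ennExp (∫⁻ x in A, F x ∂(N ω)))⁻¹ ∂P
      ≤ (ennExp (∫⁻ x in A, (1 - (ennExp (F x))⁻¹) ∂lam))⁻¹ := by
  have hsimple : ∀ k, ∫⁻ ω, (ennExp (∫⁻ x in A, SimpleFunc.eapprox F k x ∂(N ω)))⁻¹ ∂P
      = (ennExp (∫⁻ x in A, (1 - (ennExp (SimpleFunc.eapprox F k x))⁻¹) ∂lam))⁻¹ := fun k => by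
    refine hN.lintegral_simpleFunc hA hlam (G := fun t => (ennExp t)⁻¹)
      (h := fun t => 1 - (ennExp t)⁻¹) measurable_ennExp.inv (by simp) (fun s t => ?_)
      (fun B c hB hB' hc => ?_) _ fun x => (SimpleFunc.eapprox_lt_top F k x).ne
    · rw [ennExp_add, ENNReal.mul_inv (Or.inl (ennExp_ne_zero _)) (Or.inr (ennExp_ne_zero _))]
    lift c to ℝ≥0 using hc
    rw [hN.lintegral_exp hB hB' (-c) (G := fun t => (ennExp (c * t))⁻¹)
      (measurable_ennExp.comp (measurable_const_mul _)).inv fun n => by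
        rw [neg_mul, Real.exp_neg, ENNReal.ofReal_inv_of_pos (Real.exp_pos _),
          ← ennExp_ofReal (by positivity), ENNReal.ofReal_mul (by positivity),
          ENNReal.ofReal_coe_nnreal, ENNReal.ofReal_natCast]]
    have h1 : Real.exp (-(c : ℝ)) ≤ 1 := Real.exp_le_one_iff.2 (neg_nonpos.2 c.2)
    have h2 : (ennExp c)⁻¹ = ENNReal.ofReal (Real.exp (-(c : ℝ))) := by
      rw [Real.exp_neg, ENNReal.ofReal_inv_of_pos (Real.exp_pos _), ← ennExp_ofReal c.coe_nonneg,
        ENNReal.ofReal_coe_nnreal]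
    have h3 : (1 - (ennExp c)⁻¹) * lam B
        = ENNReal.ofReal ((lam B).toReal * (1 - Real.exp (-(c : ℝ)))) := by
      rw [ENNReal.ofReal_mul ENNReal.toReal_nonneg, ENNReal.ofReal_toReal hB',
        ENNReal.ofReal_sub _ (Real.exp_pos _).le, ENNReal.ofReal_one, h2, mul_comm]
    rw [h3, ennExp_ofReal (mul_nonneg ENNReal.toReal_nonneg (by linarith)),
      ← ENNReal.ofReal_inv_of_pos (Real.exp_pos _), ← Real.exp_neg]
    congr 2
    ring
  have hφm : ∀ k, Measurable fun x => SimpleFunc.eapprox F k x := fun k =>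
    (SimpleFunc.eapprox F k).measurable
  have hinner : Filter.Tendsto
      (fun k => ∫⁻ x in A, (1 - (ennExp (SimpleFunc.eapprox F k x))⁻¹) ∂lam)
      Filter.atTop (nhds (∫⁻ x in A, (1 - (ennExp (F x))⁻¹) ∂lam)) := by
    refine lintegral_tendsto_of_tendsto_of_monotone (fun k => ?_)
      (Filter.Eventually.of_forall fun x i j hij => ?_)
      (Filter.Eventually.of_forall fun x => ?_)
    · exact (measurable_const.sub (measurable_ennExp.comp (hφm k)).inv).aemeasurable
    · exact tsub_le_tsub_left (ENNReal.inv_le_inv.2 (ennExp_mono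
        (SimpleFunc.monotone_eapprox F hij x))) _
    · refine ENNReal.Tendsto.sub tendsto_const_nhds ?_ (Or.inl ENNReal.one_ne_top)
      exact ((continuous_inv.comp continuous_ennExp).tendsto _).comp
        (SimpleFunc.tendsto_eapprox hF x)
  have hT := ((continuous_inv.comp continuous_ennExp).tendsto _).comp hinner
  refine ge_of_tendsto' hT fun k => ?_
  simp only [Function.comp]
  rw [← hsimple k]
  refine lintegral_mono fun ω => ENNReal.inv_le_inv.2 (ennExp_mono (lintegral_mono fun x => ?_))
  rw [← SimpleFunc.iSup_eapprox_apply hF x]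
  exact le_iSup (fun k => SimpleFunc.eapprox F k x) k

end poisson

/-! ### The onward trajectory -/

section onward
variable {d : ℕ}

lemma measurable_coord {ι E : Type*} [MeasurableSpace E] {s : Set (ι → E)} (n : ι) :
    Measurable fun w : s => w.1 n :=
  (measurable_pi_apply n).comp measurable_subtype_coe

lemma finite_visits (K : Finset (Site d)) (w : TwoSidedPath d) : {n | (w.1 n).1 ∈ K}.Finite := by
  have : {n | (w.1 n).1 ∈ K} = ⋃ x ∈ K, {n | (w.1 n).1 = x} := by ext; simp
  rw [this]
  exact K.finite_toSet.biUnion fun x _ => w.2.2.2.1 x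

lemma firstEntrance_eq {K : Finset (Site d)} {w : TwoSidedPath d} {k : ℤ} (h1 : (w.1 k).1 ∈ K)
    (h2 : ∀ j < k, (w.1 j).1 ∉ K) : firstEntrance K w = k :=
  IsLeast.csInf_eq ⟨h1, fun j hj => not_lt.1 fun h => h2 j h hj⟩

lemma firstEntrance_spec {K : Finset (Site d)} {w : TwoSidedPath d} (hw : Visits K w) :
    (w.1 (firstEntrance K w)).1 ∈ K ∧ ∀ j < firstEntrance K w, (w.1 j).1 ∉ K := by
  have hfin := finite_visits K w
  refine ⟨Set.Nonempty.csInf_mem (s := {n | (w.1 n).1 ∈ K}) hw hfin, fun j hj hjK => ?_⟩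
  exact not_le.2 hj (csInf_le hfin.bddBelow hjK)

lemma measurableSet_coord_mem (K : Finset (Site d)) (n : ℤ) :
    MeasurableSet {w : TwoSidedPath d | (w.1 n).1 ∈ K} := by
  have hm : Measurable fun w : TwoSidedPath d => (w.1 n).1 := (measurable_coord n).fst
  exact hm (MeasurableSet.of_discrete (s := {y | y ∈ K}))

lemma measurableSet_visits (K : Finset (Site d)) :
    MeasurableSet {w : TwoSidedPath d | Visits K w} := by
  simp only [Visits, Set.ofPred_exists]
  exact MeasurableSet.iUnion fun n => measurableSet_coord_mem K n

lemma measurableSet_firstEntrance (K : Finset (Site d)) (k : ℤ) :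
    MeasurableSet {w : TwoSidedPath d | (w.1 k).1 ∈ K ∧ ∀ j < k, (w.1 j).1 ∉ K} := by
  simp only [Set.ofPred_and, Set.ofPred_forall]
  exact (measurableSet_coord_mem K k).inter (MeasurableSet.iInter fun j =>
    MeasurableSet.iInter fun _ => (measurableSet_coord_mem K j).compl)

lemma preimage_visiting (K : Finset (Site d)) :
    Quotient.mk (shiftSetoid d) ⁻¹' visiting K = {w | Visits K w} := by
  ext w
  refine ⟨fun ⟨v, hv, hvw⟩ => ?_, fun hw => ⟨w, hw, rfl⟩⟩
  exact (onward_aux K (Quotient.exact hvw) hv).1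

lemma measurableSet_visiting (K : Finset (Site d)) : MeasurableSet (visiting K) := by
  rw [measurableSet_quotient]
  exact (preimage_visiting K).symm ▸ measurableSet_visits K

lemma onward_mk {K : Finset (Site d)} {w : TwoSidedPath d} (hw : Visits K w) :
    onward K (Quotient.mk (shiftSetoid d) w) = forwardFrom w (firstEntrance K w) :=
  if_pos hw

lemma measurable_forwardFrom (k : ℤ) : Measurable fun w : TwoSidedPath d => forwardFrom w k :=
  Measurable.subtype_mk (measurable_pi_iff.2 fun _ => measurable_coord _)

/-- On trajectories visiting `K` the map is measurable on each of the countably many events that fix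
the entrance time. On the others it takes a single value, so the preimage contains all or none of
them. -/
lemma measurable_onward (K : Finset (Site d)) : Measurable (onward K) := by
  rw [measurable_from_quotient]
  intro s hs
  have h : (onward K ∘ Quotient.mk'') ⁻¹' s
      = (⋃ k : ℤ, {w | (w.1 k).1 ∈ K ∧ ∀ j < k, (w.1 j).1 ∉ K}
          ∩ (fun w : TwoSidedPath d => forwardFrom w k) ⁻¹' s)
        ∪ ({w | Visits K w}ᶜ ∩ {w : TwoSidedPath d | Visits K w ∨
          onward K (Quotient.mk (shiftSetoid d) w) ∈ s}) := by
    ext w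
    simp only [Set.mem_preimage, Function.comp, Set.mem_union, Set.mem_iUnion, Set.mem_inter_iff,
      Set.mem_ofPred_eq, Set.mem_compl_iff]
    change onward K (Quotient.mk (shiftSetoid d) w) ∈ s ↔ _
    by_cases hw : Visits K w
    · rw [onward_mk hw]
      simp only [hw, not_true_eq_false, false_and, or_false]
      refine ⟨fun h => ⟨_, firstEntrance_spec hw, h⟩, fun ⟨k, hk, h⟩ => ?_⟩
      rwa [firstEntrance_eq hk.1 hk.2]
    · simp only [hw, not_false_eq_true, false_or, true_and]
      refine ⟨Or.inr, fun h => h.resolve_left fun ⟨k, hk, _⟩ => hw ⟨k, hk.1⟩⟩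
  rw [h]
  refine (MeasurableSet.iUnion fun k => (measurableSet_firstEntrance K k).inter
    (measurable_forwardFrom k hs)).union ?_
  have hconst : ∀ v w : TwoSidedPath d, ¬ Visits K v → ¬ Visits K w →
      onward K (Quotient.mk (shiftSetoid d) v) = onward K (Quotient.mk (shiftSetoid d) w) :=
    fun v w hv hw => (if_neg hv).trans (if_neg hw).symm
  by_cases hex : ∃ v : TwoSidedPath d, ¬ Visits K v ∧ onward K (Quotient.mk (shiftSetoid d) v) ∈ s
  · obtain ⟨v, hv, hvs⟩ := hex
    convert! (measurableSet_visits K).compl using 1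
    ext w
    simp only [Set.mem_inter_iff, Set.mem_compl_iff, Set.mem_ofPred_eq, and_iff_left_iff_imp]
    exact fun hw => Or.inr (hconst v w hv hw ▸ hvs)
  · convert! MeasurableSet.empty using 1
    ext w
    simp only [Set.mem_inter_iff, Set.mem_compl_iff, Set.mem_ofPred_eq, Set.mem_empty_iff_false,
      iff_false, not_and, not_or]
    exact fun hw => ⟨hw, fun h => hex ⟨w, hw, h⟩⟩

end onward

/-! ### The intensity measure -/

section intensity
variable {d : ℕ}

lemma measurable_glue : Measurable (glue (d := d)) := by
  refine measurable_pi_iff.2 fun n => ?_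
  unfold glue
  split_ifs
  exacts [(measurable_coord _).comp measurable_fst, (measurable_coord _).comp measurable_snd]

lemma isNeighbor_comm {x y : Site d} : IsNeighbor x y ↔ IsNeighbor y x := by
  simp only [IsNeighbor, sub_sq_comm]

lemma measurableSet_returnTime (K : Finset (Site d)) :
    MeasurableSet {w : ForwardPath d | returnTime K w = ∞} := by
  simp only [returnTime_eq_top_iff]
  exact measurable_subtype_coe (measurableSet_forall_notMem K Nat.succ)

lemma glue_natCast (p : ForwardPath d × ForwardPath d) (n : ℕ) : glue p n = p.1.1 n := by
  simp [glue]

lemma glue_neg_succ (p : ForwardPath d × ForwardPath d) (n : ℕ) :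
    glue p (-((n + 1 : ℕ) : ℤ)) = p.2.1 (n + 1) := by
  rw [glue, if_neg (by push_cast; omega), neg_neg, Int.toNat_natCast]

lemma glue_mem_twoSidedSet {p : ForwardPath d × ForwardPath d} (h : (p.1.1 0).1 = (p.2.1 0).1) :
    glue p ∈ twoSidedSet d := by
  obtain ⟨hn1, hp1, hf1, ht1⟩ := p.1.2
  obtain ⟨hn2, hp2, hf2, ht2⟩ := p.2.2
  have hcases : ∀ n : ℤ, (∃ m : ℕ, n = m) ∨ ∃ m : ℕ, n = -((m + 1 : ℕ) : ℤ) := fun n => by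
    rcases le_or_gt 0 n with h0 | h0
    · exact Or.inl ⟨n.toNat, by omega⟩
    · exact Or.inr ⟨(-n).toNat - 1, by omega⟩
  refine ⟨fun n => ?_, fun n => ?_, fun x => ?_, ?_, ?_⟩
  · rcases hcases n with ⟨m, rfl⟩ | ⟨m, rfl⟩
    · have := glue_natCast p (m + 1)
      rw [Nat.cast_succ] at this
      rw [this, glue_natCast]
      exact hn1 m
    · rw [glue_neg_succ, isNeighbor_comm]
      rcases m with _ | m
      · have : glue p (-((0 + 1 : ℕ) : ℤ) + 1) = p.1.1 0 := glue_natCast p 0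
        rw [this, h]
        exact hn2 0
      · rw [show -((m + 1 + 1 : ℕ) : ℤ) + 1 = -((m + 1 : ℕ) : ℤ) by push_cast; ring, glue_neg_succ]
        exact hn2 (m + 1)
  · rcases hcases n with ⟨m, rfl⟩ | ⟨m, rfl⟩
    · rw [glue_natCast]; exact hp1 m
    · rw [glue_neg_succ]; exact hp2 _
  · refine (((hf1 x).image fun m : ℕ => (m : ℤ)).union
      ((hf2 x).image fun m : ℕ => -(m : ℤ))).subset fun n hn => ?_
    rcases hcases n with ⟨m, rfl⟩ | ⟨m, rfl⟩
    · exact Or.inl ⟨m, by simpa [glue_natCast] using hn, rfl⟩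
    · exact Or.inr ⟨m + 1, by rw [Set.mem_ofPred_eq, glue_neg_succ] at hn; exact hn, rfl⟩
  -- The holding time at index `0` comes from the forward path, so the divergent backward sum is
  -- used without its first term.
  · rw [tsum_eq_zero_add' ENNReal.summable] at ht2 ⊢
    simp only [glue_neg_succ]
    have := (ENNReal.add_eq_top.1 ht2).resolve_left ENNReal.ofReal_ne_top
    rw [this, add_top]
  · simpa only [glue_natCast] using ht1

/-- The onward trajectory of a glued trajectory whose backward part does not return to `K`. -/
lemma onward_glue {K : Finset (Site d)} {p : ForwardPath d × ForwardPath d}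
    (h : (p.1.1 0).1 = (p.2.1 0).1) (hK : (p.1.1 0).1 ∈ K) (hp : ∀ n, (p.2.1 (n + 1)).1 ∉ K) :
    onward K (Quotient.mk (shiftSetoid d) ⟨glue p, glue_mem_twoSidedSet h⟩) = p.1 := by
  have h0 : (glue p 0).1 ∈ K := hK
  rw [onward_mk ⟨0, h0⟩, firstEntrance_eq (k := 0) h0]
  · apply Subtype.ext
    funext n
    simp only [forwardFrom, zero_add]
    exact glue_natCast p n
  · intro j hj
    obtain ⟨m, rfl⟩ : ∃ m : ℕ, j = -((m + 1 : ℕ) : ℤ) := ⟨(-j).toNat - 1, by omega⟩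
    change (glue p _).1 ∉ K
    rw [glue_neg_succ]
    exact hp m

/-- Under the interlacement intensity, the onward trajectory upon the first entrance in `K` is
distributed as the walk started from the equilibrium measure of `K`. -/
theorem IsInterlacementIntensity.lintegral_onward (hd : 3 ≤ d) {ν : Measure (PathClass d)}
    (hν : IsInterlacementIntensity ν) (K : Finset (Site d)) {G : ForwardPath d → ℝ≥0∞}
    (hG : Measurable G) :
    ∫⁻ w in visiting K, G (onward K w) ∂ν
      = ∑ x ∈ K, ENNReal.ofReal (equilibrium K x) * ∫⁻ w, G w ∂(walkLaw x) := by
  have : NeZero d := ⟨by omega⟩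
  have hmk : Measurable (Quotient.mk (shiftSetoid d)) := measurable_quotient_mk''
  have hH : Measurable fun w : PathClass d => G (onward K w) := hG.comp (measurable_onward K)
  have hs := measurableSet_twoSidedSet d
  rw [hν K, lintegral_map hH hmk]
  set f : TwoSidedPath d → ℝ≥0∞ := fun w => G (onward K (Quotient.mk (shiftSetoid d) w)) with hf
  have hfm : Measurable f := hH.comp hmk
  -- `hitMeasure` is a pullback to the subtype; the extension by zero allows integration over all
  -- glued sequences, where the product structure is visible.
  set g : (ℤ → Site d × ℝ) → ℝ≥0∞ := Function.extend Subtype.val f 0 with hg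
  have hgm : Measurable g :=
    (MeasurableEmbedding.subtype_coe hs).measurable_extend hfm measurable_zero
  have hgf : ∀ w : TwoSidedPath d, g w.1 = f w := fun w => Subtype.val_injective.extend_apply f 0 w
  rw [lintegral_congr fun w => (hgf w).symm, hitMeasure, lintegral_subtype_comap hs,
    ← lintegral_indicator hs, lintegral_finsetSum_measure]
  refine Finset.sum_congr rfl fun x hx => ?_
  have hgi : Measurable ((twoSidedSet d).indicator g) := hgm.indicator hs
  rw [lintegral_smul_measure, smul_eq_mul, lintegral_map hgi measurable_glue]
  -- At a point of zero equilibrium mass the conditioning on no return is degenerate, but the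
  -- summand vanishes.
  rcases (equilibrium_nonneg K x).eq_or_lt with h0 | h0
  · simp [← h0]
  congr 1
  have hprob := isProbabilityMeasure_walkLaw hd x
  have hne : walkLaw x {w | returnTime K w = ∞} ≠ 0 := fun h => by
    rw [equilibrium, if_pos hx, measureReal_def, h] at h0
    simp at h0
  have hcond := cond_isProbabilityMeasure hne
  have hstart : ∀ᵐ w ∂(walkLaw x), (w.1 0).1 = x := by
    have h1 := ae_pathLaw_zero x
    rw [← map_walkLaw hd x] at h1
    exact ae_of_ae_map measurable_subtype_coe.aemeasurable h1
  have h1 := (Measure.quasiMeasurePreserving_fst (μ := walkLaw x)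
    (ν := cond (walkLaw x) {w | returnTime K w = ∞})).ae hstart
  have h2 := (Measure.quasiMeasurePreserving_snd (μ := walkLaw x)).ae
    (cond_absolutelyContinuous.ae_le hstart
      : ∀ᵐ w ∂(cond (walkLaw x) {w | returnTime K w = ∞}), (w.1 0).1 = x)
  have h3 := (Measure.quasiMeasurePreserving_snd (μ := walkLaw x)).ae
    (ae_cond_of_forall_mem (μ := walkLaw x) (measurableSet_returnTime K)
      (p := fun w => ∀ n, (w.1 (n + 1)).1 ∉ K) fun w hw => (returnTime_eq_top_iff K w).1 hw)
  rw [lintegral_congr_ae (g := fun p => G p.1)]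
  · have := (measurePreserving_fst (μ := walkLaw x)
      (ν := cond (walkLaw x) {w | returnTime K w = ∞})).lintegral_comp hG
    exact this
  · filter_upwards [h1, h2, h3] with p hp1 hp2 hp3
    have h : (p.1.1 0).1 = (p.2.1 0).1 := hp1.trans hp2.symm
    have hmem := glue_mem_twoSidedSet h
    rw [Set.indicator_of_mem hmem, hgf ⟨glue p, hmem⟩]
    simp only [hf]
    rw [onward_glue h (hp1 ▸ hx) hp3]

lemma IsInterlacementIntensity.measure_visiting (hd : 3 ≤ d) {ν : Measure (PathClass d)}
    (hν : IsInterlacementIntensity ν) (K : Finset (Site d)) :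
    ν (visiting K) = ENNReal.ofReal (capacity K) := by
  have h := hν.lintegral_onward hd K (G := fun _ => 1) measurable_const
  have h1 : ∀ x : Site d, walkLaw x Set.univ = 1 := fun x =>
    (isProbabilityMeasure_walkLaw hd x).measure_univ
  simp only [lintegral_const, h1, Measure.restrict_apply_univ, one_mul, mul_one] at h
  rw [h, capacity, ENNReal.ofReal_sum_of_nonneg fun x _ => equilibrium_nonneg K x]

/-- Every trajectory visits some site, and the trajectories visiting a given site have finite
measure. This is what Fubini needs for `ν(dw) du`. -/
lemma IsInterlacementIntensity.sigmaFinite (hd : 3 ≤ d) {ν : Measure (PathClass d)}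
    (hν : IsInterlacementIntensity ν) : SigmaFinite ν := by
  refine Measure.sigmaFinite_of_countable
    (S := Set.range fun x : Site d => visiting ({x} : Finset (Site d)))
    (Set.countable_range _) ?_ ?_
  · rintro _ ⟨x, rfl⟩
    simp only [hν.measure_visiting hd]
    exact ENNReal.ofReal_lt_top
  · refine Set.eq_univ_of_forall fun w => ?_
    induction w using Quotient.inductionOn with
    | h w => exact ⟨_, ⟨(w.1 0).1, rfl⟩, w, ⟨0, by simp⟩, rfl⟩

lemma IsInterlacementIntensity.setLIntegral_prod (hd : 3 ≤ d) {ν : Measure (PathClass d)}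
    (hν : IsInterlacementIntensity ν) (K : Finset (Site d)) (u : ℝ) {G : ForwardPath d → ℝ≥0∞}
    (hG : Measurable G) :
    ∫⁻ p in visiting K ×ˢ Set.Iic u, G (onward K p.1) ∂(ν.prod (volume.restrict (Set.Ici 0)))
      = ENNReal.ofReal u
        * ∑ x ∈ K, ENNReal.ofReal (equilibrium K x) * ∫⁻ w, G w ∂(walkLaw x) := by
  have := hν.sigmaFinite hd
  have hH : Measurable fun p : PathClass d × ℝ => G (onward K p.1) :=
    hG.comp ((measurable_onward K).comp measurable_fst)
  rw [← Measure.prod_restrict, lintegral_prod _ hH.aemeasurable]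
  simp only [lintegral_const]
  have hG' : Measurable fun w => G (onward K w) := hG.comp (measurable_onward K)
  rw [lintegral_mul_const _ hG', hν.lintegral_onward hd K hG, mul_comm,
    Measure.restrict_apply_univ, Measure.restrict_apply measurableSet_Iic, Set.inter_comm,
    Set.Ici_inter_Iic, Real.volume_Icc, sub_zero]

end intensity

/-! ### Deviations of the total occupation -/

section deviations
variable {d : ℕ}

/-- The integral over the onward trajectories at level `u` of the occupation functional. -/
def totalOccupation (K : Finset (Site d)) (u : ℝ) (η : Measure (PathClass d × ℝ)) : ℝ≥0∞ :=
  ∫⁻ p in visiting K ×ˢ Set.Iic u, occupation K (onward K p.1).1 ∂η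

lemma measurable_occupation_onward (K : Finset (Site d)) :
    Measurable fun p : PathClass d × ℝ => occupation K (onward K p.1).1 :=
  (measurable_occupation K).comp
    (measurable_subtype_coe.comp ((measurable_onward K).comp measurable_fst))

lemma measurableSet_visiting_prod (K : Finset (Site d)) (u : ℝ) :
    MeasurableSet (visiting K ×ˢ Set.Iic u) := (measurableSet_visiting K).prod measurableSet_Iic

lemma measurable_totalOccupation (K : Finset (Site d)) (u : ℝ) :
    Measurable (totalOccupation K u) :=
  measurable_setLIntegral (measurableSet_visiting_prod K u) (measurable_occupation_onward K)

lemma const_mul_totalOccupation (K : Finset (Site d)) (u a : ℝ) (η : Measure (PathClass d × ℝ)) :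
    ENNReal.ofReal a * totalOccupation K u η
      = ∫⁻ p in visiting K ×ˢ Set.Iic u, ENNReal.ofReal a * occupation K (onward K p.1).1 ∂η :=
  (lintegral_const_mul _ (measurable_occupation_onward K)).symm

lemma IsInterlacementIntensity.measure_visiting_prod_ne_top (hd : 3 ≤ d)
    {ν : Measure (PathClass d)} (hν : IsInterlacementIntensity ν) (K : Finset (Site d)) (u : ℝ) :
    ν.prod (volume.restrict (Set.Ici 0)) (visiting K ×ˢ Set.Iic u) ≠ ∞ := by
  have h := hν.setLIntegral_prod hd K u (G := fun _ => 1) measurable_const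
  rw [lintegral_const, one_mul, Measure.restrict_apply_univ] at h
  rw [h]
  have h1 : ∀ x : Site d, walkLaw x Set.univ = 1 := fun x =>
    (isProbabilityMeasure_walkLaw hd x).measure_univ
  simp only [lintegral_const, h1, mul_one]
  exact ENNReal.mul_ne_top ENNReal.ofReal_ne_top
    (ENNReal.sum_ne_top.2 fun x _ => ENNReal.ofReal_ne_top)

variable {Ω : Type*} [MeasurableSpace Ω] {P : Measure Ω} {N : Ω → Measure (PathClass d × ℝ)}

lemma sum_equilibrium_mul_le {K : Finset (Site d)} {m : Site d → ℝ≥0∞} {c : ℝ} (hc : 0 ≤ c)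
    (hm : ∀ x ∈ K, m x ≤ ENNReal.ofReal c) :
    ∑ x ∈ K, ENNReal.ofReal (equilibrium K x) * m x ≤ ENNReal.ofReal (capacity K * c) := by
  rw [capacity, Finset.sum_mul, ENNReal.ofReal_sum_of_nonneg fun x _ =>
    mul_nonneg (equilibrium_nonneg K x) hc]
  refine Finset.sum_le_sum fun x hx => ?_
  rw [ENNReal.ofReal_mul (equilibrium_nonneg K x)]
  exact mul_le_mul_right (hm x hx) _

lemma le_sum_equilibrium_mul {K : Finset (Site d)} {m : Site d → ℝ≥0∞} {c : ℝ} (hc : 0 ≤ c)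
    (hm : ∀ x ∈ K, ENNReal.ofReal c ≤ m x) :
    ENNReal.ofReal (capacity K * c) ≤ ∑ x ∈ K, ENNReal.ofReal (equilibrium K x) * m x := by
  rw [capacity, Finset.sum_mul, ENNReal.ofReal_sum_of_nonneg fun x _ =>
    mul_nonneg (equilibrium_nonneg K x) hc]
  refine Finset.sum_le_sum fun x hx => ?_
  rw [ENNReal.ofReal_mul (equilibrium_nonneg K x)]
  exact mul_le_mul_right (hm x hx) _

/-- In the Laplace functional each starting point in `K` contributes at most `1/(1-a) - 1 =
a/(1-a)`, and the weights add up to `u` times the capacity. -/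
lemma IsInterlacementProcess.lintegral_ennExp_le (hd : 3 ≤ d) (hN : IsInterlacementProcess P N)
    (K : Finset (Site d)) {u a : ℝ} (hu : 0 ≤ u) (ha0 : 0 ≤ a) (ha : a < 1) :
    ∫⁻ ω, ennExp (ENNReal.ofReal a * totalOccupation K u (N ω)) ∂P
      ≤ ENNReal.ofReal (Real.exp (u * (capacity K * (a / (1 - a))))) := by
  obtain ⟨ν, hν, hP⟩ := hN
  have ha' : 0 < 1 - a := by linarith
  have hF : Measurable fun p : PathClass d × ℝ =>
      ENNReal.ofReal a * occupation K (onward K p.1).1 :=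
    (measurable_occupation_onward K).const_mul _
  have h := hP.lintegral_ennExp_le (measurableSet_visiting_prod K u)
    (hν.measure_visiting_prod_ne_top hd K u) hF
  simp only [const_mul_totalOccupation]
  refine h.trans ?_
  have hc : 0 ≤ a / (1 - a) := by positivity
  rw [← ennExp_ofReal (mul_nonneg hu (mul_nonneg (capacity_nonneg K) hc))]
  refine ennExp_mono ?_
  have hG : Measurable fun w : ForwardPath d =>
      ennExp (ENNReal.ofReal a * occupation K w.1) - 1 := by
    have : Measurable fun w : ForwardPath d => occupation K w.1 :=
      (measurable_occupation K).comp measurable_subtype_coe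
    fun_prop
  rw [hν.setLIntegral_prod hd K u hG, ENNReal.ofReal_mul hu]
  refine mul_le_mul_right (sum_equilibrium_mul_le hc fun x hx => ?_) _
  have hm1 : Measurable fun w : ℕ → Site d × ℝ =>
      ennExp (ENNReal.ofReal a * occupation K w) - 1 := by fun_prop
  have : NeZero d := ⟨by omega⟩
  rw [lintegral_walkLaw hd x hm1, lintegral_sub measurable_const (by simp)
    (Filter.Eventually.of_forall fun w => one_le_ennExp _)]
  rw [lintegral_const, measure_univ, mul_one]
  refine (tsub_le_tsub_right (lintegral_ennExp_occupation_le hd K ha0 ha hx) 1).trans ?_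
  rw [← ENNReal.ofReal_one, ← ENNReal.ofReal_sub _ zero_le_one]
  refine le_of_eq (congrArg _ ?_)
  field_simp
  ring

lemma IsInterlacementProcess.lintegral_inv_ennExp_le (hd : 3 ≤ d)
    (hN : IsInterlacementProcess P N) (K : Finset (Site d)) {u b : ℝ} (hu : 0 ≤ u) (hb : 0 ≤ b) :
    ∫⁻ ω, (ennExp (ENNReal.ofReal b * totalOccupation K u (N ω)))⁻¹ ∂P
      ≤ ENNReal.ofReal (Real.exp (-(u * (capacity K * (b / (1 + b)))))) := by
  obtain ⟨ν, hν, hP⟩ := hN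
  have hF : Measurable fun p : PathClass d × ℝ =>
      ENNReal.ofReal b * occupation K (onward K p.1).1 :=
    (measurable_occupation_onward K).const_mul _
  have h := hP.lintegral_inv_ennExp_le (measurableSet_visiting_prod K u)
    (hν.measure_visiting_prod_ne_top hd K u) hF
  simp only [const_mul_totalOccupation]
  refine h.trans ?_
  have hc : 0 ≤ b / (1 + b) := by positivity
  rw [Real.exp_neg, ENNReal.ofReal_inv_of_pos (Real.exp_pos _),
    ← ennExp_ofReal (mul_nonneg hu (mul_nonneg (capacity_nonneg K) hc))]
  refine ENNReal.inv_le_inv.2 (ennExp_mono ?_)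
  have hG : Measurable fun w : ForwardPath d =>
      1 - (ennExp (ENNReal.ofReal b * occupation K w.1))⁻¹ := by
    have : Measurable fun w : ForwardPath d => occupation K w.1 :=
      (measurable_occupation K).comp measurable_subtype_coe
    fun_prop
  rw [hν.setLIntegral_prod hd K u hG, ENNReal.ofReal_mul hu]
  refine mul_le_mul_right (le_sum_equilibrium_mul hc fun x hx => ?_) _
  have hm0 : Measurable fun w : ℕ → Site d × ℝ =>
      (ennExp (ENNReal.ofReal b * occupation K w))⁻¹ := by fun_prop
  have hm1 : Measurable fun w : ℕ → Site d × ℝ =>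
      1 - (ennExp (ENNReal.ofReal b * occupation K w))⁻¹ := by fun_prop
  have : NeZero d := ⟨by omega⟩
  have hle := lintegral_inv_ennExp_occupation_le hd K hb hx
  rw [lintegral_walkLaw hd x hm1, lintegral_sub hm0 (ne_top_of_le_ne_top ENNReal.ofReal_ne_top hle)
    (Filter.Eventually.of_forall fun w => ENNReal.inv_le_one.2 (one_le_ennExp _))]
  rw [lintegral_const, measure_univ, mul_one]
  refine le_trans ?_ (tsub_le_tsub_left hle 1)
  rw [← ENNReal.ofReal_one, ← ENNReal.ofReal_sub _ (by positivity)]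
  refine le_of_eq (congrArg _ ?_)
  field_simp
  ring

/-- Large deviations above the mean. -/
theorem IsInterlacementProcess.measure_le_totalOccupation (hd : 3 ≤ d)
    (hN : IsInterlacementProcess P N) (K : Finset (Site d)) {u v : ℝ} (hu : 0 < u) (huv : u < v) :
    P {ω | ENNReal.ofReal (v * capacity K) ≤ totalOccupation K u (N ω)}
      ≤ ENNReal.ofReal (Real.exp (-(√v - √u) ^ 2 * capacity K)) := by
  have hcap := capacity_nonneg K
  have hs : 0 < √u := Real.sqrt_pos.2 hu
  have hst : √u < √v := Real.sqrt_lt_sqrt hu.le huv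
  have ht : 0 < √v := hs.trans hst
  have hu2 : u = √u ^ 2 := (Real.sq_sqrt hu.le).symm
  have hv2 : v = √v ^ 2 := (Real.sq_sqrt (hu.trans huv).le).symm
  set s := √u
  set t := √v
  -- The minimizer of `u a/(1-a) - a v`, with minimum `-(t - s)²`.
  set a := 1 - s / t with ha
  have ha0 : 0 ≤ a := by
    rw [ha, sub_nonneg, div_le_one ht]; exact hst.le
  have ha1 : a < 1 := by
    rw [ha]; linarith [div_pos hs ht]
  have hv0 : 0 ≤ v * capacity K := mul_nonneg (hu.trans huv).le hcap
  have hmeas : Measurable fun ω => ennExp (ENNReal.ofReal a * totalOccupation K u (N ω)) := by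
    obtain ⟨_, _, hP⟩ := hN
    have : Measurable fun ω => totalOccupation K u (N ω) :=
      (measurable_totalOccupation K u).comp hP.measurable
    fun_prop
  have hsub : {ω | ENNReal.ofReal (v * capacity K) ≤ totalOccupation K u (N ω)}
      ⊆ {ω | ENNReal.ofReal (Real.exp (a * (v * capacity K)))
        ≤ ennExp (ENNReal.ofReal a * totalOccupation K u (N ω))} := fun ω hω => by
    rw [Set.mem_ofPred_eq, ← ennExp_ofReal (mul_nonneg ha0 hv0), ENNReal.ofReal_mul ha0]
    exact ennExp_mono (mul_le_mul_right hω _)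
  refine (measure_mono hsub).trans ((meas_ge_le_lintegral_div hmeas.aemeasurable
    (ENNReal.ofReal_pos.2 (Real.exp_pos _)).ne' ENNReal.ofReal_ne_top).trans ?_)
  refine (ENNReal.div_le_div_right (hN.lintegral_ennExp_le hd K hu.le ha0 ha1) _).trans ?_
  rw [← ENNReal.ofReal_div_of_pos (Real.exp_pos _), ← Real.exp_sub]
  refine ENNReal.ofReal_le_ofReal (Real.exp_le_exp.2 (le_of_eq ?_))
  have h1 : a / (1 - a) = t / s - 1 := by
    rw [ha, sub_sub_cancel]
    field_simp
  rw [h1, ha, hu2, hv2]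
  field_simp
  ring

/-- Large deviations below the mean. -/
theorem IsInterlacementProcess.measure_totalOccupation_le (hd : 3 ≤ d)
    (hN : IsInterlacementProcess P N) (K : Finset (Site d)) {u v : ℝ} (hv : 0 < v) (hvu : v < u) :
    P {ω | totalOccupation K u (N ω) ≤ ENNReal.ofReal (v * capacity K)}
      ≤ ENNReal.ofReal (Real.exp (-(√u - √v) ^ 2 * capacity K)) := by
  have hcap := capacity_nonneg K
  have hu := hv.trans hvu
  have ht : 0 < √v := Real.sqrt_pos.2 hv
  have hts : √v < √u := Real.sqrt_lt_sqrt hv.le hvu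
  have hs : 0 < √u := ht.trans hts
  have hu2 : u = √u ^ 2 := (Real.sq_sqrt hu.le).symm
  have hv2 : v = √v ^ 2 := (Real.sq_sqrt hv.le).symm
  set s := √u
  set t := √v
  -- The minimizer of `b v - u b/(1+b)`, with minimum `-(s - t)²`.
  set b := s / t - 1 with hb
  have hb0 : 0 ≤ b := by
    rw [hb, sub_nonneg, one_le_div ht]; exact hts.le
  have hv0 : 0 ≤ v * capacity K := mul_nonneg hv.le hcap
  have hmeas : Measurable fun ω => (ennExp (ENNReal.ofReal b * totalOccupation K u (N ω)))⁻¹ := by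
    obtain ⟨_, _, hP⟩ := hN
    have : Measurable fun ω => totalOccupation K u (N ω) :=
      (measurable_totalOccupation K u).comp hP.measurable
    fun_prop
  have hsub : {ω | totalOccupation K u (N ω) ≤ ENNReal.ofReal (v * capacity K)}
      ⊆ {ω | ENNReal.ofReal (Real.exp (-(b * (v * capacity K))))
        ≤ (ennExp (ENNReal.ofReal b * totalOccupation K u (N ω)))⁻¹} := fun ω hω => by
    rw [Set.mem_ofPred_eq, Real.exp_neg, ENNReal.ofReal_inv_of_pos (Real.exp_pos _),
      ← ennExp_ofReal (mul_nonneg hb0 hv0), ENNReal.ofReal_mul hb0]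
    exact ENNReal.inv_le_inv.2 (ennExp_mono (mul_le_mul_right hω _))
  refine (measure_mono hsub).trans ((meas_ge_le_lintegral_div hmeas.aemeasurable
    (ENNReal.ofReal_pos.2 (Real.exp_pos _)).ne' ENNReal.ofReal_ne_top).trans ?_)
  refine (ENNReal.div_le_div_right (hN.lintegral_inv_ennExp_le hd K hu.le hb0) _).trans ?_
  rw [← ENNReal.ofReal_div_of_pos (Real.exp_pos _), ← Real.exp_sub]
  refine ENNReal.ofReal_le_ofReal (Real.exp_le_exp.2 (le_of_eq ?_))
  have h1 : b / (1 + b) = 1 - t / s := by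
    rw [hb, add_sub_cancel]
    field_simp
  rw [h1, hb, hu2, hv2]
  field_simp
  ring

lemma observable_eq (L : ℕ) (C : Finset (Site d)) (u : ℝ) (η : Measure (PathClass d × ℝ)) :
    observable L C u η = ∫⁻ p in visiting (boxUnion L C) ×ˢ Set.Iic u,
      ∑' k, ENNReal.ofReal (((onward (boxUnion L C) p.1).1 k).2
        * potential L C ((onward (boxUnion L C) p.1).1 k).1) ∂η := by
  unfold observable onwardMeasure
  simp only [lintegral_position]
  have hV : Measurable (potential L C) := Measurable.of_discrete
  have hm : Measurable fun w : ForwardPath d =>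
      ∑' k, ENNReal.ofReal ((w.1 k).2 * potential L C (w.1 k).1) := by
    have : Measurable fun w : ℕ → Site d × ℝ =>
      ∑' k, ENNReal.ofReal ((w k).2 * potential L C (w k).1) := by fun_prop
    exact this.comp measurable_subtype_coe
  have ho : Measurable fun p : PathClass d × ℝ => onward (boxUnion L C) p.1 :=
    (measurable_onward _).comp measurable_fst
  rw [lintegral_map hm ho]

lemma observable_le {L : ℕ} {C : Finset (Site d)} {c : ℝ} (hc : 0 ≤ c)
    (h : ∀ x, potential L C x ≤ c * equilibrium (boxUnion L C) x) (u : ℝ)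
    (η : Measure (PathClass d × ℝ)) :
    observable L C u η ≤ ENNReal.ofReal c * totalOccupation (boxUnion L C) u η := by
  rw [observable_eq, const_mul_totalOccupation]
  refine lintegral_mono fun p => ?_
  simp only [occupation, ← ENNReal.tsum_mul_left]
  refine ENNReal.tsum_le_tsum fun k => ?_
  rw [← ENNReal.ofReal_mul hc]
  refine ENNReal.ofReal_le_ofReal ?_
  have := mul_le_mul_of_nonneg_left (h ((onward (boxUnion L C) p.1).1 k).1)
    ((onward (boxUnion L C) p.1).2.2.1 k).le
  linarith

lemma le_observable {L : ℕ} {C : Finset (Site d)} {c : ℝ} (hc : 0 ≤ c)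
    (h : ∀ x, c * equilibrium (boxUnion L C) x ≤ potential L C x) (u : ℝ)
    (η : Measure (PathClass d × ℝ)) :
    ENNReal.ofReal c * totalOccupation (boxUnion L C) u η ≤ observable L C u η := by
  rw [observable_eq, const_mul_totalOccupation]
  refine lintegral_mono fun p => ?_
  simp only [occupation, ← ENNReal.tsum_mul_left]
  refine ENNReal.tsum_le_tsum fun k => ?_
  rw [← ENNReal.ofReal_mul hc]
  refine ENNReal.ofReal_le_ofReal ?_
  have := mul_le_mul_of_nonneg_left (h ((onward (boxUnion L C) p.1).1 k).1)
    ((onward (boxUnion L C) p.1).2.2.1 k).le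
  linarith

end deviations
end Interlacement
end

/-! ### The deviation bounds for the observable. -/

theorem proposition4p4 (d : ℕ) (hd : 3 ≤ d) :
    ∃ c : ℝ, 0 < c ∧
      ∀ {Ω : Type*} [MeasurableSpace Ω] (P : Measure Ω) [IsProbabilityMeasure P]
        (N : Ω → Measure (Interlacement.PathClass d × ℝ)),
        Interlacement.IsInterlacementProcess P N →
        ∀ (ε u uminus uplus : ℝ), 0 < ε → ε < 1 →
          0 < uminus / (1 - ε) → uminus / (1 - ε) < u → u < uplus / (1 + ε) →
        ∀ (K L : ℕ), 100 ≤ K → c / ε ≤ K → 1 ≤ L →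
        ∀ C : Finset (Interlacement.Site d), Interlacement.IsSeparated K L C →
          P {ω | ENNReal.ofReal (uplus * Interlacement.capacity (Interlacement.boxUnion L C))
                ≤ Interlacement.observable L C u (N ω)}
              ≤ ENNReal.ofReal (Real.exp (-(√(uplus / (1 + ε)) - √u) ^ 2
                  * Interlacement.capacity (Interlacement.boxUnion L C))) ∧
          P {ω | Interlacement.observable L C u (N ω)
                ≤ ENNReal.ofReal
                    (uminus * Interlacement.capacity (Interlacement.boxUnion L C))}
              ≤ ENNReal.ofReal (Real.exp (-(√u - √(uminus / (1 - ε))) ^ 2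
                  * Interlacement.capacity (Interlacement.boxUnion L C))) := by
  refine ⟨25920 * d ^ 2 * (48 * d * 104 ^ d) ^ 2, by
    have : (0 : ℝ) < d := by exact_mod_cast (by omega : 0 < d)
    positivity, ?_⟩
  intro Ω _ P _ N hN ε u uminus uplus hε hε1 hum hmu hup K L hK hcK hL C hC
  have hcomp := Interlacement.potential_comparison hd hε hε1 hK hcK hL hC
  have hcancel : ∀ {c x : ℝ}, 0 < c → ENNReal.ofReal c
      * ENNReal.ofReal (x / c * Interlacement.capacity (Interlacement.boxUnion L C))
      = ENNReal.ofReal (x * Interlacement.capacity (Interlacement.boxUnion L C)) :=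
    fun {c x} hc => by
      rw [← ENNReal.ofReal_mul hc.le]
      congr 1
      field_simp
  have h1 : 0 < 1 + ε := by linarith
  have h2 : 0 < 1 - ε := by linarith
  constructor
  -- Since the observable is at most `1 + ε` times the total occupation, the latter must exceed the
  -- level `uplus / (1 + ε)`, still above its mean level `u`. The lower bound is symmetric, with `1
  -- - ε`.
  · refine (measure_mono fun ω hω => ?_).trans (hN.measure_le_totalOccupation hd
      (Interlacement.boxUnion L C) (hum.trans hmu) hup)
    have := le_trans (Set.mem_ofPred_eq.mp hω)
      (Interlacement.observable_le h1.le (fun x => (hcomp x).2) u (N ω))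
    rw [← hcancel h1] at this
    exact (ENNReal.mul_le_mul_iff_right (ENNReal.ofReal_pos.2 h1).ne' ENNReal.ofReal_ne_top).1 this
  · refine (measure_mono fun ω hω => ?_).trans (hN.measure_totalOccupation_le hd
      (Interlacement.boxUnion L C) hum hmu)
    have := le_trans (Interlacement.le_observable h2.le (fun x => (hcomp x).1) u (N ω))
      (Set.mem_ofPred_eq.mp hω)
    rw [← hcancel h2] at this
    exact (ENNReal.mul_le_mul_iff_right (ENNReal.ofReal_pos.2 h2).ne' ENNReal.ofReal_ne_top).1 this
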